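/- Let $p$ be a prime, let $n\ge 0$ and $d\ge n+1$, let $x^{\mathbf b_1},\dots,x^{\mathbf b_N}$ be all the monomials of degree $d$ in $x_0,\dots,x_n$, ordered so that the first $M=\binom{d-1}{n}$ of them are those divisible by $x_0\cdots x_n$, and put $\mathbf a_k=(\mathbf b_k,1)\in\mathbb N^{n+2}$. Let $|\cdot|$ be the absolute value of $\mathbb C_p$ with $|p|=p^{-1}$, and let $\gamma_0\in\mathbb C_p$ satisfy $\sum_{i\ge0}\gamma_0^{p^i}/p^i=0$ and $|\gamma_0|^{p-1}=p^{-1}$. **The region $\mathcal D$.** For $1\le i,j\le M$ let $$B_{ij}(\Lambda)=\Lambda_i^{-p}\Lambda_j\sum_{\nu\in\mathbb N^N,\ \sum_k\nu_k\mathbf a_k=p\mathbf a_i-\mathbf a_j}\frac{\Lambda^\nu}{\nu_1!\cdots\nu_N!},\qquad D(\Lambda)=\det\big(B_{ij}(\Lambda)\big),$$ and let $\mathcal D$ be the set of $\lambda\in\mathbb C_p^N$ with $|\lambda_k|=1$ for $k\le M$, $|\lambda_k|\le1$ for $k>M$ and $|D(\lambda)|=1$. **The rings.** For $i\le M$ and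 $u\in\mathbb Z^{n+2}$ put $L_{i,u}=\{l\in\mathbb Z^N:\sum_kl_k\mathbf a_k=u,\ l_i\le0,\ l_k\ge0\ (k\ne i)\}$, and let $E$ be the set of integer points of the real cone generated by $\bigcup_{i\le M}L_{i,\mathbf 0}$. Let $R_E$ be the ring of series $\sum_{l\in E}c_l\Lambda^l$ with bounded coefficients $c_l\in\mathbb C_p$. Let $\mathbb B$ be the Banach space of all Laurent series $\sum_{l\in\mathbb Z^N}c_l\Lambda^l$ with bounded coefficients in $\mathbb C_p$ and norm $\sup_l|c_l|$. Let $R'_E$ be the closure in $\mathbb B$ of the set of fractions $h/D^k$, where $k\in\mathbb N$ and $h$ is a Laurent polynomial over $\mathbb C_p$ with exponents in $E$ ($D$ is invertible in $R_E$). Let $R'$ be the closure in $\mathbb B$ of $R'_E[\Lambda_1^{\pm1},\dots,\Lambda_M^{\pm1},\Lambda_{M+1},\dots,\Lambda_N]$, and let $R'_{\mathbf 0}$ consist of the $\sum_lc_l\Lambda^l\in R'$ with $\sum_kl_k\mathbf a_k=\mathbf 0$ whenever $c_l\ne0$. Evaluating the $h/D^k$ and monomials at $\lambda\in\mathcal D$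 and passing to limits makes each $\xi\in R'$ a function $\lambda\mapsto\xi(\lambda)$ on $\mathcal D$. **The matrix $\mathcal G$.** Put $\gamma_j=\sum_{i=0}^j\gamma_0^{p^i}/p^i$ and define $\hat\theta_{1,r}$ by $\prod_{j\ge1}\exp(\gamma_jt^{p^j})=\sum_{r\ge0}\frac{\hat\theta_{1,r}}{r!}(\gamma_0t)^r$. For $i\le M$ and $u\in\mathbb Z^{n+2}$ with all coordinates negative put $$F^{(i)}_u(\Lambda)=\sum_{l\in L_{i,u}}\frac{(-1)^{-l_i-1}(-l_i-1)!}{\prod_{k\ne i}l_k!}\Lambda^l,\qquad G^{(i)}_u(\Lambda)=\sum_{\nu\in\mathbb N^N}\Big(\prod_{k=1}^N\frac{\hat\theta_{1,\nu_k}}{\nu_k!}\Big)\Lambda^\nu F^{(i)}_{u-\sum_k\nu_k\mathbf a_k}(\Lambda),$$ and let $G(\Lambda)$ be the $M\times M$ matrix with entries $\Lambda_jG^{(i)}_{-\mathbf a_j}(\Lambda)$. **Proposition.** The sums defining the coefficients of the entries of $G(\Lambda)$ converge, and $G(\Lambda^p)$ is invertible. The matrix $\mathcal G(\Lambda)=G(\Lambda^p)^{-1}G(\Lambda)$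 has entries in $R'_{\mathbf 0}$; its determinant is invertible in $R'_{\mathbf 0}$, and both $\det\mathcal G(\Lambda)$ and $(\det\mathcal G(\Lambda))^{-1}$ have norm $1$. For every $\lambda\in\mathcal D$ the values at $\lambda$ of the entries of $\mathcal G(\Lambda)$ are well defined, and all eigenvalues of the matrix $\mathcal G(\lambda)$, as well as all roots $t$ of $\det(I-t\,\mathcal G(\lambda))$, are $p$-adic units, that is, have absolute value $1$. -/

import Mathlib

noncomputable section

namespace HasseWitt

/-! ### Monomials, exponents and cones -/

/-- The (indices of the) monomials `x^b` of degree `d` in the variables `x_0, …, x_n`. -/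
abbrev Mon (n d : ℕ) : Type := ↥(Finset.piAntidiag (Finset.univ : Finset (Fin (n + 1))) d)

/-- The (indices of the) monomials of degree `d` divisible by `x_0 ⋯ x_n`, that is, the set `U`. -/
abbrev IntMon (n d : ℕ) : Type := {k : Mon n d // ∀ i, 0 < k.1 i}

/-- The augmented exponent vector `a_k = (b_k, 1)`. -/
def aVec {n d : ℕ} (k : Mon n d) : Fin (n + 2) → ℤ :=
  Fin.snoc (α := fun _ => ℤ) (fun i : Fin (n + 1) => (k.1 i : ℤ)) 1

/-- Exponent vectors `l ∈ ℤ^N` of Laurent series in the variables `Λ_k`. -/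
structure Expo (n d : ℕ) where
  /-- The coordinates `l_k`. -/
  coord : Mon n d → ℤ

instance (n d : ℕ) : CoeFun (Expo n d) (fun _ => Mon n d → ℤ) := ⟨Expo.coord⟩

@[ext] theorem Expo.ext' {n d : ℕ} {l m : Expo n d} (h : ∀ k, l k = m k) : l = m := by
  cases l; cases m; congr 1; exact funext h

/-- Exponent vectors are the elements of the group `ℤ^N`. -/
def Expo.equivFun (n d : ℕ) : Expo n d ≃ (Mon n d → ℤ) :=
  ⟨Expo.coord, Expo.mk, fun _ => rfl, fun _ => rfl⟩

instance (n d : ℕ) : AddCommGroup (Expo n d) := (Expo.equivFun n d).addCommGroup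

@[simp] theorem Expo.add_apply {n d : ℕ} (l m : Expo n d) (k : Mon n d) :
    (l + m) k = l k + m k := rfl

@[simp] theorem Expo.zero_apply {n d : ℕ} (k : Mon n d) : (0 : Expo n d) k = 0 := rfl

@[simp] theorem Expo.neg_apply {n d : ℕ} (l : Expo n d) (k : Mon n d) : (-l) k = -l k := rfl

@[simp] theorem Expo.sub_apply {n d : ℕ} (l m : Expo n d) (k : Mon n d) :
    (l - m) k = l k - m k := rfl

@[simp] theorem Expo.nsmul_apply {n d : ℕ} (r : ℕ) (l : Expo n d) (k : Mon n d) :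
    (r • l) k = r • l k := rfl

/-- The exponent of the monomial `Λ_k`. -/
def eVec {n d : ℕ} (k : Mon n d) : Expo n d := ⟨fun j => if j = k then 1 else 0⟩

/-- A vector of natural numbers as an exponent. -/
def natExpo {n d : ℕ} (ν : Mon n d → ℕ) : Expo n d := ⟨fun k => (ν k : ℤ)⟩

/-- The degree `∑_k l_k a_k` of `Λ^l`. -/
def degVec {n d : ℕ} (l : Expo n d) : Fin (n + 2) → ℤ := fun r => ∑ k, l k * aVec k r

/-- The set `L_{i,u}`; the set `L_i` is `relSet i 0`. -/
def relSet {n d : ℕ} (i : IntMon n d) (u : Fin (n + 2) → ℤ) : Set (Expo n d) :=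
  {l | degVec l = u ∧ l i.1 ≤ 0 ∧ ∀ k, k ≠ i.1 → 0 ≤ l k}

/-- The lattice points `E` of the real cone generated by the union of the sets `L_i`. -/
def coneSet (n d : ℕ) : Set (Expo n d) :=
  {l | (fun k => (l k : ℝ)) ∈ PointedCone.hull ℝ
    {v : Mon n d → ℝ | ∃ i : IntMon n d, ∃ m ∈ relSet i 0, v = fun k => (m k : ℝ)}}

/-! ### An ambient field of formal Laurent series

`ℤ^N` gets the linear order that compares first the values of the linear form `wt`, which is
positive on all nonzero elements of `E`, and breaks ties lexicographically.  Only finitely many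
points of `E` have weight below a given bound, so series with exponents in `E` are Hahn series
for this order, with the usual product.  The order serves only to embed the ring of series with
exponents in `E` into a field. -/

/-- The linear form `l ↦ ∑_k l_k ‖b_k‖²`. -/
def wt {n d : ℕ} (l : Expo n d) : ℤ := ∑ k, l k * ∑ r, (k.1 r : ℤ) ^ 2

/-- The exponent lattice, embedded in a lexicographic product. -/
def lexKey {n d : ℕ} (l : Expo n d) : ℤ ×ₗ Lex (Fin (Fintype.card (Mon n d)) → ℤ) :=
  toLex (wt l, toLex fun r => l ((Fintype.equivFin (Mon n d)).symm r))

theorem wt_add {n d : ℕ} (l m : Expo n d) : wt (l + m) = wt l + wt m := by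
  simp [wt, add_mul, Finset.sum_add_distrib]

theorem lexKey_add {n d : ℕ} (l m : Expo n d) : lexKey (l + m) = lexKey l + lexKey m := by
  unfold lexKey
  rw [wt_add]
  rfl

theorem lexKey_injective {n d : ℕ} : Function.Injective (lexKey : Expo n d → _) := by
  intro l m h
  have h2 := congrArg (fun z => ofLex (ofLex z).2) h
  ext k
  have := congrFun h2 (Fintype.equivFin (Mon n d) k)
  simpa [lexKey] using this

instance (n d : ℕ) : LinearOrder (Expo n d) := LinearOrder.lift' lexKey lexKey_injective

instance (n d : ℕ) : IsOrderedAddMonoid (Expo n d) :=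
  Function.Injective.isOrderedAddMonoid lexKey lexKey_add Iff.rfl

theorem wt_le_of_le {n d : ℕ} {l m : Expo n d} (h : l ≤ m) : wt l ≤ wt m := by
  have h' : lexKey l ≤ lexKey m := h
  rcases (Prod.Lex.le_iff).1 h' with h1 | h1
  · exact le_of_lt h1
  · exact le_of_eq h1.1

theorem degVec_castSucc {n d : ℕ} (l : Expo n d) (r : Fin (n + 1)) :
    degVec l r.castSucc = ∑ k, l k * (k.1 r : ℤ) := by
  simp [degVec, aVec]

theorem degVec_last {n d : ℕ} (l : Expo n d) : degVec l (Fin.last (n + 1)) = ∑ k, l k := by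
  simp [degVec, aVec]

/-- Points of `L_i` have coordinates bounded by their weight. -/
theorem abs_le_wt {n d : ℕ} {i : IntMon n d} {l : Expo n d} (hl : l ∈ relSet i 0)
    (j : Mon n d) : |l j| ≤ wt l := by
  obtain ⟨h0, hi, hk⟩ := hl
  have hs : ∑ k, l k = 0 := by rw [← degVec_last, h0]; rfl
  have hr : ∀ r : Fin (n + 1), ∑ k, l k * (k.1 r : ℤ) = 0 := fun r => by
    rw [← degVec_castSucc, h0]; rfl
  have hw : wt l = ∑ k, l k * ∑ r, ((k.1 r : ℤ) - (i.1.1 r : ℤ)) ^ 2 := by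
    have e : ∀ k : Mon n d, l k * ∑ r, ((k.1 r : ℤ) - (i.1.1 r : ℤ)) ^ 2 =
        l k * (∑ r, (k.1 r : ℤ) ^ 2) - (∑ r, 2 * (i.1.1 r : ℤ) * (l k * (k.1 r : ℤ)))
          + l k * ∑ r, (i.1.1 r : ℤ) ^ 2 := by
      intro k
      rw [Finset.mul_sum, Finset.mul_sum, Finset.mul_sum, ← Finset.sum_sub_distrib,
        ← Finset.sum_add_distrib]
      exact Finset.sum_congr rfl fun r _ => by ring
    simp only [e, Finset.sum_add_distrib, Finset.sum_sub_distrib, ← Finset.sum_mul, hs]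
    rw [Finset.sum_comm]
    simp only [← Finset.mul_sum, hr]
    simp [wt]
  have hpos : ∀ k : Mon n d, k ≠ i.1 → 1 ≤ ∑ r, ((k.1 r : ℤ) - (i.1.1 r : ℤ)) ^ 2 := by
    intro k hki
    obtain ⟨r, hr'⟩ : ∃ r, k.1 r ≠ i.1.1 r := by
      by_contra! h
      exact hki (Subtype.ext (funext h))
    have h1 : ((k.1 r : ℤ) - (i.1.1 r : ℤ)) ^ 2 ≤ ∑ r, ((k.1 r : ℤ) - (i.1.1 r : ℤ)) ^ 2 :=
      Finset.single_le_sum (f := fun r => ((k.1 r : ℤ) - (i.1.1 r : ℤ)) ^ 2)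
        (fun _ _ => sq_nonneg _) (Finset.mem_univ r)
    have h2 : ((k.1 r : ℤ) - (i.1.1 r : ℤ)) ≠ 0 := by
      intro h; apply hr'; omega
    have := Int.one_le_abs h2
    have h3 : 1 ≤ ((k.1 r : ℤ) - (i.1.1 r : ℤ)) ^ 2 := by
      rw [← sq_abs]; nlinarith
    linarith
  have hle : ∑ k ∈ Finset.univ.erase i.1, l k ≤ wt l := by
    rw [hw, ← Finset.add_sum_erase _ _ (Finset.mem_univ i.1)]
    simp only [sub_self, ne_eq, OfNat.ofNat_ne_zero, not_false_eq_true, zero_pow,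
      Finset.sum_const_zero, mul_zero, zero_add]
    refine Finset.sum_le_sum fun k hk' => ?_
    have hne := Finset.ne_of_mem_erase hk'
    nlinarith [hk k hne, hpos k hne]
  rw [← Finset.add_sum_erase _ _ (Finset.mem_univ i.1)] at hs
  by_cases hj : j = i.1
  · subst hj
    rw [abs_of_nonpos hi]
    linarith
  · rw [abs_of_nonneg (hk j hj)]
    refine le_trans ?_ hle
    exact Finset.single_le_sum (f := fun k => l k)
      (fun k hk' => hk k (Finset.ne_of_mem_erase hk'))
      (Finset.mem_erase.2 ⟨hj, Finset.mem_univ j⟩)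

theorem relSet_isPWO {n d : ℕ} (i : IntMon n d) : (relSet i 0).IsPWO := by
  rw [Set.isPWO_iff_isWF, Set.isWF_iff_no_descending_seq]
  intro f hf hmem
  have hfin : (Set.pi Set.univ
      (fun _ : Mon n d => Set.Icc (-(wt (f 0))) (wt (f 0)))).Finite :=
    Set.Finite.pi fun _ => Set.finite_Icc _ _
  have hsub : Set.range (fun k => (f k).coord) ⊆ Set.pi Set.univ
      (fun _ : Mon n d => Set.Icc (-(wt (f 0))) (wt (f 0))) := by
    rintro _ ⟨k, rfl⟩ j _
    have h1 := abs_le_wt (hmem k) j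
    have h2 := wt_le_of_le (hf.antitone (Nat.zero_le k))
    exact abs_le.1 (h1.trans h2)
  have hinj : Function.Injective fun k => (f k).coord := fun a b h =>
    hf.injective ((Expo.equivFun n d).injective h)
  exact Set.infinite_range_of_injective hinj (hfin.subset hsub)

/-- The ambient field of formal Laurent series over `ℂ_p`. -/
abbrev Series (p : ℕ) [Fact p.Prime] (n d : ℕ) : Type := HahnSeries (Expo n d) ℂ_[p]

theorem nsmul_strictMono (p : ℕ) [hp : Fact p.Prime] (n d : ℕ) :
    StrictMono fun l : Expo n d => p • l :=
  fun _ _ h => nsmul_lt_nsmul_right hp.out.ne_zero h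

/-- The substitution `ξ(Λ) ↦ ξ(Λ^p)`. -/
def frob {p : ℕ} [Fact p.Prime] {n d : ℕ} (ξ : Series p n d) : Series p n d :=
  HahnSeries.embDomain (OrderEmbedding.ofStrictMono _ (nsmul_strictMono p n d)) ξ

/-! ### Laurent polynomials, the matrix `B(Λ)` and its determinant -/

/-- Laurent polynomials over `ℂ_p` in the variables `Λ_k`. -/
abbrev LPoly (p : ℕ) [Fact p.Prime] (n d : ℕ) : Type := AddMonoidAlgebra ℂ_[p] (Expo n d)

/-- A Laurent polynomial as a formal series. -/
def LPoly.toSeries {p : ℕ} [Fact p.Prime] {n d : ℕ} (h : LPoly p n d) : Series p n d :=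
  HahnSeries.ofFinsupp h.coeff

/-- The value of a Laurent polynomial at a point. -/
def LPoly.eval {p : ℕ} [Fact p.Prime] {n d : ℕ} (pt : Mon n d → ℂ_[p]) (h : LPoly p n d) :
    ℂ_[p] :=
  h.coeff.sum fun l c => c * ∏ k, pt k ^ l k

/-- The entry `H_{ij}(Λ) = ∑ Λ^ν / (ν_1! ⋯ ν_N!)`, the sum over `ν ∈ ℕ^N` with
`∑_k ν_k a_k = p a_i - a_j`; the last coordinate of this equation says `∑_k ν_k = p - 1`. -/
def hEntry (p : ℕ) [Fact p.Prime] {n d : ℕ} (i j : IntMon n d) : LPoly p n d :=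
  ∑ ν ∈ (Finset.piAntidiag (Finset.univ : Finset (Mon n d)) (p - 1)).filter
      (fun ν => degVec (natExpo ν) = (p : ℤ) • aVec i.1 - aVec j.1),
    AddMonoidAlgebra.single (natExpo ν) (∏ k, ((ν k).factorial : ℂ_[p]))⁻¹

/-- The matrix `B(Λ)` with entries `Λ_i^{-p} Λ_j H_{ij}(Λ)`. -/
def bMat (p : ℕ) [Fact p.Prime] (n d : ℕ) : Matrix (IntMon n d) (IntMon n d) (LPoly p n d) :=
  fun i j => AddMonoidAlgebra.single (eVec j.1 - p • eVec i.1) 1 * hEntry p i j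

/-- `D(Λ) = det B(Λ)`. -/
def detB (p : ℕ) [Fact p.Prime] (n d : ℕ) : LPoly p n d := (bMat p n d).det

/-- The region `𝒟 ⊆ ℂ_p^N`. -/
def region (p : ℕ) [Fact p.Prime] (n d : ℕ) : Set (Mon n d → ℂ_[p]) :=
  {pt | (∀ k, (∀ i, 0 < k.1 i) → ‖pt k‖ = 1) ∧ (∀ k, ‖pt k‖ ≤ 1) ∧
    ‖(detB p n d).eval pt‖ = 1}

/-! ### The rings `R'_E`, `R'`, `R'_0` and their elements as functions on `𝒟` -/

/-- The Banach space `𝔹` of Laurent series with bounded coefficients, with the sup norm. -/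
abbrev BSpace (p : ℕ) [Fact p.Prime] (n d : ℕ) : Type :=
  lp (fun _ : Expo n d => ℂ_[p]) ⊤

/-- The element `b ∈ 𝔹` and the series `ξ` have the same coefficients. -/
def SameCoeff {p : ℕ} [Fact p.Prime] {n d : ℕ} (b : BSpace p n d) (ξ : Series p n d) : Prop :=
  ∀ l, b l = ξ.coeff l

/-- The graph of the evaluation at `pt` on `L_{E,D}`: pairs `(h/D^k, h(pt)/D(pt)^k)` where `h` is
a Laurent polynomial with exponents in `E`. -/
def graphFrac {p : ℕ} [Fact p.Prime] {n d : ℕ} (pt : Mon n d → ℂ_[p]) :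
    Set (BSpace p n d × ℂ_[p]) :=
  {x | ∃ (h : LPoly p n d) (k : ℕ), (∀ l, h.coeff l ≠ 0 → l ∈ coneSet n d) ∧
    SameCoeff x.1 (h.toSeries / (detB p n d).toSeries ^ k) ∧
    x.2 = h.eval pt / (detB p n d).eval pt ^ k}

/-- The subring `L_{E,D}` of `𝔹`: the fractions `h/D^k` where `h` is a Laurent polynomial with
exponents in `E`. -/
def fracSet (p : ℕ) [Fact p.Prime] (n d : ℕ) : Set (BSpace p n d) :=
  {b | ∃ (h : LPoly p n d) (k : ℕ), (∀ l, h.coeff l ≠ 0 → l ∈ coneSet n d) ∧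
    SameCoeff b (h.toSeries / (detB p n d).toSeries ^ k)}

/-- `R'_E`: the completion (that is, the closure in `𝔹`) of `L_{E,D}`. -/
def ringRE (p : ℕ) [Fact p.Prime] (n d : ℕ) : Set (BSpace p n d) := closure (fracSet p n d)

/-- The exponents of the monomials in the ring
`ℂ_p[Λ_k^{±1} (k ∈ U), Λ_k (k ∉ U)]`. -/
def monoSet (n d : ℕ) : Set (Expo n d) := {l | ∀ k, (¬ ∀ i, 0 < k.1 i) → 0 ≤ l k}

/-- `R̃' = R'_E[Λ_k^{±1} (k ∈ U), Λ_k (k ∉ U)]`: finite sums `∑_l Λ^l ξ_l` with `ξ_l ∈ R'_E`. -/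
def ringRtilde (p : ℕ) [Fact p.Prime] (n d : ℕ) : Set (BSpace p n d) :=
  {b | ∃ (s : Finset (Expo n d)) (ξ : Expo n d → BSpace p n d),
    (∀ l ∈ s, l ∈ monoSet n d ∧ ξ l ∈ ringRE p n d) ∧ ∀ m, b m = ∑ l ∈ s, ξ l (m - l)}

/-- `R'`: the completion (that is, the closure in `𝔹`) of `R̃'`. -/
def ringR (p : ℕ) [Fact p.Prime] (n d : ℕ) : Set (BSpace p n d) := closure (ringRtilde p n d)

/-- `R'_0`: the elements of `R'` that are homogeneous of degree `0`. -/
def ringR0 (p : ℕ) [Fact p.Prime] (n d : ℕ) : Set (BSpace p n d) :=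
  {b | b ∈ ringR p n d ∧ ∀ l, b l ≠ 0 → degVec l = 0}

/-- `z` is the value at `pt` of `ξ ∈ R'_E`: the limit of `h_m(pt)/D(pt)^{k_m}` for some fractions
`h_m/D^{k_m}` in `L_{E,D}` that converge to `ξ`. -/
def IsValueRE {p : ℕ} [Fact p.Prime] {n d : ℕ} (pt : Mon n d → ℂ_[p]) (ξ : BSpace p n d)
    (z : ℂ_[p]) : Prop :=
  (ξ, z) ∈ closure (graphFrac pt)

/-- The graph of the evaluation at `pt` on `R̃'`: the value of `∑_l Λ^l ξ_l` is
`∑_l pt^l ξ_l(pt)`. -/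
def graphRtilde {p : ℕ} [Fact p.Prime] {n d : ℕ} (pt : Mon n d → ℂ_[p]) :
    Set (BSpace p n d × ℂ_[p]) :=
  {x | ∃ (s : Finset (Expo n d)) (ξ : Expo n d → BSpace p n d) (ζ : Expo n d → ℂ_[p]),
    (∀ l ∈ s, l ∈ monoSet n d ∧ IsValueRE pt (ξ l) (ζ l)) ∧
    (∀ m, x.1 m = ∑ l ∈ s, ξ l (m - l)) ∧ x.2 = ∑ l ∈ s, (∏ k, pt k ^ l k) * ζ l}

/-- `z` is the value at `pt` of `ξ ∈ R'`: the limit of the values at `pt` of some sequence in `R̃'`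
that converges to `ξ`. -/
def IsValue {p : ℕ} [Fact p.Prime] {n d : ℕ} (pt : Mon n d → ℂ_[p]) (ξ : BSpace p n d)
    (z : ℂ_[p]) : Prop :=
  (ξ, z) ∈ closure (graphRtilde pt)

/-! ### The matrices `G(Λ)` and `𝒢(Λ)` -/

/-- `γ_j = ∑_{i ≤ j} γ_0^{p^i} / p^i`. -/
def gam {p : ℕ} [Fact p.Prime] (γ₀ : ℂ_[p]) (j : ℕ) : ℂ_[p] :=
  ∑ i ∈ Finset.range (j + 1), γ₀ ^ p ^ i / (p : ℂ_[p]) ^ i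

/-- The power series `exp(c t^m)` (for `m ≥ 1`). -/
def expMono {p : ℕ} [Fact p.Prime] (c : ℂ_[p]) (m : ℕ) : PowerSeries ℂ_[p] :=
  PowerSeries.mk fun r => if m ∣ r then c ^ (r / m) / ((r / m).factorial : ℂ_[p]) else 0

/-- The power series `∏_{j ≥ 1} exp(γ_j t^{p^j})`.  The factors with `j > r` are congruent to `1`
modulo `t^{r + 1}`, so they do not contribute to the coefficient of `t^r`. -/
def thetaOne {p : ℕ} [Fact p.Prime] (γ₀ : ℂ_[p]) : PowerSeries ℂ_[p] :=
  PowerSeries.mk fun r =>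
    PowerSeries.coeff r (∏ j ∈ Finset.Icc 1 r, expMono (gam γ₀ j) (p ^ j))

/-- The number `θ̂_{1,r} / r!`, where
`∏_{j ≥ 1} exp(γ_j t^{p^j}) = ∑_r (θ̂_{1,r} / r!) (γ_0 t)^r`. -/
def thetaOneCoeff {p : ℕ} [Fact p.Prime] (γ₀ : ℂ_[p]) (r : ℕ) : ℂ_[p] :=
  PowerSeries.coeff r (thetaOne γ₀) / γ₀ ^ r

open Classical in
/-- The coefficient of `Λ^l` in the `A`-hypergeometric series
`F_u^{(i)}(Λ) = ∑_{l ∈ L_{i,u}} (-1)^{-l_i-1} (-l_i-1)! / ∏_{k ≠ i} l_k! Λ^l`, for `u` with all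
coordinates negative (so that `l_i < 0` for `l ∈ L_{i,u}`). -/
def fCoeff (p : ℕ) [Fact p.Prime] {n d : ℕ} (i : IntMon n d) (u : Fin (n + 2) → ℤ)
    (l : Expo n d) : ℂ_[p] :=
  if l ∈ relSet i u then
    (-1) ^ (-l i.1 - 1).toNat * ((-l i.1 - 1).toNat.factorial : ℂ_[p]) /
      ∏ k ∈ Finset.univ.erase i.1, ((l k).toNat.factorial : ℂ_[p])
  else 0

/-- The terms of the coefficient of `Λ^l` in
`G_u^{(i)}(Λ) = ∑_{u' + u'' = u} F_{u'}^{(i)}(Λ) θ̂_{1,u''}(Λ)`, where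
`θ̂_{1,u''}(Λ) = ∑_ν (∏_k θ̂_{1,ν_k} / ν_k!) Λ^ν`, the sum over `ν ∈ ℕ^N` with
`∑_k ν_k a_k = u''`. -/
def gTerm {p : ℕ} [Fact p.Prime] (γ₀ : ℂ_[p]) {n d : ℕ} (i : IntMon n d)
    (u : Fin (n + 2) → ℤ) (l : Expo n d) (ν : Mon n d → ℕ) : ℂ_[p] :=
  fCoeff p i (u - degVec (natExpo ν)) (l - natExpo ν) * ∏ k, thetaOneCoeff γ₀ (ν k)

/-- The coefficient of `Λ^l` in `G_u^{(i)}(Λ)`. -/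
def gCoeff {p : ℕ} [Fact p.Prime] (γ₀ : ℂ_[p]) {n d : ℕ} (i : IntMon n d)
    (u : Fin (n + 2) → ℤ) (l : Expo n d) : ℂ_[p] :=
  ∑' ν : Mon n d → ℕ, gTerm γ₀ i u l ν

theorem degVec_add {n d : ℕ} (l m : Expo n d) : degVec (l + m) = degVec l + degVec m := by
  funext r
  simp [degVec, add_mul, Finset.sum_add_distrib]

theorem degVec_eVec {n d : ℕ} (j : Mon n d) : degVec (eVec j) = aVec j := by
  funext r
  simp [degVec, eVec]

theorem gCoeff_support {p : ℕ} [Fact p.Prime] (γ₀ : ℂ_[p]) {n d : ℕ} (i j : IntMon n d) :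
    (Function.support fun l : Expo n d => gCoeff γ₀ i (-aVec j.1) (l - eVec j.1)) ⊆
      relSet i 0 := by
  intro l hl
  have hex : ∃ ν : Mon n d → ℕ, gTerm γ₀ i (-aVec j.1) (l - eVec j.1) ν ≠ 0 := by
    by_contra! h
    exact hl (by simp [gCoeff, h])
  obtain ⟨ν, hν⟩ := hex
  have hmem : l - eVec j.1 - natExpo ν ∈ relSet i (-aVec j.1 - degVec (natExpo ν)) := by
    by_contra h
    exact hν (by simp [gTerm, fCoeff, h])
  obtain ⟨h1, -, h3⟩ := hmem
  have hdeg : degVec l = 0 := by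
    have e : l = (l - eVec j.1 - natExpo ν) + (eVec j.1 + natExpo ν) := by abel
    rw [e, degVec_add, degVec_add, h1, degVec_eVec]
    abel
  have hk : ∀ k, k ≠ i.1 → 0 ≤ l k := by
    intro k hki
    have := h3 k hki
    have h4 : 0 ≤ eVec j.1 k := by
      simp only [eVec]; split_ifs <;> norm_num
    have h5 : 0 ≤ natExpo ν k := by simp [natExpo]
    simp only [Expo.sub_apply] at this
    linarith
  refine ⟨hdeg, ?_, hk⟩
  have hs : ∑ k, l k = 0 := by rw [← degVec_last, hdeg]; rfl
  rw [← Finset.add_sum_erase _ _ (Finset.mem_univ i.1)] at hs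
  have : 0 ≤ ∑ k ∈ Finset.univ.erase i.1, l k :=
    Finset.sum_nonneg fun k hk' => hk k (Finset.ne_of_mem_erase hk')
  linarith

/-- The matrix `G(Λ)` with entries `G_{ij}(Λ) = Λ_j G^{(i)}_{-a_j}(Λ)`. -/
def gMat {p : ℕ} [Fact p.Prime] (γ₀ : ℂ_[p]) (n d : ℕ) :
    Matrix (IntMon n d) (IntMon n d) (Series p n d) :=
  fun i j =>
    { coeff := fun l => gCoeff γ₀ i (-aVec j.1) (l - eVec j.1)
      isPWO_support' := (relSet_isPWO i).mono (gCoeff_support γ₀ i j) }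

/-- The matrix `𝒢(Λ) = G(Λ^p)⁻¹ G(Λ)`. -/
def calG {p : ℕ} [Fact p.Prime] (γ₀ : ℂ_[p]) (n d : ℕ) :
    Matrix (IntMon n d) (IntMon n d) (Series p n d) :=
  ((gMat γ₀ n d).map frob)⁻¹ * gMat γ₀ n d

end HasseWitt

end

set_option linter.unusedSectionVars false

/-! The series $G_u^{(i)}$ are fixed by Dwork's Frobenius operator, and this determines $\mathcal G$
by successive approximation modulo powers of $p$.

In one variable put $\theta=\prod_{j\ge1}\exp(\gamma_j(T/\gamma_0)^{p^j})$ and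
$\hat\theta=\exp(T)\,\theta$. Then $\hat\theta(T)=\hat\theta(T^p/\gamma_0^{p-1})\,AH(T)$ with the
Artin-Hasse exponential $AH$, which is $p$-integral, while the divided power coefficients of
$\theta$ decay like $p^{-r/2}$. The negative exponents are governed by the functional
$T^{m+1}\mapsto(-1)^m m!$, which inverts $T\,d/dT+T=\exp(-T)\circ T\,d/dT\circ\exp(T)$. Since
$\psi\circ T\,d/dT=p\,T\,d/dT\circ\psi$, the numbers `polarHat` satisfy the same functional equation
as the coefficients of $\hat\theta$, up to a factor $p$ (`hasSum_polarHat_frob`,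
`sum_coeff_thetaHat_frob`). A coefficient of $G_u^{(i)}$ is one polar number times coefficients of
$\hat\theta$ (`hasSum_gTerm`). Multiplying the equations gives $G_u(\Lambda)=\sum_\rho
c_\rho\Lambda^\rho G_v(\Lambda^p)$ with $v=(u-\deg\rho)/p$, where $|c_\rho|\le p^{-K}$ as soon as
the last coordinate of $v$ is at most $-K-1$ (`hasSum_frobTerm`, `norm_frobCoeff_le`).

The exponents in $G$ are nonnegative for the order of the lattice and its constant term is a unit
multiple of the identity, so $G$ is invertible over integral series. Let $H_u=G^{-1}(G_u^{(i)})_i$.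
Then $\mathcal G H_u=\sum_\rho c_\rho\Lambda^\rho H_v(\Lambda^p)$, and $H_{-\mathbf a_j}$ is
$\Lambda_j^{-1}$ times a unit vector. Terms whose $v$ has last coordinate $-1$ are therefore
monomials, and all others are divisible by $p$. Two things follow. Firstly $\mathcal G\equiv wB$
modulo $p$ for the unit $w=\gamma_0^{p-1}/p$ (`bdd_calG_sub`), so $\det\mathcal G\equiv w^MD$.
Secondly, knowing all $H_v$ modulo $p^m$ gives $\mathcal G H_u$, hence $\mathcal G$, $\mathcal
G^{-1}$ and $H_u$, modulo $p^{m+1}$. Because $D(\Lambda^p)\equiv D(\Lambda)^p$, the approximations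
remain fractions with a power of $D$ as denominator (`hSer_mem_approxRing`).

On $\mathcal D$ one has $|D(\lambda)|=1$, so the value of a fraction is bounded by its norm and
evaluation extends to limits (`limGraph_unique`). Evaluating $\det\mathcal G$ and its inverse shows
that $\mathcal G(\lambda)$ is an integral matrix with unit determinant, whose eigenvalues are units.
-/

namespace HasseWitt

/-! ### Exponentials of formal power series -/

section FormalExp

open PowerSeries

variable {K : Type*} [Field K] [CharZero K]

/-- A solution of `X' = a' X` is determined up to order `r` by its constant term and by the
coefficients of `a` up to order `r`. -/
theorem coeff_eq_of_derivative_eq {a b X Y : PowerSeries K} (hX : d⁄dX K X = d⁄dX K a * X)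
    (hY : d⁄dX K Y = d⁄dX K b * Y) (h0 : constantCoeff X = constantCoeff Y) (r : ℕ)
    (hab : ∀ s ≤ r, coeff s a = coeff s b) : ∀ s ≤ r, coeff s X = coeff s Y := by
  intro s
  induction s using Nat.strong_induction_on with
  | _ s ih =>
    intro hs
    rcases s with _ | s
    · simpa using h0
    · have h1 := congrArg (coeff s) hX
      have h2 := congrArg (coeff s) hY
      rw [coeff_derivative, coeff_mul] at h1 h2
      have h3 : coeff (s + 1) X * ((s : K) + 1) = coeff (s + 1) Y * ((s : K) + 1) := by
        rw [h1, h2]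
        refine Finset.sum_congr rfl fun x hx => ?_
        rw [Finset.HasAntidiagonal.mem_antidiagonal] at hx
        rw [coeff_derivative, coeff_derivative, hab _ (by omega), ih x.2 (by omega) (by omega)]
      exact mul_right_cancel₀ (by exact_mod_cast Nat.succ_ne_zero s) h3

/-- The exponential `exp(a)` of a power series without constant term. -/
noncomputable def expS (a : PowerSeries K) : PowerSeries K := (exp K).subst a

theorem derivative_expS {a : PowerSeries K} (ha : constantCoeff a = 0) :
    d⁄dX K (expS a) = d⁄dX K a * expS a := by
  rw [expS, derivative_subst (HasSubst.of_constantCoeff_zero' ha), derivative_exp, mul_comm]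

theorem constantCoeff_expS {a : PowerSeries K} (ha : constantCoeff a = 0) :
    constantCoeff (expS a) = 1 := by
  rw [expS]
  have h := constantCoeff_subst (HasSubst.of_constantCoeff_zero' ha) (exp K)
  change constantCoeff (subst a (exp K)) = _ at h
  rw [h, finsum_eq_single _ 0]
  · simp
  · intro n hn
    have : MvPowerSeries.constantCoeff (a ^ n) = 0 := by
      rw [map_pow]
      change constantCoeff a ^ n = 0
      rw [ha, zero_pow hn]
    rw [this, smul_zero]

/-- Uniqueness for $X'=a'X$. The exponential identities below are obtained by checking this equation
and a constant term. -/
theorem eq_expS {a X : PowerSeries K} (ha : constantCoeff a = 0)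
    (hX : d⁄dX K X = d⁄dX K a * X) (h0 : constantCoeff X = 1) : X = expS a := by
  ext r
  exact coeff_eq_of_derivative_eq hX (derivative_expS ha) (by rw [h0, constantCoeff_expS ha]) r
    (fun _ _ => rfl) r le_rfl

/-- Allows exponents to be truncated, which replaces infinite products of exponentials by finite
ones. -/
theorem coeff_expS_congr {a b : PowerSeries K} (ha : constantCoeff a = 0)
    (hb : constantCoeff b = 0) {r : ℕ} (hab : ∀ s ≤ r, coeff s a = coeff s b) :
    coeff r (expS a) = coeff r (expS b) :=
  coeff_eq_of_derivative_eq (derivative_expS ha) (derivative_expS hb)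
    (by rw [constantCoeff_expS ha, constantCoeff_expS hb]) r hab r le_rfl

theorem expS_add {a b : PowerSeries K} (ha : constantCoeff a = 0) (hb : constantCoeff b = 0) :
    expS (a + b) = expS a * expS b := by
  refine (eq_expS (by simp [ha, hb]) ?_ ?_).symm
  · rw [Derivation.leibniz, derivative_expS ha, derivative_expS hb, map_add, smul_eq_mul,
      smul_eq_mul]
    ring
  · rw [map_mul, constantCoeff_expS ha, constantCoeff_expS hb, one_mul]

theorem expS_zero : expS (0 : PowerSeries K) = 1 :=
  (eq_expS (by simp) (by simp) (by simp)).symm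

theorem expS_neg_mul_expS {a : PowerSeries K} (ha : constantCoeff a = 0) :
    expS (-a) * expS a = 1 := by
  rw [← expS_add (by simp [ha]) ha, neg_add_cancel, expS_zero]

theorem expS_sum {ι : Type*} (s : Finset ι) (a : ι → PowerSeries K)
    (ha : ∀ i ∈ s, constantCoeff (a i) = 0) : expS (∑ i ∈ s, a i) = ∏ i ∈ s, expS (a i) := by
  classical
  induction s using Finset.induction_on with
  | empty => simp [expS_zero]
  | insert i s hi ih =>
    rw [Finset.sum_insert hi, Finset.prod_insert hi, expS_add (ha i (Finset.mem_insert_self _ _)),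
      ih fun j hj => ha j (Finset.mem_insert_of_mem hj)]
    rw [map_sum]
    exact Finset.sum_eq_zero fun j hj => ha j (Finset.mem_insert_of_mem hj)

theorem expS_nsmul {a : PowerSeries K} (ha : constantCoeff a = 0) (m : ℕ) :
    expS (m • a) = expS a ^ m := by
  induction m with
  | zero => simp [expS_zero]
  | succ m ih => rw [succ_nsmul, expS_add (by simp [ha]) ha, ih, pow_succ]

theorem expS_X : expS (X : PowerSeries K) = exp K :=
  (eq_expS (by simp) (by rw [derivative_exp, derivative_X, one_mul]) (by simp)).symm

theorem expS_rescale {a : PowerSeries K} (ha : constantCoeff a = 0) (c : K) :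
    rescale c (expS a) = expS (rescale c a) := by
  rw [expS, expS, rescale_eq_subst, rescale_eq_subst,
    subst_comp_subst_apply (HasSubst.of_constantCoeff_zero' ha)]
  exact HasSubst.of_constantCoeff_zero' (by simp)

theorem expS_expand {a : PowerSeries K} (ha : constantCoeff a = 0) {m : ℕ} (hm : m ≠ 0) :
    expand m hm (expS a) = expS (expand m hm a) := by
  rw [expS, expS, expand_apply, expand_apply,
    subst_comp_subst_apply (HasSubst.of_constantCoeff_zero' ha)]
  exact HasSubst.of_constantCoeff_zero' (by simp [hm])

/-- The series on the right is the one that defines `expMono`. It comes from $\exp(T)$ by $T\mapsto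
cT$ followed by $T\mapsto T^m$. -/
theorem expS_smul_X_pow {m : ℕ} (hm : m ≠ 0) (c : K) :
    expS (c • (X : PowerSeries K) ^ m) =
      mk fun r => if m ∣ r then c ^ (r / m) / ((r / m).factorial : K) else 0 := by
  have h : c • (X : PowerSeries K) ^ m = expand m hm (rescale c X) := by
    rw [rescale_X, map_mul, expand_X, smul_eq_C_mul, expand_C]
  rw [h, ← expS_expand (by simp), ← expS_rescale (by simp), expS_X]
  ext r
  rw [coeff_expand, coeff_mk]
  split_ifs
  · rw [coeff_rescale, coeff_exp]
    simp [div_eq_mul_inv]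
  · rfl

/-- The power series `∑_j c_j T^{p^j}`. -/
noncomputable def powSeries (p : ℕ) (c : ℕ → K) : PowerSeries K :=
  mk fun s => ∑ j ∈ (Finset.range (s + 1)).filter fun j => p ^ j = s, c j

variable {p : ℕ}

theorem coeff_powSeries_pow (hp : 1 < p) (c : ℕ → K) (j : ℕ) :
    coeff (p ^ j) (powSeries p c) = c j := by
  rw [powSeries, coeff_mk, Finset.sum_eq_single j]
  · intro i hi hij
    rw [Finset.mem_filter] at hi
    exact absurd (Nat.pow_right_injective hp hi.2) hij
  · intro h
    exfalso
    apply h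
    rw [Finset.mem_filter, Finset.mem_range]
    exact ⟨(Nat.lt_pow_self hp).trans (Nat.lt_succ_self _), rfl⟩

theorem coeff_powSeries_of_ne {c : ℕ → K} {s : ℕ} (h : ∀ j, p ^ j ≠ s) :
    coeff s (powSeries p c) = 0 := by
  rw [powSeries, coeff_mk]
  refine Finset.sum_eq_zero fun j hj => ?_
  exact absurd (Finset.mem_filter.1 hj).2 (h j)

theorem powSeries_ext_iff (hp : 1 < p) {c : ℕ → K} {f : PowerSeries K}
    (h1 : ∀ j, coeff (p ^ j) f = c j) (h2 : ∀ s, (∀ j, p ^ j ≠ s) → coeff s f = 0) :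
    f = powSeries p c := by
  ext s
  by_cases h : ∃ j, p ^ j = s
  · obtain ⟨j, rfl⟩ := h
    rw [h1, coeff_powSeries_pow hp]
  · push Not at h
    rw [h2 s h, coeff_powSeries_of_ne h]

theorem constantCoeff_powSeries (hp : 1 < p) (c : ℕ → K) :
    constantCoeff (powSeries p c) = 0 := by
  rw [← coeff_zero_eq_constantCoeff_apply]
  exact coeff_powSeries_of_ne fun j => (pow_pos (by omega) j).ne'

theorem powSeries_add (c c' : ℕ → K) :
    powSeries p (c + c') = powSeries p c + powSeries p c' := by
  ext s
  simp [powSeries, Finset.sum_add_distrib]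

theorem powSeries_neg (c : ℕ → K) : powSeries p (-c) = -powSeries p c := by
  ext s
  simp [powSeries]

theorem powSeries_single (hp : 1 < p) (c : K) (i : ℕ) :
    powSeries p (Pi.single i c) = c • (X : PowerSeries K) ^ p ^ i := by
  refine (powSeries_ext_iff hp (fun j => ?_) fun s hs => ?_).symm
  · rw [coeff_smul, coeff_X_pow, Pi.single_apply]
    by_cases h : j = i
    · simp [h]
    · rw [if_neg, if_neg h, smul_zero]
      exact fun h' => h (Nat.pow_right_injective hp h')
  · rw [coeff_smul, coeff_X_pow, if_neg (hs i).symm, smul_zero]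

theorem powSeries_sum {ι : Type*} (s : Finset ι) (c : ι → ℕ → K) :
    powSeries p (∑ i ∈ s, c i) = ∑ i ∈ s, powSeries p (c i) := by
  ext r
  simp only [powSeries, coeff_mk, map_sum, Finset.sum_apply]
  rw [Finset.sum_comm]

/-- The exponential of `∑_j c_j T^{p^j}` agrees up to order `r` with a finite product. -/
theorem coeff_expS_powSeries (hp : 1 < p) {c : ℕ → K} (hc : c 0 = 0) (r : ℕ) :
    coeff r (expS (powSeries p c)) =
      coeff r (∏ j ∈ Finset.Icc 1 r, expS (c j • (X : PowerSeries K) ^ p ^ j)) := by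
  rw [← expS_sum]
  · simp only [← powSeries_single hp]
    rw [← powSeries_sum]
    refine coeff_expS_congr (constantCoeff_powSeries hp _) (constantCoeff_powSeries hp _)
      fun s hs => ?_
    by_cases h : ∃ j, p ^ j = s
    · obtain ⟨j, rfl⟩ := h
      rw [coeff_powSeries_pow hp, coeff_powSeries_pow hp, Finset.sum_apply]
      rcases Nat.eq_zero_or_pos j with rfl | hj
      · rw [hc]
        refine (Finset.sum_eq_zero fun i hi => ?_).symm
        rw [Finset.mem_Icc] at hi
        exact Pi.single_eq_of_ne (by omega) _
      · rw [Finset.sum_eq_single j]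
        · simp
        · intro i _ hij
          exact Pi.single_eq_of_ne hij.symm _
        · intro h
          exfalso
          apply h
          rw [Finset.mem_Icc]
          exact ⟨hj, (Nat.lt_pow_self hp).le.trans hs⟩
    · push Not at h
      rw [coeff_powSeries_of_ne h, coeff_powSeries_of_ne h]
  · intro i _
    simp [show p ≠ 0 by omega]

/-- The substitution `T ↦ c T^p` shifts the coefficients of `∑_j c_j T^{p^j}`. -/
theorem expand_rescale_powSeries (hp : 1 < p) (b : K) (c : ℕ → K) :
    expand p (by omega) (rescale b (powSeries p c)) =
      powSeries p fun j => if j = 0 then 0 else b ^ p ^ (j - 1) * c (j - 1) := by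
  refine powSeries_ext_iff hp (fun j => ?_) fun s hs => ?_
  · rw [coeff_expand]
    rcases j with _ | j
    · rw [if_neg, if_pos rfl]
      rw [pow_zero, Nat.dvd_one]
      omega
    · rw [if_pos (dvd_pow_self p j.succ_ne_zero), if_neg j.succ_ne_zero, pow_succ,
        Nat.mul_div_cancel _ (by omega), coeff_rescale, coeff_powSeries_pow hp, Nat.add_sub_cancel]
  · rw [coeff_expand]
    split_ifs with h
    · obtain ⟨t, rfl⟩ := h
      rw [Nat.mul_div_cancel_left _ (by omega), coeff_rescale, coeff_powSeries_of_ne, mul_zero]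
      intro j hj
      exact hs (j + 1) (by rw [pow_succ, hj, mul_comm])
    · rfl

end FormalExp

/-! ### The Artin-Hasse exponential -/

section ArtinHasse

open PowerSeries

theorem powSeries_smul {K : Type*} [Field K] {p : ℕ} (b : K) (c : ℕ → K) :
    powSeries p (b • c) = b • powSeries p c := by
  ext s
  simp [powSeries, Finset.mul_sum]

/-- The Artin-Hasse exponential `exp(∑_j T^{p^j} / p^j)`. -/
noncomputable def artinHasse (K : Type*) [Field K] [CharZero K] (p : ℕ) : PowerSeries K :=
  expS (powSeries p fun j => ((p : K) ^ j)⁻¹)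

theorem map_expS {K L : Type*} [Field K] [CharZero K] [Field L] [CharZero L] (f : K →+* L)
    {a : PowerSeries K} (ha : constantCoeff a = 0) :
    PowerSeries.map f (expS a) = expS (PowerSeries.map f a) := by
  have hd : ∀ x : PowerSeries K, d⁄dX L (PowerSeries.map f x) = PowerSeries.map f (d⁄dX K x) := by
    intro x
    ext n
    simp [coeff_derivative]
  refine eq_expS ?_ ?_ ?_
  · rw [← coeff_zero_eq_constantCoeff_apply, coeff_map, coeff_zero_eq_constantCoeff_apply, ha,
      map_zero]
  · rw [hd, derivative_expS ha, map_mul, hd]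
  · rw [← coeff_zero_eq_constantCoeff_apply, coeff_map, coeff_zero_eq_constantCoeff_apply,
      constantCoeff_expS ha, map_one]

theorem map_artinHasse {K L : Type*} [Field K] [CharZero K] [Field L] [CharZero L] (f : K →+* L)
    {p : ℕ} (hp : 1 < p) : PowerSeries.map f (artinHasse K p) = artinHasse L p := by
  rw [artinHasse, map_expS f (constantCoeff_powSeries hp _), artinHasse]
  congr 1
  ext s
  simp [powSeries]

theorem constantCoeff_artinHasse {K : Type*} [Field K] [CharZero K] {p : ℕ} (hp : 1 < p) :
    constantCoeff (artinHasse K p) = 1 :=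
  constantCoeff_expS (constantCoeff_powSeries hp _)

/-- On exponents: $p\sum_j T^{p^j}/p^j=pT+\sum_j T^{p^{j+1}}/p^j$. -/
theorem artinHasse_pow {K : Type*} [Field K] [CharZero K] {p : ℕ} (hp : 1 < p) :
    artinHasse K p ^ p =
      expand p (by omega) (artinHasse K p) * expS ((p : K) • (X : PowerSeries K) ^ 1) := by
  have h0 := constantCoeff_powSeries (K := K) hp fun j => ((p : K) ^ j)⁻¹
  rw [artinHasse, ← expS_nsmul h0, expS_expand h0, ← expS_add (by simpa using h0) (by simp)]
  · have h1 := expand_rescale_powSeries hp (1 : K) fun j => ((p : K) ^ j)⁻¹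
    rw [rescale_one, RingHom.id_apply] at h1
    rw [h1, ← pow_zero p, ← powSeries_single hp, ← powSeries_add, ← Nat.cast_smul_eq_nsmul K,
      ← powSeries_smul]
    congr 2
    funext j
    have hp0 : (p : K) ≠ 0 := by exact_mod_cast (by omega : p ≠ 0)
    rcases j with _ | j
    · simp
    · simp [pow_succ]
      field_simp

/-- Below degree $p$ the exponent is just $T$. This is what later produces the factorials in the
entries of $B(\Lambda)$. -/
theorem coeff_artinHasse_of_lt {K : Type*} [Field K] [CharZero K] {p : ℕ} (hp : 1 < p) {r : ℕ}
    (hr : r < p) : coeff r (artinHasse K p) = ((r.factorial : K))⁻¹ := by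
  have : coeff r (artinHasse K p) = coeff r (expS (X : PowerSeries K)) := by
    refine coeff_expS_congr (constantCoeff_powSeries hp _) (by simp) fun s hs => ?_
    by_cases h : s = 1
    · subst h
      have := coeff_powSeries_pow hp (fun j => ((p : K) ^ j)⁻¹) 0
      simp only [pow_zero, inv_one] at this
      rw [this, coeff_one_X]
    · rw [coeff_X, if_neg h]
      refine coeff_powSeries_of_ne fun j hj => ?_
      rcases j with _ | j
      · exact h (by simpa using hj.symm)
      · have : p ≤ p ^ (j + 1) := Nat.le_self_pow j.succ_ne_zero p
        omega
  rw [this, expS_X, coeff_exp]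
  simp

variable {p : ℕ} [hp : Fact p.Prime]

theorem norm_natCast_padic (n : ℕ) (hn : n ≠ 0) :
    ‖(n : ℚ_[p])‖ = (p : ℝ)⁻¹ ^ padicValNat p n := by
  rw [Padic.norm_eq_zpow_neg_valuation (by exact_mod_cast hn), Padic.valuation_natCast,
    zpow_neg, zpow_natCast, inv_pow]

/-- Legendre's formula $(p-1)v_p(j!)=j-s_p(j)$ with digit sum $s_p(j)\ge1$ gives $v_p(j!)\le j-1$.
-/
theorem norm_pow_div_factorial_le {j : ℕ} (hj : j ≠ 0) :
    ‖(p : ℚ_[p]) ^ j / (j.factorial : ℚ_[p])‖ ≤ (p : ℝ)⁻¹ := by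
  have hp1 : (1 : ℝ) < p := by exact_mod_cast hp.out.one_lt
  rw [norm_div, norm_pow, Padic.norm_p, norm_natCast_padic _ j.factorial_ne_zero]
  have h2 : padicValNat p j.factorial + 1 ≤ j := by
    have h := sub_one_mul_padicValNat_factorial (p := p) j
    have h3 : 0 < (p.digits j).sum := by
      rw [Nat.pos_iff_ne_zero]
      intro h0
      rw [List.sum_eq_zero_iff] at h0
      have := Nat.getLast_digit_ne_zero p hj
      exact this (h0 _ (List.getLast_mem _))
    have h4 : 1 ≤ p - 1 := by have := hp.out.two_le; omega
    have h5 : padicValNat p j.factorial ≤ (p - 1) * padicValNat p j.factorial :=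
      Nat.le_mul_of_pos_left _ h4
    have := Nat.pos_of_ne_zero hj
    omega
  rw [div_le_iff₀ (by positivity), ← pow_succ']
  exact pow_le_pow_of_le_one (by positivity) (inv_le_one_of_one_le₀ hp1.le) h2

/-- For a polynomial over `ℤ_p`, the `p`-th power agrees with the substitution `T ↦ T^p`
modulo `p`. -/
theorem norm_coeff_pow_sub_expand_le (P : Polynomial ℤ_[p]) (n : ℕ) :
    ‖(P ^ p - Polynomial.expand ℤ_[p] p P).coeff n‖ ≤ (p : ℝ)⁻¹ := by
  have h : PadicInt.toZMod ((P ^ p - Polynomial.expand ℤ_[p] p P).coeff n) = 0 := by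
    rw [← Polynomial.coeff_map, Polynomial.map_sub, Polynomial.map_pow, Polynomial.map_expand,
      ZMod.expand_card, sub_self, Polynomial.coeff_zero]
  rw [← RingHom.mem_ker, PadicInt.ker_toZMod, PadicInt.maximalIdeal_eq_span_p] at h
  have := (PadicInt.norm_le_pow_iff_mem_span_pow
    ((P ^ p - Polynomial.expand ℤ_[p] p P).coeff n) 1).2 (by simpa using h)
  simpa using this

/-- Dwork's criterion. Compare coefficients of $T^n$ in $E^p=E(T^p)\exp(pT)$, with $A$ the
truncation of $E$ below degree $n$, integral by induction. The left side is that of $A^p$ plus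
$p\,e_n$, the right side is that of $A(T^p)$ plus multiples of $p$, and $A^p\equiv A(T^p)$ modulo
$p$. So $p\,e_n$ is divisible by $p$. -/
theorem norm_coeff_artinHasse_padic_le (n : ℕ) : ‖coeff n (artinHasse ℚ_[p] p)‖ ≤ 1 := by
  have hp1 := hp.out.one_lt
  have hpR : (1 : ℝ) < p := by exact_mod_cast hp1
  induction n using Nat.strong_induction_on with
  | _ n ih =>
  rcases Nat.eq_zero_or_pos n with rfl | hn
  · rw [coeff_zero_eq_constantCoeff_apply, constantCoeff_artinHasse hp1, norm_one]
  set E := artinHasse ℚ_[p] p with hE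
  -- Integrality is known only below $n$, hence the value $0$ from $n$ on.
  let e : ℕ → ℤ_[p] := fun m => if h : m < n then ⟨coeff m E, ih m h⟩ else 0
  have he : ∀ m < n, (e m : ℚ_[p]) = coeff m E := fun m hm => by simp [e, hm]
  let P : Polynomial ℤ_[p] := ∑ m ∈ Finset.range n, Polynomial.monomial m (e m)
  have hP : ∀ m, P.coeff m = if m < n then e m else 0 := by
    intro m
    simp only [P, Polynomial.finsetSum_coeff, Polynomial.coeff_monomial, Finset.sum_ite_eq',
      Finset.mem_range]
  let A : PowerSeries ℚ_[p] := ((P.map PadicInt.Coe.ringHom : Polynomial ℚ_[p]) : PowerSeries ℚ_[p])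
  have hA : ∀ m, coeff m A = if m < n then coeff m E else 0 := by
    intro m
    simp only [A, Polynomial.coeff_coe, Polynomial.coeff_map, hP]
    split_ifs with h
    · exact he m h
    · simp
  obtain ⟨R, hR⟩ : ∃ R : PowerSeries ℚ_[p], E = A + X ^ n * R := by
    have : (X : PowerSeries ℚ_[p]) ^ n ∣ E - A := by
      rw [X_pow_dvd_iff]
      intro m hm
      rw [map_sub, hA, if_pos hm, sub_self]
    obtain ⟨R, hR⟩ := this
    exact ⟨R, by rw [← hR]; ring⟩
  have hRn : constantCoeff R = coeff n E := by
    rw [hR, map_add, hA, if_neg (lt_irrefl n), zero_add]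
    have := coeff_X_pow_mul R n 0
    rw [zero_add] at this
    rw [this, coeff_zero_eq_constantCoeff_apply]
  have hA0 : constantCoeff A = 1 := by
    rw [← coeff_zero_eq_constantCoeff_apply, hA, if_pos hn, coeff_zero_eq_constantCoeff_apply,
      constantCoeff_artinHasse hp1]
  -- the coefficient of `T^n` in `E^p`
  have hL : coeff n (E ^ p) = coeff n (A ^ p) + p * coeff n E := by
    obtain ⟨k, hk⟩ := Polynomial.powAddExpansion A (X ^ n * R) p
    rw [hR, hk, map_add, map_add, ← hR]
    have h1 : (p : PowerSeries ℚ_[p]) * A ^ (p - 1) * (X ^ n * R) =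
        X ^ n * (C (p : ℚ_[p]) * A ^ (p - 1) * R) := by
      rw [map_natCast]; ring
    have h2 : k * (X ^ n * R) ^ 2 = X ^ n * (X ^ n * (k * R ^ 2)) := by ring
    have h3 : ∀ f : PowerSeries ℚ_[p], coeff n (X ^ n * f) = constantCoeff f := by
      intro f
      have := coeff_X_pow_mul f n 0
      rw [zero_add] at this
      rw [this, coeff_zero_eq_constantCoeff_apply]
    rw [h1, h2, h3, h3]
    simp [hn.ne', hA0, hRn]
  have hRt : coeff n (E ^ p) = coeff n (expand p hp.out.ne_zero E) +
      ∑ x ∈ (Finset.HasAntidiagonal.antidiagonal n).erase (n, 0), coeff x.1 (expand p hp.out.ne_zero E) *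
        ((p : ℚ_[p]) ^ x.2 / (x.2.factorial : ℚ_[p])) := by
    rw [hE, artinHasse_pow hp1, ← hE, expS_smul_X_pow one_ne_zero, coeff_mul,
      ← Finset.add_sum_erase _ _ (Finset.HasAntidiagonal.mem_antidiagonal.2 (add_zero n) :
        (n, 0) ∈ Finset.HasAntidiagonal.antidiagonal n)]
    simp
  have hexp : coeff n (expand p hp.out.ne_zero E) =
      (((Polynomial.expand ℤ_[p] p P).coeff n : ℤ_[p]) : ℚ_[p]) := by
    rw [coeff_expand, Polynomial.coeff_expand hp.out.pos]
    split_ifs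
    -- The coefficient of $T^n$ in $E(T^p)$ involves only index $n/p<n$, so $E$ may be replaced by
    -- its truncation.
    · have : n / p < n := Nat.div_lt_self hn hp1
      rw [hP, if_pos this, he _ this]
    · simp
  have hApow : coeff n (A ^ p) = (((P ^ p).coeff n : ℤ_[p]) : ℚ_[p]) := by
    simp only [A]
    rw [← Polynomial.coe_pow, Polynomial.coeff_coe, ← Polynomial.map_pow, Polynomial.coeff_map]
    rfl
  have hmain : (p : ℚ_[p]) * coeff n E =
      (∑ x ∈ (Finset.HasAntidiagonal.antidiagonal n).erase (n, 0), coeff x.1 (expand p hp.out.ne_zero E) *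
        ((p : ℚ_[p]) ^ x.2 / (x.2.factorial : ℚ_[p]))) -
      (((P ^ p - Polynomial.expand ℤ_[p] p P).coeff n : ℤ_[p]) : ℚ_[p]) := by
    rw [Polynomial.coeff_sub, PadicInt.coe_sub, ← hApow, ← hexp]
    linear_combination hRt - hL
  have hbd : ‖(p : ℚ_[p]) * coeff n E‖ ≤ (p : ℝ)⁻¹ := by
    rw [hmain]
    rw [sub_eq_add_neg]
    refine (IsUltrametricDist.norm_add_le_max _ _).trans (max_le ?_ ?_)
    · refine IsUltrametricDist.norm_sum_le_of_forall_le_of_nonneg (by positivity) fun x hx => ?_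
      rw [Finset.mem_erase, Finset.HasAntidiagonal.mem_antidiagonal] at hx
      have hx2 : x.2 ≠ 0 := by
        intro h
        apply hx.1
        ext <;> simp <;> omega
      have h1 : ‖coeff x.1 (expand p hp.out.ne_zero E)‖ ≤ 1 := by
        rw [coeff_expand]
        split_ifs
        · exact ih _ ((Nat.div_le_self _ _).trans_lt (by omega))
        · simp
      rw [norm_mul]
      calc _ ≤ 1 * (p : ℝ)⁻¹ := mul_le_mul h1 (norm_pow_div_factorial_le hx2) (norm_nonneg _)
            zero_le_one
        _ = _ := one_mul _
    · rw [norm_neg, ← PadicInt.norm_def]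
      exact norm_coeff_pow_sub_expand_le P n
  rw [norm_mul, Padic.norm_p] at hbd
  exact le_of_mul_le_mul_left (by simpa using hbd) (by positivity : (0 : ℝ) < (p : ℝ)⁻¹)

/-- The Artin-Hasse exponential has `p`-integral coefficients. -/
theorem norm_coeff_artinHasse_le (n : ℕ) : ‖coeff n (artinHasse ℂ_[p] p)‖ ≤ 1 := by
  rw [← map_artinHasse (algebraMap ℚ_[p] ℂ_[p]) hp.out.one_lt, coeff_map, norm_algebraMap']
  exact norm_coeff_artinHasse_padic_le n

end ArtinHasse

/-! ### Divided power estimates in `ℂ_p` -/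

section Estimates

open PowerSeries Filter Topology Finset.HasAntidiagonal

variable {p : ℕ} [hp : Fact p.Prime]

instance : NonarchimedeanRing ℂ_[p] where
  is_nonarchimedean := NonarchimedeanAddGroup.is_nonarchimedean

theorem norm_natCast_complex (n : ℕ) : ‖(n : ℂ_[p])‖ = ‖(n : ℚ_[p])‖ := by
  rw [← map_natCast (algebraMap ℚ_[p] ℂ_[p]), norm_algebraMap']

theorem norm_natCast_p : ‖(p : ℂ_[p])‖ = (p : ℝ)⁻¹ := by
  rw [norm_natCast_complex, Padic.norm_p]

theorem one_lt_cast_p : (1 : ℝ) < p := by exact_mod_cast hp.out.one_lt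

theorem inv_p_lt_one : (p : ℝ)⁻¹ < 1 := inv_lt_one_of_one_lt₀ one_lt_cast_p

theorem inv_p_pos : 0 < (p : ℝ)⁻¹ := inv_pos.2 (zero_lt_one.trans one_lt_cast_p)

theorem norm_natCast_le (n : ℕ) : ‖(n : ℂ_[p])‖ ≤ 1 := IsUltrametricDist.norm_natCast_le_one _ n

theorem norm_natCast_le_of_dvd {a b : ℕ} (h : a ∣ b) : ‖(b : ℂ_[p])‖ ≤ ‖(a : ℂ_[p])‖ := by
  obtain ⟨c, rfl⟩ := h
  rw [Nat.cast_mul, norm_mul]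
  exact mul_le_of_le_one_right (norm_nonneg _) (norm_natCast_le c)

theorem norm_factorial_mul (m : ℕ) :
    ‖((p * m).factorial : ℂ_[p])‖ = (p : ℝ)⁻¹ ^ m * ‖(m.factorial : ℂ_[p])‖ := by
  rw [norm_natCast_complex, norm_natCast_complex, norm_natCast_padic _ (Nat.factorial_ne_zero _),
    norm_natCast_padic _ (Nat.factorial_ne_zero _), padicValNat_factorial_mul, pow_add, mul_comm]

/-- At each of the $j$ steps at least $s$ factors $p$ split off; the further ones are discarded. -/
theorem norm_factorial_pow_mul_le (j s : ℕ) :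
    ‖((p ^ j * s).factorial : ℂ_[p])‖ ≤ (p : ℝ)⁻¹ ^ (j * s) * ‖(s.factorial : ℂ_[p])‖ := by
  induction j with
  | zero => simp
  | succ j ih =>
    rw [pow_succ', mul_assoc, norm_factorial_mul]
    calc _ ≤ (p : ℝ)⁻¹ ^ s * ((p : ℝ)⁻¹ ^ (j * s) * ‖(s.factorial : ℂ_[p])‖) := by
          refine mul_le_mul ?_ ih (norm_nonneg _) (pow_nonneg inv_p_pos.le _)
          exact pow_le_pow_of_le_one inv_p_pos.le inv_p_lt_one.le
            (Nat.le_mul_of_pos_left _ (pow_pos hp.out.pos _))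
      _ = _ := by rw [← mul_assoc, ← pow_add]; congr 2; ring

theorem tendsto_factorial : Tendsto (fun n : ℕ => (n.factorial : ℂ_[p])) atTop (𝓝 0) := by
  have h1 : ∀ n : ℕ, ‖(n.factorial : ℂ_[p])‖ ≤ (p : ℝ)⁻¹ ^ (n / p) := by
    intro n
    have h := norm_natCast_le_of_dvd (p := p)
      (Nat.factorial_dvd_factorial (Nat.mul_div_le n p))
    rw [norm_factorial_mul] at h
    exact h.trans (mul_le_of_le_one_right (pow_nonneg inv_p_pos.le _) (norm_natCast_le _))
  refine squeeze_zero_norm h1 ?_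
  exact (tendsto_pow_atTop_nhds_zero_of_lt_one inv_p_pos.le inv_p_lt_one).comp
    (Nat.tendsto_div_const_atTop hp.out.ne_zero)

theorem norm_factorial_add_le (a b : ℕ) :
    ‖((a + b).factorial : ℂ_[p])‖ ≤ ‖(a.factorial : ℂ_[p])‖ * ‖(b.factorial : ℂ_[p])‖ := by
  rw [← norm_mul, ← Nat.cast_mul]
  exact norm_natCast_le_of_dvd (Nat.factorial_mul_factorial_dvd_factorial_add a b)

/-- The `r`-th divided power coefficient of `f` has norm at most `ρ^r`. -/
def DPBound (ρ : ℝ) (f : PowerSeries ℂ_[p]) : Prop :=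
  ∀ r, ‖(r.factorial : ℂ_[p]) * coeff r f‖ ≤ ρ ^ r

/-- The divided power coefficients of `f` tend to zero. -/
def DPNull (f : PowerSeries ℂ_[p]) : Prop :=
  Tendsto (fun r : ℕ => (r.factorial : ℂ_[p]) * coeff r f) atTop (𝓝 0)

/-- As $i!\,j!$ divides $(i+j)!$, divided power coefficients of a product are bounded by products of
divided power coefficients. -/
theorem norm_factorial_mul_coeff_mul_le (f g : PowerSeries ℂ_[p]) {n : ℕ} {C : ℝ} (hC : 0 ≤ C)
    (h : ∀ i j, i + j = n → ‖(i.factorial : ℂ_[p]) * coeff i f‖ *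
      ‖(j.factorial : ℂ_[p]) * coeff j g‖ ≤ C) :
    ‖(n.factorial : ℂ_[p]) * coeff n (f * g)‖ ≤ C := by
  rw [coeff_mul, Finset.mul_sum]
  refine IsUltrametricDist.norm_sum_le_of_forall_le_of_nonneg hC fun x hx => ?_
  rw [mem_antidiagonal] at hx
  refine le_trans ?_ (h _ _ hx)
  rw [norm_mul, norm_mul, norm_mul, norm_mul, ← hx]
  calc _ ≤ ‖(x.1.factorial : ℂ_[p])‖ * ‖(x.2.factorial : ℂ_[p])‖ * (‖coeff x.1 f‖ * ‖coeff x.2 g‖) :=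
        mul_le_mul_of_nonneg_right (norm_factorial_add_le _ _) (by positivity)
    _ = _ := by ring

theorem DPBound.mul {ρ : ℝ} (hρ : 0 ≤ ρ) {f g : PowerSeries ℂ_[p]} (hf : DPBound ρ f)
    (hg : DPBound ρ g) : DPBound ρ (f * g) := fun n =>
  norm_factorial_mul_coeff_mul_le f g (pow_nonneg hρ n) fun i j hij => by
    rw [← hij, pow_add]
    exact mul_le_mul (hf i) (hg j) (norm_nonneg _) (pow_nonneg hρ i)

theorem DPBound.one {ρ : ℝ} (hρ : 0 ≤ ρ) : DPBound ρ (1 : PowerSeries ℂ_[p]) := by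
  intro r
  rw [coeff_one]
  split_ifs with h
  · simp [h]
  · simpa using pow_nonneg hρ r

theorem DPBound.prod {ι : Type*} {ρ : ℝ} (hρ : 0 ≤ ρ) (s : Finset ι) (f : ι → PowerSeries ℂ_[p])
    (hf : ∀ i ∈ s, DPBound ρ (f i)) : DPBound ρ (∏ i ∈ s, f i) :=
  Finset.prod_induction f (DPBound ρ) (fun _ _ => DPBound.mul hρ) (DPBound.one hρ) hf

theorem DPBound.dpNull {ρ : ℝ} (hρ : 0 ≤ ρ) (hρ1 : ρ < 1) {f : PowerSeries ℂ_[p]}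
    (hf : DPBound ρ f) : DPNull f :=
  squeeze_zero_norm hf (tendsto_pow_atTop_nhds_zero_of_lt_one hρ hρ1)

theorem DPNull.mul {f g : PowerSeries ℂ_[p]} (hf : DPNull f) (hg : DPNull g) :
    DPNull (f * g) := by
  rw [DPNull, tendsto_zero_iff_norm_tendsto_zero, ← Nat.cofinite_eq_atTop] at hf hg
  have h1 := tendsto_mul_cofinite_nhds_zero hf hg
  rw [DPNull, NormedAddGroup.tendsto_nhds_zero]
  intro ε hε
  have h2 := (tendsto_order.1 h1).2 (ε / 2) (half_pos hε)
  rw [eventually_cofinite] at h2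
  have h3 := (h2.image fun x => x.1 + x.2).bddAbove
  -- Only finitely many pairs $(i,j)$ give a product of norm at least $\varepsilon/2$; $N$ bounds
  -- their sums $i+j$.
  obtain ⟨N, hN⟩ := h3
  filter_upwards [eventually_gt_atTop N] with n hn
  refine lt_of_le_of_lt ?_ (half_lt_self hε)
  refine norm_factorial_mul_coeff_mul_le f g (half_pos hε).le fun i j hij => ?_
  by_contra hcon
  have : i + j ≤ N := hN ⟨(i, j), fun h => hcon h.le, rfl⟩
  omega

theorem dpNull_of_norm_coeff_le_one {f : PowerSeries ℂ_[p]} (hf : ∀ r, ‖coeff r f‖ ≤ 1) :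
    DPNull f := by
  refine squeeze_zero_norm (a := fun r : ℕ => ‖(r.factorial : ℂ_[p])‖) (fun r => ?_) ?_
  · rw [norm_mul]
    exact mul_le_of_le_one_right (norm_nonneg _) (hf r)
  · simpa using (tendsto_factorial (p := p)).norm

/-- The operator `T^{pm} ↦ π^m T^m`, which kills the other monomials. -/
noncomputable def psi (π : ℂ_[p]) (f : PowerSeries ℂ_[p]) : PowerSeries ℂ_[p] :=
  PowerSeries.mk fun m => π ^ m * coeff (p * m) f

/-- Since $|(pm)!|=p^{-m}|m!|$, the factor $\pi^m$ makes the $m$-th divided power coefficient of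
$\psi f$ as large as the $pm$-th one of $f$. -/
theorem DPNull.psi {π : ℂ_[p]} (hπ : ‖π‖ = (p : ℝ)⁻¹) {f : PowerSeries ℂ_[p]} (hf : DPNull f) :
    DPNull (psi π f) := by
  have h : Tendsto (fun m : ℕ => p * m) atTop atTop :=
    tendsto_id.const_mul_atTop' hp.out.pos
  rw [DPNull, tendsto_zero_iff_norm_tendsto_zero] at hf ⊢
  refine (hf.comp h).congr fun m => ?_
  simp only [Function.comp, HasseWitt.psi, coeff_mk, norm_mul, norm_factorial_mul, norm_pow, hπ]
  ring

/-- `ψ` is linear over the substitution `T ↦ π⁻¹ T^p`. -/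
theorem psi_expand_mul {π : ℂ_[p]} (hπ : π ≠ 0) (f g : PowerSeries ℂ_[p]) :
    psi π (expand p hp.out.ne_zero (rescale π⁻¹ f) * g) = f * psi π g := by
  ext m
  rw [psi, coeff_mk, coeff_mul, coeff_mul, Finset.mul_sum]
  symm
  refine Finset.sum_of_injOn (fun x => (p * x.1, p * x.2)) ?_ ?_ ?_ ?_
  · intro x _ y _ hxy
    simp only [Prod.mk.injEq] at hxy
    ext
    · exact Nat.eq_of_mul_eq_mul_left hp.out.pos hxy.1
    · exact Nat.eq_of_mul_eq_mul_left hp.out.pos hxy.2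
  · intro x hx
    simp only [Finset.mem_coe, mem_antidiagonal] at hx ⊢
    rw [← mul_add, hx]
  · intro x hx hx2
    rw [mem_antidiagonal] at hx
    rw [coeff_expand, if_neg, zero_mul, mul_zero]
    rintro ⟨a, ha⟩
    apply hx2
    have h2 : p ∣ x.2 := by
      have : p ∣ x.1 + x.2 := by rw [hx]; exact dvd_mul_right _ _
      rw [ha] at this
      exact (Nat.dvd_add_right (dvd_mul_right _ _)).1 this
    obtain ⟨b, hb⟩ := h2
    refine ⟨(a, b), ?_, ?_⟩
    · simp only [Finset.mem_coe, mem_antidiagonal]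
      rw [ha, hb, ← mul_add] at hx
      exact Nat.eq_of_mul_eq_mul_left hp.out.pos hx
    · ext <;> simp [ha, hb]
  · intro x hx
    rw [mem_antidiagonal] at hx
    simp only
    rw [coeff_expand, if_pos (dvd_mul_right _ _), Nat.mul_div_cancel_left _ hp.out.pos,
      coeff_rescale, psi, coeff_mk, ← hx, pow_add, inv_pow]
    field_simp

theorem coeff_X_mul_derivative (f : PowerSeries ℂ_[p]) (m : ℕ) :
    coeff m (X * d⁄dX ℂ_[p] f) = m * coeff m f := by
  rcases m with _ | m
  · simp
  · rw [coeff_succ_X_mul, coeff_derivative]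
    push_cast
    ring

theorem psi_X_mul_derivative (π : ℂ_[p]) (f : PowerSeries ℂ_[p]) :
    psi π (X * d⁄dX ℂ_[p] f) = (p : ℂ_[p]) • (X * d⁄dX ℂ_[p] (psi π f)) := by
  ext m
  rw [coeff_smul, coeff_X_mul_derivative, psi, coeff_mk, coeff_X_mul_derivative, psi, coeff_mk]
  push_cast
  rw [smul_eq_mul]
  ring

/-! ### The functional `T^{m+1} ↦ (-1)^m m!` -/

/-- The operator `T d/dT + T`. -/
noncomputable def twistedEuler (g : PowerSeries ℂ_[p]) : PowerSeries ℂ_[p] :=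
  X * d⁄dX ℂ_[p] g + X * g

/-- Exhibits $T\,d/dT+T$ as the conjugate of $T\,d/dT$ by $\exp(T)$, so that relations for $\psi$
and $T\,d/dT$ can be transported. -/
theorem exp_mul_twistedEuler (g : PowerSeries ℂ_[p]) :
    exp ℂ_[p] * twistedEuler g = X * d⁄dX ℂ_[p] (exp ℂ_[p] * g) := by
  rw [Derivation.leibniz, derivative_exp, twistedEuler, smul_eq_mul, smul_eq_mul]
  ring

theorem factorial_mul_coeff_twistedEuler (g : PowerSeries ℂ_[p]) (m : ℕ) :
    (m.factorial : ℂ_[p]) * coeff (m + 1) (twistedEuler g) =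
      (m + 1).factorial * coeff (m + 1) g + m.factorial * coeff m g := by
  rw [twistedEuler, map_add, coeff_X_mul_derivative, coeff_succ_X_mul, Nat.factorial_succ]
  push_cast
  ring

/-- A telescoping sum: with $a_m=(-1)^m m!\,g_m$ the terms are $a_m-a_{m+1}$, and $a_m\to0$. -/
theorem hasSum_twistedEuler {g : PowerSeries ℂ_[p]} (hg : DPNull g) :
    HasSum (fun m : ℕ => (-1) ^ m * (m.factorial : ℂ_[p]) * coeff (m + 1) (twistedEuler g))
      (coeff 0 g) := by
  set a : ℕ → ℂ_[p] := fun m => (-1) ^ m * (m.factorial * coeff m g) with ha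
  have ha0 : Tendsto a atTop (𝓝 0) := by
    rw [DPNull, tendsto_zero_iff_norm_tendsto_zero] at hg
    rw [tendsto_zero_iff_norm_tendsto_zero]
    refine hg.congr fun m => ?_
    rw [ha]
    simp [norm_mul]
  have hb : (fun m : ℕ => (-1) ^ m * (m.factorial : ℂ_[p]) * coeff (m + 1) (twistedEuler g)) =
      fun m => a m - a (m + 1) := by
    funext m
    rw [mul_assoc, factorial_mul_coeff_twistedEuler, ha]
    simp only [pow_succ]
    ring
  rw [hb]
  have hs : Summable fun m => a m - a (m + 1) := by
    apply NonarchimedeanAddGroup.summable_of_tendsto_cofinite_zero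
    rw [Nat.cofinite_eq_atTop]
    simpa using ha0.sub (ha0.comp (tendsto_add_atTop_nat 1))
  have h1 := hs.hasSum.tendsto_sum_nat
  have h2 : Tendsto (fun n => ∑ i ∈ Finset.range n, (a i - a (i + 1))) atTop (𝓝 (a 0)) := by
    simp only [Finset.sum_range_sub']
    simpa using ha0.const_sub (a 0)
  have h3 := tendsto_nhds_unique h1 h2
  have h4 := hs.hasSum
  rw [h3] at h4
  simpa [ha] using h4

/-- Every `f` without constant term whose shifted divided power coefficients tend to zero is of the
form `(T d/dT + T) g`. -/
theorem exists_twistedEuler_eq {f : PowerSeries ℂ_[p]} (h0 : coeff 0 f = 0)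
    (hf : Tendsto (fun m : ℕ => (m.factorial : ℂ_[p]) * coeff (m + 1) f) atTop (𝓝 0)) :
    ∃ g, DPNull g ∧ twistedEuler g = f := by
  set b : ℕ → ℂ_[p] := fun m => (-1) ^ m * (m.factorial * coeff (m + 1) f) with hb
  have hb0 : Tendsto b atTop (𝓝 0) := by
    rw [tendsto_zero_iff_norm_tendsto_zero] at hf ⊢
    refine hf.congr fun m => ?_
    rw [hb]
    simp [norm_mul]
  have hs : Summable b := by
    apply NonarchimedeanAddGroup.summable_of_tendsto_cofinite_zero
    rwa [Nat.cofinite_eq_atTop]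
  -- The recursion $a_m-a_{m+1}=b_m$ with $a_m\to0$ is solved by the tails of $\sum b_m$.
  set t : ℕ → ℂ_[p] := fun s => ∑' k, b (k + s) with ht
  have ht0 : Tendsto t atTop (𝓝 0) := tendsto_sum_nat_add b
  have htr : ∀ s, t s = b s + t (s + 1) := by
    intro s
    have := ((summable_nat_add_iff s).2 hs).tsum_eq_zero_add
    simp only [ht]
    rw [this, zero_add]
    congr 1
    exact tsum_congr fun k => by congr 1; ring
  have hfac : ∀ m : ℕ, (m.factorial : ℂ_[p]) ≠ 0 := fun m => by
    exact_mod_cast m.factorial_ne_zero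
  have hco : ∀ m : ℕ, (m.factorial : ℂ_[p]) *
      coeff m (PowerSeries.mk fun s => (-1) ^ s * t s / (s.factorial : ℂ_[p])) = (-1) ^ m * t m := by
    intro m
    rw [coeff_mk, mul_div_cancel₀ _ (hfac m)]
  refine ⟨PowerSeries.mk fun s => (-1) ^ s * t s / s.factorial, ?_, ?_⟩
  · rw [DPNull]
    simp only [hco]
    rw [tendsto_zero_iff_norm_tendsto_zero] at ht0 ⊢
    refine ht0.congr fun m => ?_
    simp [norm_mul]
  · ext m
    rcases m with _ | m
    · rw [h0, twistedEuler]
      simp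
    · apply mul_left_cancel₀ (hfac m)
      rw [factorial_mul_coeff_twistedEuler, hco, hco, htr m]
      simp only [hb, pow_succ]
      have : ((-1 : ℂ_[p]) ^ m) * (-1) ^ m = 1 := by
        rw [← mul_pow]; simp
      linear_combination ((m.factorial : ℂ_[p]) * coeff (m + 1) f) * this

end Estimates

/-! ### Dwork's series -/

section Dwork

open PowerSeries Filter Topology Finset.HasAntidiagonal

variable {p : ℕ} [hp : Fact p.Prime]

/-- The coefficients `γ_j / γ_0^{p^j}` for `j ≥ 1`. -/
noncomputable def dworkCoeff (γ₀ : ℂ_[p]) (j : ℕ) : ℂ_[p] :=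
  if j = 0 then 0 else gam γ₀ j / γ₀ ^ p ^ j

/-- The series `∏_{j ≥ 1} exp(γ_j (T / γ_0)^{p^j})`. -/
noncomputable def theta (γ₀ : ℂ_[p]) : PowerSeries ℂ_[p] := expS (powSeries p (dworkCoeff γ₀))

/-- The inverse of `theta γ₀`. -/
noncomputable def thetaInv (γ₀ : ℂ_[p]) : PowerSeries ℂ_[p] :=
  expS (powSeries p (-dworkCoeff γ₀))

theorem theta_mul_thetaInv (γ₀ : ℂ_[p]) : theta γ₀ * thetaInv γ₀ = 1 := by
  rw [mul_comm, theta, thetaInv, powSeries_neg,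
    expS_neg_mul_expS (constantCoeff_powSeries hp.out.one_lt _)]

theorem constantCoeff_theta (γ₀ : ℂ_[p]) : constantCoeff (theta γ₀) = 1 :=
  constantCoeff_expS (constantCoeff_powSeries hp.out.one_lt _)

theorem constantCoeff_thetaInv (γ₀ : ℂ_[p]) : constantCoeff (thetaInv γ₀) = 1 :=
  constantCoeff_expS (constantCoeff_powSeries hp.out.one_lt _)

/-- The division by $\gamma_0^r$ is the substitution $T\mapsto T/\gamma_0$, which can be moved into
each exponent. -/
theorem thetaOneCoeff_eq (γ₀ : ℂ_[p]) (r : ℕ) : thetaOneCoeff γ₀ r = coeff r (theta γ₀) := by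
  rw [thetaOneCoeff, thetaOne, coeff_mk, theta,
    coeff_expS_powSeries (c := dworkCoeff γ₀) hp.out.one_lt (if_pos rfl)]
  rw [div_eq_inv_mul, ← inv_pow, ← coeff_rescale, map_prod]
  congr 1
  refine Finset.prod_congr rfl fun j hj => ?_
  have hj0 : j ≠ 0 := by rw [Finset.mem_Icc] at hj; omega
  have hm : p ^ j ≠ 0 := (pow_pos hp.out.pos j).ne'
  rw [expMono, ← expS_smul_X_pow hm, expS_rescale (by simp [hp.out.ne_zero, hj0])]
  congr 1
  ext s
  rw [coeff_rescale, coeff_smul, coeff_smul, coeff_X_pow, dworkCoeff, if_neg hj0]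
  split_ifs with h
  · rw [h, inv_pow, smul_eq_mul, smul_eq_mul, div_eq_mul_inv]
    ring
  · simp

variable {γ₀ : ℂ_[p]} (hγ₀ : HasSum (fun i : ℕ => γ₀ ^ p ^ i / (p : ℂ_[p]) ^ i) 0)
  (hγ₀' : ‖γ₀‖ ^ (p - 1) = (p : ℝ)⁻¹)

include hγ₀' in
theorem gamma_ne_zero : γ₀ ≠ 0 := by
  rintro rfl
  have h1 : p - 1 ≠ 0 := by have := hp.out.two_le; omega
  rw [norm_zero, zero_pow h1] at hγ₀'
  exact inv_p_pos.ne hγ₀'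

include hγ₀' in
-- The quotient of the two sides is $p\,|\gamma_0|^{(p-1)p^i}=p^{1-p^i}\le1$.
theorem norm_gamma_pow_div (i : ℕ) :
    ‖γ₀ ^ p ^ (i + 1) / (p : ℂ_[p]) ^ (i + 1)‖ ≤ ‖γ₀ ^ p ^ i / (p : ℂ_[p]) ^ i‖ := by
  have hp1 := hp.out.one_lt
  have hpR : (0 : ℝ) < p := by exact_mod_cast hp.out.pos
  rw [norm_div, norm_div, norm_pow, norm_pow, norm_pow, norm_pow, norm_natCast_p]
  have e : p ^ (i + 1) = p ^ i + (p - 1) * p ^ i := by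
    rw [pow_succ]
    obtain ⟨q, rfl⟩ : ∃ q, p = q + 1 := ⟨p - 1, by omega⟩
    rw [Nat.add_sub_cancel]
    ring
  rw [e, pow_add, pow_mul, hγ₀', pow_succ, ← div_div, div_le_iff₀ inv_p_pos, mul_div_right_comm]
  refine mul_le_mul_of_nonneg_left ?_ (by positivity)
  exact pow_le_of_le_one inv_p_pos.le inv_p_lt_one.le (pow_pos hp.out.pos i).ne'

include hγ₀ hγ₀' in
-- As the full series vanishes, $\gamma_j$ is minus its tail, which is bounded by its first and
-- largest term.
theorem norm_gam_le (j : ℕ) : ‖gam γ₀ j‖ ≤ ‖γ₀ ^ p ^ (j + 1) / (p : ℂ_[p]) ^ (j + 1)‖ := by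
  have h := hγ₀.summable.sum_add_tsum_nat_add (j + 1)
  rw [hγ₀.tsum_eq] at h
  rw [gam, eq_neg_of_add_eq_zero_left h, norm_neg]
  refine IsUltrametricDist.norm_tsum_le_of_forall_le_of_nonneg (norm_nonneg _) fun i => ?_
  induction i with
  | zero => rw [zero_add]
  | succ i ih =>
    refine le_trans ?_ ih
    have := norm_gamma_pow_div hγ₀' (i + (j + 1))
    rwa [show i + (j + 1) + 1 = i + 1 + (j + 1) by ring] at this

include hγ₀ hγ₀' in
-- Writing $p^{j+1}=p^j+(p-1)p^j$ in the bound for $\gamma_j$ gives $|\gamma_j/\gamma_0^{p^j}|\le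
-- p^{j+1-p^j}$.
theorem norm_dworkCoeff_mul_le {j : ℕ} (hj : j ≠ 0) :
    ‖dworkCoeff γ₀ j‖ * (p : ℝ)⁻¹ ^ j ≤ (p : ℝ)⁻¹ ^ (p ^ j - 1) := by
  have hγ := norm_pos_iff.2 (gamma_ne_zero hγ₀')
  have hpR : (0 : ℝ) < p := by exact_mod_cast hp.out.pos
  have hp1 := hp.out.one_lt
  rw [dworkCoeff, if_neg hj, norm_div, div_mul_eq_mul_div, norm_pow, div_le_iff₀ (by positivity)]
  have h := norm_gam_le hγ₀ hγ₀' j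
  rw [norm_div, norm_pow, norm_pow, norm_natCast_p] at h
  have e : p ^ (j + 1) = p ^ j + (p - 1) * p ^ j := by
    rw [pow_succ]
    obtain ⟨q, rfl⟩ : ∃ q, p = q + 1 := ⟨p - 1, by omega⟩
    rw [Nat.add_sub_cancel]
    ring
  rw [e, pow_add, pow_mul, hγ₀'] at h
  have e2 : (p : ℝ)⁻¹ ^ p ^ j = (p : ℝ)⁻¹ ^ (p ^ j - 1) * (p : ℝ)⁻¹ := by
    rw [← pow_succ, Nat.sub_add_cancel (pow_pos hp.out.pos j)]
  calc ‖gam γ₀ j‖ * (p : ℝ)⁻¹ ^ j ≤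
        ‖γ₀‖ ^ p ^ j * (p : ℝ)⁻¹ ^ p ^ j / (p : ℝ)⁻¹ ^ (j + 1) * (p : ℝ)⁻¹ ^ j :=
        mul_le_mul_of_nonneg_right h (by positivity)
    _ = _ := by
        rw [e2, pow_succ]
        field_simp

/-- The rate of decay `p^{-1/2}` of the divided power coefficients of `theta γ₀`. -/
noncomputable def rate (p : ℕ) : ℝ := Real.sqrt (p : ℝ)⁻¹

theorem rate_nonneg : 0 ≤ rate p := Real.sqrt_nonneg _

theorem rate_sq : rate p ^ 2 = (p : ℝ)⁻¹ := Real.sq_sqrt inv_p_pos.le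

theorem rate_lt_one : rate p < 1 := by
  rw [rate, Real.sqrt_lt' one_pos, one_pow]
  exact inv_p_lt_one

/-- The only nonzero coefficients are $c^s/s!$ at $T^{p^js}$, and $|(p^js)!/s!|\le p^{-js}$, so
their divided power coefficients are at most $(|c|p^{-j})^s$. -/
theorem dpBound_expS_smul_X_pow {c : ℂ_[p]} {j : ℕ} (hj : j ≠ 0)
    (hc : ‖c‖ * (p : ℝ)⁻¹ ^ j ≤ (p : ℝ)⁻¹ ^ (p ^ j - 1)) :
    DPBound (rate p) (expS (c • (X : PowerSeries ℂ_[p]) ^ p ^ j)) := by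
  intro r
  have hm : 0 < p ^ j := pow_pos hp.out.pos j
  rw [expS_smul_X_pow hm.ne', coeff_mk]
  split_ifs with h
  · obtain ⟨s, rfl⟩ := h
    rw [Nat.mul_div_cancel_left _ hm, norm_mul, norm_div, norm_pow]
    have hs : 0 < ‖(s.factorial : ℂ_[p])‖ := norm_pos_iff.2 (by exact_mod_cast s.factorial_ne_zero)
    calc _ ≤ (p : ℝ)⁻¹ ^ (j * s) * ‖(s.factorial : ℂ_[p])‖ *
          (‖c‖ ^ s / ‖(s.factorial : ℂ_[p])‖) :=
          mul_le_mul_of_nonneg_right (norm_factorial_pow_mul_le j s) (by positivity)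
      _ = (‖c‖ * (p : ℝ)⁻¹ ^ j) ^ s := by
          rw [mul_pow, pow_mul]
          field_simp
      _ ≤ ((p : ℝ)⁻¹ ^ (p ^ j - 1)) ^ s := pow_le_pow_left₀ (mul_nonneg (norm_nonneg _) (pow_nonneg inv_p_pos.le _)) hc s
      _ = (rate p ^ (2 * (p ^ j - 1))) ^ s := by rw [pow_mul, rate_sq]
      _ ≤ (rate p ^ p ^ j) ^ s := by
          refine pow_le_pow_left₀ (pow_nonneg rate_nonneg _) ?_ s
          refine pow_le_pow_of_le_one rate_nonneg rate_lt_one.le ?_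
          -- Hence $p^j\le2(p^j-1)$, with equality for $p^j=2$; this is where the rate $p^{-1/2}$
          -- comes from.
          have : 2 ≤ p ^ j := hp.out.two_le.trans (Nat.le_self_pow hj p)
          omega
      _ = _ := by rw [← pow_mul]
  · rw [mul_zero, norm_zero]
    exact pow_nonneg rate_nonneg _

theorem dpBound_expS_powSeries {c : ℕ → ℂ_[p]} (hc0 : c 0 = 0)
    (hc : ∀ j, j ≠ 0 → ‖c j‖ * (p : ℝ)⁻¹ ^ j ≤ (p : ℝ)⁻¹ ^ (p ^ j - 1)) :
    DPBound (rate p) (expS (powSeries p c)) := by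
  intro r
  rw [coeff_expS_powSeries hp.out.one_lt hc0]
  refine DPBound.prod rate_nonneg _ _ (fun j hj => ?_) r
  have hj0 : j ≠ 0 := by rw [Finset.mem_Icc] at hj; omega
  exact dpBound_expS_smul_X_pow hj0 (hc j hj0)

include hγ₀ hγ₀' in
theorem dpBound_theta : DPBound (rate p) (theta γ₀) :=
  dpBound_expS_powSeries (if_pos rfl) fun _ hj => norm_dworkCoeff_mul_le hγ₀ hγ₀' hj

include hγ₀ hγ₀' in
theorem dpBound_thetaInv : DPBound (rate p) (thetaInv γ₀) := by
  refine dpBound_expS_powSeries (by simp [dworkCoeff]) fun j hj => ?_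
  rw [Pi.neg_apply, norm_neg]
  exact norm_dworkCoeff_mul_le hγ₀ hγ₀' hj

/-- The series `∏_{j ≥ 0} exp(γ_j (T / γ_0)^{p^j})`. -/
noncomputable def thetaHat (γ₀ : ℂ_[p]) : PowerSeries ℂ_[p] := exp ℂ_[p] * theta γ₀

include hγ₀' in
/-- The functional equation of `thetaHat`, in which the Artin-Hasse exponential occurs. -/
theorem expand_thetaHat_mul_artinHasse :
    expand p hp.out.ne_zero (rescale (γ₀ ^ (p - 1))⁻¹ (thetaHat γ₀)) * artinHasse ℂ_[p] p =
      thetaHat γ₀ := by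
  have hp1 := hp.out.one_lt
  have hγ := gamma_ne_zero hγ₀'
  have hp0 : (p : ℂ_[p]) ≠ 0 := by exact_mod_cast hp.out.ne_zero
  have h1 : thetaHat γ₀ = expS (powSeries p (Pi.single 0 1 + dworkCoeff γ₀)) := by
    rw [powSeries_add, expS_add (constantCoeff_powSeries hp1 _) (constantCoeff_powSeries hp1 _),
      powSeries_single hp1, pow_zero, pow_one, one_smul, expS_X]
    rfl
  have hc : Pi.single 0 1 + dworkCoeff γ₀ = fun j => gam γ₀ j / γ₀ ^ p ^ j := by
    funext j
    rcases j with _ | j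
    · simp [dworkCoeff, gam, div_self hγ]
    · simp [dworkCoeff]
  have h2 : constantCoeff (rescale (γ₀ ^ (p - 1))⁻¹ (powSeries p fun j => gam γ₀ j / γ₀ ^ p ^ j)) =
      0 := by
    rw [← coeff_zero_eq_constantCoeff_apply, coeff_rescale, coeff_zero_eq_constantCoeff_apply,
      constantCoeff_powSeries hp1, mul_zero]
  rw [h1, hc, expS_rescale (constantCoeff_powSeries hp1 _), expS_expand h2, artinHasse,
    expand_rescale_powSeries hp1, ← expS_add (constantCoeff_powSeries hp1 _)
      (constantCoeff_powSeries hp1 _), ← powSeries_add]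
  -- Both sides are exponentials of series in $T^{p^j}$. In degree $p^{j+1}$ the identity is
  -- $\gamma_{j+1}=\gamma_j+\gamma_0^{p^{j+1}}/p^{j+1}$ divided by $\gamma_0^{p^{j+1}}$.
  congr 2
  funext j
  rcases j with _ | j
  · simp [gam, div_self hγ]
  · simp only [Pi.add_apply, Nat.succ_ne_zero, if_false, Nat.add_sub_cancel]
    rw [show gam γ₀ (j + 1) = gam γ₀ j + γ₀ ^ p ^ (j + 1) / (p : ℂ_[p]) ^ (j + 1) by
      rw [gam, Finset.sum_range_succ, ← gam]]
    have e : γ₀ ^ p ^ (j + 1) = γ₀ ^ p ^ j * (γ₀ ^ (p - 1)) ^ p ^ j := by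
      rw [← pow_mul, ← pow_add, pow_succ]
      congr 1
      obtain ⟨q, rfl⟩ : ∃ q, p = q + 1 := ⟨p - 1, by omega⟩
      rw [Nat.add_sub_cancel]
      ring
    rw [add_div, div_right_comm, div_self (pow_ne_zero _ hγ), e, inv_pow]
    field_simp

/-- The operator `exp(-T) ∘ ψ ∘ exp(T)`, written in terms of overconvergent series. -/
noncomputable def frobOp (γ₀ : ℂ_[p]) (g : PowerSeries ℂ_[p]) : PowerSeries ℂ_[p] :=
  theta γ₀ * psi (γ₀ ^ (p - 1)) (artinHasse ℂ_[p] p * (thetaInv γ₀ * g))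

include hγ₀' in
-- The factor $\hat\theta$ is pulled inside $\psi$ as $\hat\theta(T^p/\gamma_0^{p-1})$; the
-- functional equation then absorbs the Artin-Hasse factor, and $\theta$ cancels.
theorem exp_mul_frobOp (g : PowerSeries ℂ_[p]) :
    exp ℂ_[p] * frobOp γ₀ g = psi (γ₀ ^ (p - 1)) (exp ℂ_[p] * g) := by
  rw [frobOp, ← mul_assoc, ← thetaHat,
    ← psi_expand_mul (pow_ne_zero _ (gamma_ne_zero hγ₀')), ← mul_assoc,
    expand_thetaHat_mul_artinHasse hγ₀', thetaHat, mul_assoc, ← mul_assoc (theta γ₀),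
    theta_mul_thetaInv, one_mul]

include hγ₀' in
-- After multiplication by the unit $\exp(T)$ this is the relation between $\psi$ and $T\,d/dT$.
theorem frobOp_twistedEuler (g : PowerSeries ℂ_[p]) :
    frobOp γ₀ (twistedEuler g) = (p : ℂ_[p]) • twistedEuler (frobOp γ₀ g) := by
  apply (isUnit_exp ℂ_[p]).mul_left_cancel
  rw [exp_mul_frobOp hγ₀', exp_mul_twistedEuler, psi_X_mul_derivative, mul_smul_comm,
    exp_mul_twistedEuler, exp_mul_frobOp hγ₀']

include hγ₀' in
theorem norm_gamma_pow : ‖γ₀ ^ (p - 1)‖ = (p : ℝ)⁻¹ := by rw [norm_pow, hγ₀']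

include hγ₀ hγ₀' in
-- Here the form of `frobOp` matters: the divided power coefficients of $\exp(T)$ are all $1$, so
-- conjugation by $\exp(T)$ gives no decay, whereas each factor in `frobOp` preserves it.
theorem dpNull_frobOp {g : PowerSeries ℂ_[p]} (hg : DPNull g) : DPNull (frobOp γ₀ g) :=
  ((dpBound_theta hγ₀ hγ₀').dpNull rate_nonneg rate_lt_one).mul <|
    DPNull.psi (norm_gamma_pow hγ₀') <|
      (dpNull_of_norm_coeff_le_one norm_coeff_artinHasse_le).mul <|
        ((dpBound_thetaInv hγ₀ hγ₀').dpNull rate_nonneg rate_lt_one).mul hg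

theorem coeff_zero_frobOp (g : PowerSeries ℂ_[p]) : coeff 0 (frobOp γ₀ g) = coeff 0 g := by
  simp [frobOp, psi, constantCoeff_theta, constantCoeff_thetaInv,
    constantCoeff_artinHasse hp.out.one_lt]

/-- The number `(-1)^{-s-1} (-s-1)!` for `s < 0`, and zero for `s ≥ 0`. -/
noncomputable def polar (p : ℕ) [Fact p.Prime] (s : ℤ) : ℂ_[p] :=
  if s < 0 then (-1) ^ (-s - 1).toNat * ((-s - 1).toNat.factorial : ℂ_[p]) else 0

/-- The coefficients of `(∑_{l ≥ 0} (-1)^l l! T^{-l-1}) theta(T)`. -/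
noncomputable def polarHat (γ₀ : ℂ_[p]) (s : ℤ) : ℂ_[p] :=
  ∑' ν : ℕ, polar p (s - ν) * coeff ν (theta γ₀)

theorem polar_neg_sub {m : ℕ} (hm : m ≠ 0) (ν : ℕ) :
    polar p (-(m : ℤ) - ν) = (-1) ^ (m + ν - 1) * ((m + ν - 1).factorial : ℂ_[p]) := by
  have e : (-(-(m : ℤ) - ν) - 1).toNat = m + ν - 1 := by omega
  rw [polar, if_pos (by omega), e]

include hγ₀ hγ₀' in
theorem norm_polar_mul_le {m : ℕ} (hm : m ≠ 0) (ν : ℕ) :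
    ‖polar p (-(m : ℤ) - ν) * coeff ν (theta γ₀)‖ ≤
      ‖((m - 1).factorial : ℂ_[p])‖ * rate p ^ ν := by
  rw [polar_neg_sub hm, mul_assoc, norm_mul, norm_pow, norm_neg, norm_one, one_pow, one_mul, norm_mul,
    show m + ν - 1 = m - 1 + ν by omega]
  calc _ ≤ ‖((m - 1).factorial : ℂ_[p])‖ * ‖(ν.factorial : ℂ_[p])‖ * ‖coeff ν (theta γ₀)‖ :=
        mul_le_mul_of_nonneg_right (norm_factorial_add_le _ _) (norm_nonneg _)
    _ = ‖((m - 1).factorial : ℂ_[p])‖ * ‖(ν.factorial : ℂ_[p]) * coeff ν (theta γ₀)‖ := by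
        rw [norm_mul, mul_assoc]
    _ ≤ _ := mul_le_mul_of_nonneg_left (dpBound_theta hγ₀ hγ₀' ν) (norm_nonneg _)

include hγ₀ hγ₀' in
theorem summable_polar {s : ℤ} (hs : s < 0) :
    Summable fun ν : ℕ => polar p (s - ν) * coeff ν (theta γ₀) := by
  obtain ⟨m, rfl⟩ : ∃ m : ℕ, s = -(m : ℤ) := ⟨(-s).toNat, by omega⟩
  have hm : m ≠ 0 := by omega
  apply NonarchimedeanAddGroup.summable_of_tendsto_cofinite_zero
  rw [Nat.cofinite_eq_atTop]
  refine squeeze_zero_norm (norm_polar_mul_le hγ₀ hγ₀' hm) ?_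
  simpa using (tendsto_pow_atTop_nhds_zero_of_lt_one rate_nonneg rate_lt_one).const_mul
    ‖((m - 1).factorial : ℂ_[p])‖

include hγ₀ hγ₀' in
-- The functional $T^{k+1}\mapsto(-1)^kk!$ applied to $\theta T^m$; the indices match by
-- $k=m-1+\nu$.
theorem hasSum_polarHat {m : ℕ} (hm : m ≠ 0) :
    HasSum (fun k : ℕ => (-1) ^ k * (k.factorial : ℂ_[p]) * coeff (k + 1) (theta γ₀ * X ^ m))
      (polarHat γ₀ (-(m : ℤ))) := by
  have h1 := (summable_polar hγ₀ hγ₀' (s := -(m : ℤ)) (by omega)).hasSum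
  rw [← polarHat] at h1
  refine (hasSum_iff_hasSum_of_ne_zero_bij (fun x => m - 1 + x.1) ?_ ?_ ?_).2 h1
  · intro x y hxy
    simp only at hxy
    exact Subtype.ext (by omega)
  · intro k hk
    rw [Function.mem_support, coeff_mul_X_pow'] at hk
    have hk1 : m ≤ k + 1 := by
      by_contra h
      simp [h] at hk
    rw [if_pos hk1] at hk
    refine ⟨⟨k + 1 - m, ?_⟩, ?_⟩
    · rw [Function.mem_support, polar_neg_sub hm]
      rwa [show m + (k + 1 - m) - 1 = k by omega]
    · simp only
      omega
  · intro x
    rw [polar_neg_sub hm, coeff_mul_X_pow', if_pos (by omega)]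
    rw [show m - 1 + x.1 + 1 - m = x.1 by omega, show m - 1 + x.1 = m + x.1 - 1 by omega]

include hγ₀ hγ₀' in
-- Write $\theta T^m=(T\,d/dT+T)g$, so the functional takes the value $g(0)$ there. Applying
-- `frobOp` gives $p\,(T\,d/dT+T)$ of a series with the same constant term $g(0)$, hence the value
-- is multiplied by $p$. The inverse of $\theta$ inside `frobOp` cancels $\theta$.
theorem hasSum_frob_polarHat {m : ℕ} (hm : m ≠ 0) :
    HasSum (fun k : ℕ => (-1) ^ k * (k.factorial : ℂ_[p]) *
        coeff (k + 1) (theta γ₀ * psi (γ₀ ^ (p - 1)) (artinHasse ℂ_[p] p * X ^ m)))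
      (p * polarHat γ₀ (-(m : ℤ))) := by
  have h0 : coeff 0 (theta γ₀ * X ^ m) = 0 := by simp [hm]
  have hs : Tendsto (fun k : ℕ => (k.factorial : ℂ_[p]) * coeff (k + 1) (theta γ₀ * X ^ m)) atTop
      (𝓝 0) := by
    have := (hasSum_polarHat hγ₀ hγ₀' hm).summable.tendsto_cofinite_zero
    rw [Nat.cofinite_eq_atTop, tendsto_zero_iff_norm_tendsto_zero] at this
    rw [tendsto_zero_iff_norm_tendsto_zero]
    refine this.congr fun k => ?_
    simp [norm_mul]
  obtain ⟨g, hg, hgf⟩ := exists_twistedEuler_eq h0 hs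
  have h1 := hasSum_twistedEuler hg
  rw [hgf] at h1
  have h2 := h1.unique (hasSum_polarHat hγ₀ hγ₀' hm)
  have h3 := (hasSum_twistedEuler (dpNull_frobOp hγ₀ hγ₀' hg)).mul_left (p : ℂ_[p])
  rw [coeff_zero_frobOp, h2] at h3
  refine h3.congr_fun fun k => ?_
  have h4 := frobOp_twistedEuler hγ₀' g
  rw [hgf, frobOp, ← mul_assoc (thetaInv γ₀), mul_comm (thetaInv γ₀), theta_mul_thetaInv,
    one_mul] at h4
  rw [h4, coeff_smul, smul_eq_mul]
  ring

end Dwork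

/-! ### Functional equations of the one-variable coefficients -/

theorem hasSum_of_summable_prod {M : Type*} [NormedAddCommGroup M] {F : ℕ × ℕ → M}
    (hF : Summable F) {g : ℕ → M} (hg : ∀ k, HasSum (fun ν => F (k, ν)) (g k)) :
    HasSum g (∑' x, F x) :=
  hF.hasSum.prod_fiberwise hg

theorem hasSum_antidiagonal_of_summable_prod {M : Type*} [NormedAddCommGroup M] {F : ℕ × ℕ → M}
    (hF : Summable F) :
    HasSum (fun n : ℕ => ∑ x ∈ Finset.HasAntidiagonal.antidiagonal n, F x) (∑' x, F x) := by
  have h := Finset.HasAntidiagonal.sigmaAntidiagonalEquivProd.hasSum_iff.2 hF.hasSum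
  refine h.sigma fun n => ?_
  exact Finset.hasSum (Finset.HasAntidiagonal.antidiagonal n) F

section Dwork

open PowerSeries Filter Topology Finset.HasAntidiagonal

variable {p : ℕ} [hp : Fact p.Prime] {γ₀ : ℂ_[p]}
  (hγ₀ : HasSum (fun i : ℕ => γ₀ ^ p ^ i / (p : ℂ_[p]) ^ i) 0)
  (hγ₀' : ‖γ₀‖ ^ (p - 1) = (p : ℝ)⁻¹)

include hγ₀' in
theorem norm_factorial_mul_coeff_psi_le (m k : ℕ) :
    ‖((k - 1).factorial : ℂ_[p])‖ *
      ‖coeff k (psi (γ₀ ^ (p - 1)) (artinHasse ℂ_[p] p * X ^ m))‖ ≤ (p : ℝ)⁻¹ ^ k := by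
  rw [psi, coeff_mk, norm_mul, norm_pow, norm_gamma_pow hγ₀', coeff_mul_X_pow']
  have h1 : ‖if m ≤ p * k then coeff (p * k - m) (artinHasse ℂ_[p] p) else 0‖ ≤ 1 := by
    split_ifs
    · exact norm_coeff_artinHasse_le _
    · simp
  calc _ ≤ 1 * ((p : ℝ)⁻¹ ^ k * 1) :=
        mul_le_mul (norm_natCast_le _)
          (mul_le_mul_of_nonneg_left h1 (pow_nonneg inv_p_pos.le _))
          (mul_nonneg (pow_nonneg inv_p_pos.le _) (norm_nonneg _)) zero_le_one
    _ = _ := by rw [one_mul, mul_one]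

theorem coeff_zero_psi_mul_X_pow (π : ℂ_[p]) {m : ℕ} (hm : m ≠ 0) (f : PowerSeries ℂ_[p]) :
    coeff 0 (psi π (f * X ^ m)) = 0 := by
  simp [psi, hm]

include hγ₀ hγ₀' in
-- Let $a$ be the series under $\psi$. The double series with terms $a_k\theta_\nu$ times the polar
-- number at $-k-\nu$ is summed by rows, which gives the asserted series, and by antidiagonals,
-- which gives the functional at $\theta a$, already known to be $p$ times the polar value.
theorem hasSum_psi_mul_polarHat {m : ℕ} (hm : m ≠ 0) :
    HasSum (fun k : ℕ => coeff k (psi (γ₀ ^ (p - 1)) (artinHasse ℂ_[p] p * X ^ m)) *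
      polarHat γ₀ (-(k : ℤ))) (p * polarHat γ₀ (-(m : ℤ))) := by
  set a := psi (γ₀ ^ (p - 1)) (artinHasse ℂ_[p] p * X ^ m) with ha
  have ha0 : coeff 0 a = 0 := coeff_zero_psi_mul_X_pow _ hm _
  let F : ℕ × ℕ → ℂ_[p] := fun x =>
    coeff x.1 a * (polar p (-(x.1 : ℤ) - x.2) * coeff x.2 (theta γ₀))
  have hF : Summable F := by
    apply NonarchimedeanAddGroup.summable_of_tendsto_cofinite_zero
    refine squeeze_zero_norm (a := fun x : ℕ × ℕ => (p : ℝ)⁻¹ ^ x.1 * rate p ^ x.2) (fun x => ?_) ?_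
    · by_cases hx : x.1 = 0
      · simp only [F, hx, ha0, zero_mul, norm_zero]
        exact mul_nonneg (pow_nonneg inv_p_pos.le _) (pow_nonneg rate_nonneg _)
      · simp only [F, norm_mul (coeff x.1 a)]
        calc _ ≤ ‖coeff x.1 a‖ * (‖((x.1 - 1).factorial : ℂ_[p])‖ * rate p ^ x.2) :=
              mul_le_mul_of_nonneg_left (norm_polar_mul_le hγ₀ hγ₀' hx _) (norm_nonneg _)
          _ = ‖((x.1 - 1).factorial : ℂ_[p])‖ * ‖coeff x.1 a‖ * rate p ^ x.2 := by ring
          _ ≤ _ := mul_le_mul_of_nonneg_right (norm_factorial_mul_coeff_psi_le hγ₀' m _)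
              (pow_nonneg rate_nonneg _)
    · refine tendsto_mul_cofinite_nhds_zero (f := fun k : ℕ => (p : ℝ)⁻¹ ^ k)
        (g := fun k : ℕ => rate p ^ k) ?_ ?_
      · rw [Nat.cofinite_eq_atTop]
        exact tendsto_pow_atTop_nhds_zero_of_lt_one inv_p_pos.le inv_p_lt_one
      · rw [Nat.cofinite_eq_atTop]
        exact tendsto_pow_atTop_nhds_zero_of_lt_one rate_nonneg rate_lt_one
  have h1 : HasSum (fun k : ℕ => coeff k a * polarHat γ₀ (-(k : ℤ))) (∑' x, F x) := by
    refine hasSum_of_summable_prod hF fun k => ?_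
    by_cases hk : k = 0
    · simp only [F, hk, ha0, zero_mul]
      exact hasSum_zero
    · have h := (summable_polar hγ₀ hγ₀' (s := -(k : ℤ)) (by omega)).hasSum.mul_left (coeff k a)
      rw [← polarHat] at h
      exact h
  have h2 : HasSum (fun n : ℕ => ∑ x ∈ antidiagonal n, F x) (∑' x, F x) :=
    hasSum_antidiagonal_of_summable_prod hF
  have h3 := hasSum_frob_polarHat hγ₀ hγ₀' hm
  rw [← ha] at h3
  have h4 : HasSum (fun n : ℕ => ∑ x ∈ antidiagonal n, F x) (p * polarHat γ₀ (-(m : ℤ))) := by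
    -- The functional reads coefficients from degree $1$ on; nothing is lost, as $a$ has no constant
    -- term.
    rw [← hasSum_nat_add_iff' 1]
    have e0 : ∑ i ∈ Finset.range 1, ∑ x ∈ antidiagonal i, F x = 0 := by
      simp [F, ha0]
    rw [e0, sub_zero]
    refine h3.congr_fun fun k => ?_
    rw [mul_comm (theta γ₀), coeff_mul, Finset.mul_sum]
    refine Finset.sum_congr rfl fun x hx => ?_
    rw [mem_antidiagonal] at hx
    by_cases hx1 : x.1 = 0
    · simp only [F, hx1, ha0]
      simp
    · simp only [F]
      rw [polar_neg_sub hx1, hx, Nat.add_sub_cancel]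
      ring
  rw [← h1.unique h1, h2.unique h4] at h1
  exact h1

include hγ₀ hγ₀' in
/-- The functional equation of `polarHat`. -/
theorem hasSum_polarHat_frob {s : ℤ} (hs : s < 0) :
    HasSum (fun ρ : ℕ => if (p : ℤ) ∣ s - ρ then (γ₀ ^ (p - 1)) ^ (-((s - ρ) / p)) *
      polarHat γ₀ ((s - ρ) / p) * coeff ρ (artinHasse ℂ_[p] p) else 0) (p * polarHat γ₀ s) := by
  obtain ⟨m, rfl⟩ : ∃ m : ℕ, s = -(m : ℤ) := ⟨(-s).toNat, by omega⟩
  have hm : m ≠ 0 := by omega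
  have hpZ : (p : ℤ) ≠ 0 := by exact_mod_cast hp.out.ne_zero
  -- The surviving terms have $\rho=pk-m$, where $(s-\rho)/p=-k$. Truncated subtraction does no harm
  -- because the coefficient of $T^k$ vanishes when $pk<m$.
  refine (hasSum_iff_hasSum_of_ne_zero_bij (fun x => p * x.1 - m) ?_ ?_ ?_).2
    (hasSum_psi_mul_polarHat hγ₀ hγ₀' hm)
  all_goals
    have key : ∀ k : ℕ, k ∈ Function.support (fun k : ℕ =>
        coeff k (psi (γ₀ ^ (p - 1)) (artinHasse ℂ_[p] p * X ^ m)) * polarHat γ₀ (-(k : ℤ))) →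
        m ≤ p * k := by
      intro k hk
      by_contra h
      rw [Function.mem_support, psi, coeff_mk, coeff_mul_X_pow', if_neg h] at hk
      simp at hk
  · rintro ⟨x, hx⟩ ⟨y, hy⟩ hxy
    simp only at hxy
    have h1 := key x hx
    have h2 := key y hy
    have h3 : p * x = p * y := by omega
    exact Subtype.ext (Nat.eq_of_mul_eq_mul_left hp.out.pos h3)
  · intro ρ hρ
    rw [Function.mem_support] at hρ
    have hd : (p : ℤ) ∣ -(m : ℤ) - ρ := by
      by_contra h
      rw [if_neg h] at hρ
      exact hρ rfl
    rw [if_pos hd] at hρ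
    have hd' : p ∣ m + ρ := by
      have := (dvd_neg (α := ℤ)).2 hd
      rw [show -(-(m : ℤ) - ρ) = ((m + ρ : ℕ) : ℤ) by push_cast; ring] at this
      exact_mod_cast this
    obtain ⟨k, hk⟩ := hd'
    have e : (-(m : ℤ) - ρ) / p = -(k : ℤ) := by
      rw [show -(m : ℤ) - ρ = p * (-(k : ℤ)) by
        have : ((m + ρ : ℕ) : ℤ) = ((p * k : ℕ) : ℤ) := by rw [hk]
        push_cast at this
        linarith]
      exact Int.mul_ediv_cancel_left _ hpZ
    refine ⟨⟨k, ?_⟩, ?_⟩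
    · rw [Function.mem_support, psi, coeff_mk, coeff_mul_X_pow', if_pos (by omega),
        show p * k - m = ρ by omega]
      rw [e, neg_neg, zpow_natCast] at hρ
      intro h
      apply hρ
      rw [← h]
      ring
    · simp only
      omega
  · rintro ⟨k, hk⟩
    have h1 := key k hk
    have e : -(m : ℤ) - ((p * k - m : ℕ) : ℤ) = p * (-(k : ℤ)) := by
      push_cast [Nat.cast_sub h1]
      ring
    simp only [e]
    rw [if_pos (dvd_mul_right _ _), Int.mul_ediv_cancel_left _ hpZ, neg_neg, zpow_natCast, psi,
      coeff_mk, coeff_mul_X_pow', if_pos h1]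
    ring

include hγ₀' in
/-- The functional equation of the coefficients of `thetaHat`. -/
theorem sum_coeff_thetaHat_frob (r : ℕ) :
    ∑ ρ ∈ Finset.range (r + 1), (if (p : ℤ) ∣ (r : ℤ) - ρ then
      (γ₀ ^ (p - 1)) ^ (-(((r : ℤ) - ρ) / p)) * coeff (((r : ℤ) - ρ) / p).toNat (thetaHat γ₀) *
        coeff ρ (artinHasse ℂ_[p] p) else 0) = coeff r (thetaHat γ₀) := by
  conv_rhs => rw [← expand_thetaHat_mul_artinHasse hγ₀', mul_comm, coeff_mul,
    Finset.Nat.sum_antidiagonal_eq_sum_range_succ_mk]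
  refine Finset.sum_congr rfl fun ρ hρ => ?_
  rw [Finset.mem_range] at hρ
  have e : (r : ℤ) - ρ = ((r - ρ : ℕ) : ℤ) := by
    rw [Nat.cast_sub (by omega)]
  rw [e, coeff_expand]
  have e2 : ((p : ℤ) ∣ ((r - ρ : ℕ) : ℤ)) ↔ p ∣ r - ρ := Int.natCast_dvd_natCast
  simp only [e2]
  split_ifs
  · rw [← Int.natCast_div, Int.toNat_natCast, zpow_neg, zpow_natCast, coeff_rescale, inv_pow]
    ring
  · simp

end Dwork

/-! ### The coefficients of the series $G_u^{(i)}$ as products over the variables -/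

theorem hasSum_split {R : Type*} [NormedCommRing R] [NonarchimedeanRing R] {κ : Type*} [Fintype κ]
    [DecidableEq κ] (i : κ) {f : ℕ → R} {S : R} (hf : HasSum f S) (g : κ → ℕ → R) (N : κ → ℕ)
    (hg : ∀ k, k ≠ i → ∀ m, N k ≤ m → g k m = 0) :
    HasSum (fun ν : κ → ℕ => f (ν i) * ∏ k ∈ Finset.univ.erase i, g k (ν k))
      (S * ∏ k ∈ Finset.univ.erase i, ∑ m ∈ Finset.range (N k), g k m) := by
  have hC : HasSum (fun τ : {k // k ≠ i} → ℕ => ∏ k, g k.1 (τ k))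
      (∏ k : {k // k ≠ i}, ∑ m ∈ Finset.range (N k.1), g k.1 m) := by
    rw [Finset.prod_univ_sum]
    refine hasSum_sum_of_ne_finset_zero fun τ hτ => ?_
    rw [Fintype.mem_piFinset] at hτ
    push Not at hτ
    obtain ⟨k, hk⟩ := hτ
    rw [Finset.mem_range, not_lt] at hk
    exact Finset.prod_eq_zero (Finset.mem_univ k) (hg k.1 k.2 _ hk)
  have h := (Equiv.funSplitAt i ℕ).hasSum_iff.2 (hf.mul_of_nonarchimedean hC)
  have e : ∀ G : κ → R, ∏ k ∈ Finset.univ.erase i, G k = ∏ k : {k // k ≠ i}, G k.1 := fun G =>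
    Finset.prod_subtype _ (fun x => by simp) G
  simp only [e]
  exact h

section Coefficients

open PowerSeries

variable {p : ℕ} [hp : Fact p.Prime] {n d : ℕ} {γ₀ : ℂ_[p]}

/-- The product formula for the coefficients of the series `G_u^{(i)}(Λ)`. -/
noncomputable def gProd (γ₀ : ℂ_[p]) (i : IntMon n d) (l : Expo n d) : ℂ_[p] :=
  polarHat γ₀ (l i.1) * ∏ k ∈ Finset.univ.erase i.1, coeff (l k).toNat (thetaHat γ₀)

theorem natExpo_nonneg (ν : Mon n d → ℕ) (k : Mon n d) : 0 ≤ natExpo ν k := by simp [natExpo]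

theorem natExpo_apply (ν : Mon n d → ℕ) (k : Mon n d) : natExpo ν k = (ν k : ℤ) := rfl

theorem degVec_neg (l : Expo n d) : degVec (-l) = -degVec l := by
  funext r
  simp [degVec]

theorem degVec_sub (l m : Expo n d) : degVec (l - m) = degVec l - degVec m := by
  rw [sub_eq_add_neg, degVec_add, degVec_neg, sub_eq_add_neg]

theorem degVec_zero : degVec (0 : Expo n d) = 0 := by
  funext r
  simp [degVec]

theorem degVec_nsmul (m : ℕ) (l : Expo n d) : degVec (m • l) = m • degVec l := by
  funext r
  simp [degVec, Finset.mul_sum, mul_assoc]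

/-- The last coordinate of the degree equation is $\sum_kl_k=u_{n+1}<0$, so the one unrestricted
coordinate must be negative. -/
theorem apply_lt_zero {i : IntMon n d} {u : Fin (n + 2) → ℤ} (hu : u (Fin.last _) < 0)
    {l : Expo n d} (h1 : degVec l = u) (h2 : ∀ k, k ≠ i.1 → 0 ≤ l k) :
    l i.1 + ∑ k ∈ Finset.univ.erase i.1, l k = u (Fin.last _) ∧ l i.1 < 0 := by
  have hs : ∑ k, l k = u (Fin.last _) := by rw [← degVec_last, h1]
  rw [← Finset.add_sum_erase _ _ (Finset.mem_univ i.1)] at hs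
  have : 0 ≤ ∑ k ∈ Finset.univ.erase i.1, l k :=
    Finset.sum_nonneg fun k hk' => h2 k (Finset.ne_of_mem_erase hk')
  exact ⟨hs, by linarith⟩

theorem mem_relSet_iff {i : IntMon n d} {u : Fin (n + 2) → ℤ} (hu : u (Fin.last _) < 0)
    {l : Expo n d} : l ∈ relSet i u ↔ degVec l = u ∧ ∀ k, k ≠ i.1 → 0 ≤ l k :=
  ⟨fun h => ⟨h.1, h.2.2⟩, fun h => ⟨h.1, (apply_lt_zero hu h.1 h.2).2.le, h.2⟩⟩

theorem degVec_natExpo_last_nonneg (ν : Mon n d → ℕ) :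
    degVec (natExpo ν) (Fin.last _) = ∑ k, (ν k : ℤ) := by
  rw [degVec_last]
  rfl

theorem sub_degVec_last_lt {u : Fin (n + 2) → ℤ} (hu : u (Fin.last _) < 0) (ν : Mon n d → ℕ) :
    (u - degVec (natExpo ν)) (Fin.last _) < 0 := by
  rw [Pi.sub_apply, degVec_natExpo_last_nonneg]
  have : (0 : ℤ) ≤ ∑ k, (ν k : ℤ) := Finset.sum_nonneg fun k _ => Int.natCast_nonneg _
  linarith

theorem sub_natExpo_mem_relSet_iff {i : IntMon n d} {u : Fin (n + 2) → ℤ}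
    (hu : u (Fin.last _) < 0) {l : Expo n d} (ν : Mon n d → ℕ) :
    l - natExpo ν ∈ relSet i (u - degVec (natExpo ν)) ↔
      degVec l = u ∧ ∀ k, k ≠ i.1 → (ν k : ℤ) ≤ l k := by
  rw [mem_relSet_iff (sub_degVec_last_lt hu ν), degVec_sub, sub_left_inj]
  simp [natExpo_apply]

theorem gTerm_eq_zero {i : IntMon n d} {u : Fin (n + 2) → ℤ} (hu : u (Fin.last _) < 0)
    {l : Expo n d} (hl : l ∉ relSet i u) (ν : Mon n d → ℕ) : gTerm γ₀ i u l ν = 0 := by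
  rw [gTerm, fCoeff, if_neg, zero_mul]
  rw [sub_natExpo_mem_relSet_iff hu]
  rintro ⟨h1, h2⟩
  exact hl ((mem_relSet_iff hu).2 ⟨h1, fun k hk => (Int.natCast_nonneg _).trans (h2 k hk)⟩)

/-- Subtracting $\nu$ from $l$ and $\deg\nu$ from $u$ preserves the degree equation, so the only
remaining condition is $\nu_k\le l_k$ for $k\ne i$, and it separates by variables. -/
theorem gTerm_eq_prod {i : IntMon n d} {u : Fin (n + 2) → ℤ} (hu : u (Fin.last _) < 0)
    {l : Expo n d} (hl : l ∈ relSet i u) (ν : Mon n d → ℕ) :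
    gTerm γ₀ i u l ν = (polar p (l i.1 - ν i.1) * coeff (ν i.1) (theta γ₀)) *
      ∏ k ∈ Finset.univ.erase i.1, if ν k ≤ (l k).toNat then
        (((l k).toNat - ν k).factorial : ℂ_[p])⁻¹ * coeff (ν k) (theta γ₀) else 0 := by
  have h1 := (mem_relSet_iff hu).1 hl
  have hneg := (apply_lt_zero hu h1.1 h1.2).2
  rw [gTerm, fCoeff]
  by_cases h : ∀ k, k ≠ i.1 → (ν k : ℤ) ≤ l k
  · rw [if_pos ((sub_natExpo_mem_relSet_iff hu ν).2 ⟨h1.1, h⟩),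
      ← Finset.mul_prod_erase Finset.univ _ (Finset.mem_univ i.1), polar, if_pos (by omega),
      div_eq_mul_inv, ← Finset.prod_inv_distrib]
    simp only [thetaOneCoeff_eq, Expo.sub_apply, natExpo_apply]
    have e : ∀ k ∈ Finset.univ.erase i.1, (if ν k ≤ (l k).toNat then
        (((l k).toNat - ν k).factorial : ℂ_[p])⁻¹ * coeff (ν k) (theta γ₀) else 0) =
        ((l k - (ν k : ℤ)).toNat.factorial : ℂ_[p])⁻¹ * coeff (ν k) (theta γ₀) := by
      intro k hk
      have hk1 := h k (Finset.ne_of_mem_erase hk)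
      rw [if_pos (by omega), show (l k - (ν k : ℤ)).toNat = (l k).toNat - ν k by omega]
    rw [Finset.prod_congr rfl e, Finset.prod_mul_distrib]
    ring
  · rw [if_neg, zero_mul]
    · push Not at h
      obtain ⟨k, hk, hk2⟩ := h
      rw [Finset.prod_eq_zero (Finset.mem_erase.2 ⟨hk, Finset.mem_univ k⟩), mul_zero]
      have := h1.2 k hk
      rw [if_neg (by omega)]
    · rw [sub_natExpo_mem_relSet_iff hu]
      exact fun h' => h h'.2

theorem coeff_thetaHat_eq (r : ℕ) : coeff r (thetaHat γ₀) =
    ∑ m ∈ Finset.range (r + 1), if m ≤ r then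
        ((r - m).factorial : ℂ_[p])⁻¹ * coeff m (theta γ₀) else 0 := by
  rw [thetaHat, mul_comm, coeff_mul, Finset.Nat.sum_antidiagonal_eq_sum_range_succ_mk]
  refine Finset.sum_congr rfl fun m hm => ?_
  rw [if_pos (by rw [Finset.mem_range] at hm; omega), coeff_exp, mul_comm]
  simp

variable (hγ₀ : HasSum (fun i : ℕ => γ₀ ^ p ^ i / (p : ℂ_[p]) ^ i) 0)
  (hγ₀' : ‖γ₀‖ ^ (p - 1) = (p : ℝ)⁻¹)

include hγ₀ hγ₀' in
-- The summation over $\nu_i$ is the series for `polarHat`; for $k\ne i$ the summation over $\nu_k$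
-- is the Cauchy product $\exp(T)\,\theta$ in degree $l_k$.
theorem hasSum_gTerm {i : IntMon n d} {u : Fin (n + 2) → ℤ} (hu : u (Fin.last _) < 0)
    {l : Expo n d} (hl : l ∈ relSet i u) : HasSum (gTerm γ₀ i u l) (gProd γ₀ i l) := by
  have h1 := (mem_relSet_iff hu).1 hl
  have hneg := (apply_lt_zero hu h1.1 h1.2).2
  have hs := (summable_polar hγ₀ hγ₀' hneg).hasSum
  rw [← polarHat] at hs
  have h := hasSum_split i.1 hs (fun k m => if m ≤ (l k).toNat then
        (((l k).toNat - m).factorial : ℂ_[p])⁻¹ * coeff m (theta γ₀) else 0)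
        (fun k => (l k).toNat + 1) (fun k _ m hm => if_neg (by omega))
  simp only [← coeff_thetaHat_eq] at h
  rw [gProd]
  refine h.congr_fun fun ν => ?_
  exact gTerm_eq_prod hu hl ν

include hγ₀ hγ₀' in
theorem summable_gTerm {i : IntMon n d} {u : Fin (n + 2) → ℤ} (hu : u (Fin.last _) < 0)
    (l : Expo n d) : Summable (gTerm γ₀ i u l) := by
  by_cases hl : l ∈ relSet i u
  · exact (hasSum_gTerm hγ₀ hγ₀' hu hl).summable
  · exact summable_zero.congr fun ν => (gTerm_eq_zero hu hl ν).symm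

include hγ₀ hγ₀' in
theorem gCoeff_eq_gProd {i : IntMon n d} {u : Fin (n + 2) → ℤ} (hu : u (Fin.last _) < 0)
    {l : Expo n d} (hl : l ∈ relSet i u) : gCoeff γ₀ i u l = gProd γ₀ i l :=
  (hasSum_gTerm hγ₀ hγ₀' hu hl).tsum_eq

theorem gCoeff_eq_zero {i : IntMon n d} {u : Fin (n + 2) → ℤ} (hu : u (Fin.last _) < 0)
    {l : Expo n d} (hl : l ∉ relSet i u) : gCoeff γ₀ i u l = 0 := by
  simp [gCoeff, gTerm_eq_zero hu hl]

include hγ₀ hγ₀' in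
-- Multinomial integrality: since the last coordinate of $u$ is at most $-1$, the number
-- $-(l-\nu)_i-1$ is at least $\sum_{k\ne i}(l-\nu)_k+\sum_k\nu_k$. So its factorial absorbs the
-- denominators, and the remaining $\nu_k!$ make the coefficients of $\theta$ integral.
theorem norm_gTerm_le {i : IntMon n d} {u : Fin (n + 2) → ℤ} (hu : u (Fin.last _) < 0)
    (l : Expo n d) (ν : Mon n d → ℕ) : ‖gTerm γ₀ i u l ν‖ ≤ 1 := by
  rw [gTerm, fCoeff]
  split_ifs with h
  · obtain ⟨hdeg, -, hk⟩ := h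
    obtain ⟨hs, hneg⟩ := apply_lt_zero (sub_degVec_last_lt hu ν) hdeg hk
    have hdvd : (∏ k ∈ Finset.univ.erase i.1, ((l - natExpo ν) k).toNat.factorial) *
        (∏ k, (ν k).factorial) ∣ (-(l - natExpo ν) i.1 - 1).toNat.factorial := by
      refine (mul_dvd_mul (Nat.prod_factorial_dvd_factorial_sum _ _)
        (Nat.prod_factorial_dvd_factorial_sum _ _)).trans ?_
      refine (Nat.factorial_mul_factorial_dvd_factorial_add _ _).trans ?_
      apply Nat.factorial_dvd_factorial
      rw [Pi.sub_apply, degVec_natExpo_last_nonneg] at hs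
      have e : ((∑ k ∈ Finset.univ.erase i.1, ((l - natExpo ν) k).toNat : ℕ) : ℤ) =
          ∑ k ∈ Finset.univ.erase i.1, (l - natExpo ν) k := by
        rw [Nat.cast_sum]
        refine Finset.sum_congr rfl fun k hk' => ?_
        exact Int.toNat_of_nonneg (hk k (Finset.ne_of_mem_erase hk'))
      have e2 : ((∑ k, ν k : ℕ) : ℤ) = ∑ k, (ν k : ℤ) := Nat.cast_sum _ _
      omega
    have h1 := norm_natCast_le_of_dvd (p := p) hdvd
    rw [Nat.cast_mul, norm_mul, Nat.cast_prod, Nat.cast_prod] at h1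
    have hpos : 0 < ‖∏ k ∈ Finset.univ.erase i.1,
        (((l - natExpo ν) k).toNat.factorial : ℂ_[p])‖ := by
      rw [norm_pos_iff, Finset.prod_ne_zero_iff]
      intro k _
      exact_mod_cast Nat.factorial_ne_zero _
    rw [norm_mul, norm_div, norm_mul, norm_pow, norm_neg, norm_one, one_pow, one_mul]
    have h2 : ‖∏ k, ((ν k).factorial : ℂ_[p])‖ * ‖∏ k, thetaOneCoeff γ₀ (ν k)‖ ≤ 1 := by
      rw [← norm_mul, ← Finset.prod_mul_distrib, norm_prod]
      refine Finset.prod_le_one (fun k _ => norm_nonneg _) fun k _ => ?_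
      rw [thetaOneCoeff_eq]
      exact (dpBound_theta hγ₀ hγ₀' _).trans (pow_le_one₀ rate_nonneg rate_lt_one.le)
    rw [div_mul_eq_mul_div, div_le_one hpos]
    calc _ ≤ _ := mul_le_mul_of_nonneg_right h1 (norm_nonneg _)
      _ = ‖∏ k ∈ Finset.univ.erase i.1, (((l - natExpo ν) k).toNat.factorial : ℂ_[p])‖ *
          (‖∏ k, ((ν k).factorial : ℂ_[p])‖ * ‖∏ k, thetaOneCoeff γ₀ (ν k)‖) := by ring
      _ ≤ _ := mul_le_of_le_one_right (norm_nonneg _) h2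
  · simp

include hγ₀ hγ₀' in
theorem norm_gCoeff_le {i : IntMon n d} {u : Fin (n + 2) → ℤ} (hu : u (Fin.last _) < 0)
    (l : Expo n d) : ‖gCoeff γ₀ i u l‖ ≤ 1 :=
  IsUltrametricDist.norm_tsum_le_of_forall_le_of_nonneg zero_le_one (norm_gTerm_le hγ₀ hγ₀' hu l)

include hγ₀ hγ₀' in
-- The term $\nu=0$ equals $1$ and all others have norm at most $p^{-1/2}$.
theorem norm_polarHat_neg_one : ‖polarHat γ₀ (-1)‖ = 1 := by
  have hs := summable_polar hγ₀ hγ₀' (s := -1) (by norm_num)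
  have h := hs.tsum_eq_zero_add
  rw [← polarHat] at h
  have h0 : polar p (-1 - ((0 : ℕ) : ℤ)) * coeff 0 (theta γ₀) = 1 := by
    simp [polar, constantCoeff_theta]
  have h1 : ‖∑' ν : ℕ, polar p (-1 - ((ν + 1 : ℕ) : ℤ)) * coeff (ν + 1) (theta γ₀)‖ < 1 := by
    refine lt_of_le_of_lt (IsUltrametricDist.norm_tsum_le_of_forall_le_of_nonneg rate_nonneg
      fun ν => ?_) (rate_lt_one (p := p))
    have := norm_polar_mul_le hγ₀ hγ₀' one_ne_zero (ν + 1)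
    rw [Nat.cast_one] at this
    refine this.trans ?_
    simp only [Nat.sub_self, Nat.factorial_zero, Nat.cast_one, norm_one, one_mul]
    exact pow_le_of_le_one rate_nonneg rate_lt_one.le (Nat.succ_ne_zero ν)
  rw [h, h0]
  have h2 := IsUltrametricDist.norm_add_eq_max_of_norm_ne_norm
    (x := (1 : ℂ_[p])) (y := ∑' ν : ℕ, polar p (-1 - ((ν + 1 : ℕ) : ℤ)) * coeff (ν + 1) (theta γ₀))
    (by rw [norm_one]; exact h1.ne')
  rw [h2, norm_one, max_eq_left h1.le]

include hγ₀ hγ₀' in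
/-- The functional equation of the coefficients of `G_u^{(i)}(Λ)`. -/
theorem hasSum_gProd_frob {i : IntMon n d} {u : Fin (n + 2) → ℤ} (hu : u (Fin.last _) < 0)
    {l : Expo n d} (hl : l ∈ relSet i u) :
    HasSum (fun ρ : Mon n d → ℕ => (if (p : ℤ) ∣ l i.1 - ρ i.1 then
        (γ₀ ^ (p - 1)) ^ (-((l i.1 - ρ i.1) / p)) * polarHat γ₀ ((l i.1 - ρ i.1) / p) *
          coeff (ρ i.1) (artinHasse ℂ_[p] p) else 0) *
      ∏ k ∈ Finset.univ.erase i.1, if (ρ k : ℤ) ≤ l k ∧ (p : ℤ) ∣ l k - ρ k then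
        (γ₀ ^ (p - 1)) ^ (-((l k - ρ k) / p)) * coeff ((l k - ρ k) / p).toNat (thetaHat γ₀) *
          coeff (ρ k) (artinHasse ℂ_[p] p) else 0) (p * gProd γ₀ i l) := by
  have h1 := (mem_relSet_iff hu).1 hl
  have hneg := (apply_lt_zero hu h1.1 h1.2).2
  have hs := hasSum_polarHat_frob hγ₀ hγ₀' hneg
  have h := hasSum_split i.1 hs (fun k m => if (m : ℤ) ≤ l k ∧ (p : ℤ) ∣ l k - m then
        (γ₀ ^ (p - 1)) ^ (-((l k - m) / p)) * coeff ((l k - m) / p).toNat (thetaHat γ₀) *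
          coeff m (artinHasse ℂ_[p] p) else 0)
        (fun k => (l k).toNat + 1) (fun k hk m hm => if_neg fun h' => by
          have := h1.2 k hk
          omega)
  have e : ∀ k ∈ Finset.univ.erase i.1, ∑ m ∈ Finset.range ((l k).toNat + 1),
      (if (m : ℤ) ≤ l k ∧ (p : ℤ) ∣ l k - m then
        (γ₀ ^ (p - 1)) ^ (-((l k - m) / p)) * coeff ((l k - m) / p).toNat (thetaHat γ₀) *
          coeff m (artinHasse ℂ_[p] p) else 0) = coeff (l k).toNat (thetaHat γ₀) := by
    intro k hk
    rw [← sum_coeff_thetaHat_frob hγ₀' (l k).toNat]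
    refine Finset.sum_congr rfl fun m hm => ?_
    rw [Finset.mem_range] at hm
    have h0 := h1.2 k (Finset.ne_of_mem_erase hk)
    have hm' : (m : ℤ) ≤ l k := by omega
    rw [Int.toNat_of_nonneg h0]
    simp only [hm', true_and]
  rw [Finset.prod_congr rfl e, mul_assoc] at h
  exact h

end Coefficients

/-! ### Bounded series -/

section Bounded

variable {p : ℕ} [hp : Fact p.Prime] {n d : ℕ}

/-- All coefficients of `ξ` have norm at most `C`. -/
def Bdd (C : ℝ) (ξ : Series p n d) : Prop := ∀ l, ‖ξ.coeff l‖ ≤ C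

theorem Bdd.mono {C C' : ℝ} (h : C ≤ C') {ξ : Series p n d} (hξ : Bdd C ξ) : Bdd C' ξ :=
  fun l => (hξ l).trans h

theorem Bdd.zero {C : ℝ} (hC : 0 ≤ C) : Bdd C (0 : Series p n d) := fun l => by simpa using hC

theorem Bdd.add {C : ℝ} {ξ η : Series p n d} (hξ : Bdd C ξ) (hη : Bdd C η) : Bdd C (ξ + η) :=
  fun l => by
    rw [HahnSeries.coeff_add]
    exact (IsUltrametricDist.norm_add_le_max _ _).trans (max_le (hξ l) (hη l))

theorem Bdd.neg {C : ℝ} {ξ : Series p n d} (hξ : Bdd C ξ) : Bdd C (-ξ) := fun l => by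
  rw [HahnSeries.coeff_neg, norm_neg]
  exact hξ l

theorem Bdd.sub {C : ℝ} {ξ η : Series p n d} (hξ : Bdd C ξ) (hη : Bdd C η) : Bdd C (ξ - η) := by
  rw [sub_eq_add_neg]
  exact hξ.add hη.neg

theorem Bdd.mul {C C' : ℝ} (hC : 0 ≤ C) (hC' : 0 ≤ C') {ξ η : Series p n d} (hξ : Bdd C ξ)
    (hη : Bdd C' η) : Bdd (C * C') (ξ * η) := fun l => by
  rw [HahnSeries.coeff_mul]
  refine IsUltrametricDist.norm_sum_le_of_forall_le_of_nonneg (mul_nonneg hC hC') fun x _ => ?_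
  rw [norm_mul]
  exact mul_le_mul (hξ _) (hη _) (norm_nonneg _) hC

theorem Bdd.single {C : ℝ} (hC : 0 ≤ C) (a : Expo n d) {c : ℂ_[p]} (hc : ‖c‖ ≤ C) :
    Bdd C (HahnSeries.single a c : Series p n d) := fun l => by
  classical
  rw [HahnSeries.coeff_single]
  split_ifs
  · exact hc
  · simpa using hC

theorem Bdd.one : Bdd 1 (1 : Series p n d) := Bdd.single zero_le_one _ norm_one.le

theorem Bdd.smul {C : ℝ} {c : ℂ_[p]} {ξ : Series p n d} (hξ : Bdd C ξ) : Bdd (‖c‖ * C) (c • ξ) :=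
  fun l => by
    rw [HahnSeries.coeff_smul, smul_eq_mul, norm_mul]
    exact mul_le_mul_of_nonneg_left (hξ l) (norm_nonneg _)

theorem Bdd.sum {C : ℝ} (hC : 0 ≤ C) {ι : Type*} (s : Finset ι) (f : ι → Series p n d)
    (hf : ∀ i ∈ s, Bdd C (f i)) : Bdd C (∑ i ∈ s, f i) :=
  Finset.sum_induction f (Bdd C) (fun _ _ => Bdd.add) (Bdd.zero hC) hf

/-- The subring of series with integral coefficients. -/
noncomputable def intRing (p : ℕ) [Fact p.Prime] (n d : ℕ) : Subring (Series p n d) where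
  carrier := {ξ | Bdd 1 ξ}
  mul_mem' ha hb := by simpa using Bdd.mul zero_le_one zero_le_one ha hb
  one_mem' := Bdd.one
  add_mem' ha hb := Bdd.add ha hb
  zero_mem' := Bdd.zero zero_le_one
  neg_mem' ha := Bdd.neg ha

/-! ### Integral series of degree zero with nonnegative exponents -/

/-- The weight bounds every coordinate, so it is positive unless $l=0$, and the order compares
weights first. -/
theorem relSet_zero_nonneg {i : IntMon n d} {l : Expo n d} (hl : l ∈ relSet i 0) : 0 ≤ l := by
  have h := abs_le_wt hl
  have hk0 : Nonempty (Mon n d) := ⟨i.1⟩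
  have h0 : 0 ≤ wt l := (abs_nonneg _).trans (h i.1)
  rcases h0.eq_or_lt with h1 | h1
  · have : l = 0 := by
      ext k
      have := h k
      rw [← h1] at this
      simpa using this
    rw [this]
  · refine le_of_lt ?_
    change lexKey 0 < lexKey l
    refine Prod.Lex.lt_iff.2 (Or.inl ?_)
    change wt (0 : Expo n d) < wt l
    have : wt (0 : Expo n d) = 0 := by simp [wt]
    rwa [this]

/-- The exponents of degree zero that are nonnegative for the order of the lattice. -/
def posSet (n d : ℕ) : Set (Expo n d) := {l | 0 ≤ l ∧ degVec l = 0}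

theorem relSet_zero_subset_posSet (i : IntMon n d) : relSet i 0 ⊆ posSet n d :=
  fun _ hl => ⟨relSet_zero_nonneg hl, hl.1⟩

theorem zero_mem_posSet : (0 : Expo n d) ∈ posSet n d := ⟨le_rfl, degVec_zero⟩

theorem add_mem_posSet {l m : Expo n d} (hl : l ∈ posSet n d) (hm : m ∈ posSet n d) :
    l + m ∈ posSet n d := ⟨add_nonneg hl.1 hm.1, by rw [degVec_add, hl.2, hm.2, add_zero]⟩

/-- The subring of integral series of degree zero with nonnegative exponents. -/
noncomputable def posRing (p : ℕ) [Fact p.Prime] (n d : ℕ) : Subring (Series p n d) where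
  carrier := {ξ | Bdd 1 ξ ∧ ∀ l, ξ.coeff l ≠ 0 → l ∈ posSet n d}
  mul_mem' {a b} ha hb := by
    refine ⟨(intRing p n d).mul_mem ha.1 hb.1, fun l hl => ?_⟩
    rw [HahnSeries.coeff_mul] at hl
    obtain ⟨x, hx, hx0⟩ := Finset.exists_ne_zero_of_sum_ne_zero hl
    rw [Finset.mem_antidiagonal] at hx
    rw [← hx.2.2]
    exact add_mem_posSet (ha.2 _ hx.1) (hb.2 _ hx.2.1)
  one_mem' := by
    refine ⟨Bdd.one, fun l hl => ?_⟩
    rw [HahnSeries.coeff_one] at hl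
    have : l = 0 := by
      by_contra h
      simp [h] at hl
    rw [this]
    exact zero_mem_posSet
  add_mem' {a b} ha hb := by
    refine ⟨ha.1.add hb.1, fun l hl => ?_⟩
    rw [HahnSeries.coeff_add] at hl
    by_cases h : a.coeff l = 0
    · rw [h, zero_add] at hl
      exact hb.2 l hl
    · exact ha.2 l h
  zero_mem' := ⟨Bdd.zero zero_le_one, fun l hl => absurd rfl hl⟩
  neg_mem' {a} ha := ⟨ha.1.neg, fun l hl => ha.2 l (by simpa using hl)⟩

/-- Nonnegative exponents add up to zero only if both are zero. -/
theorem coeff_zero_mul {a b : Series p n d} (ha : a ∈ posRing p n d) (hb : b ∈ posRing p n d) :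
    (a * b).coeff 0 = a.coeff 0 * b.coeff 0 := by
  rw [HahnSeries.coeff_mul, Finset.sum_eq_single (0, 0)]
  · intro x hx hx0
    exfalso
    apply hx0
    rw [Finset.mem_antidiagonal] at hx
    have h1 := (ha.2 _ hx.1).1
    have h2 := (hb.2 _ hx.2.1).1
    obtain ⟨h3, h4⟩ := (add_eq_zero_iff_of_nonneg h1 h2).1 hx.2.2
    exact Prod.ext h3 h4
  · intro h
    rw [Finset.mem_antidiagonal] at h
    by_contra h'
    apply h
    exact ⟨left_ne_zero_of_mul h', right_ne_zero_of_mul h', add_zero 0⟩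

/-- The constant term of a series in `posRing`. -/
noncomputable def constTerm (p : ℕ) [Fact p.Prime] (n d : ℕ) : posRing p n d →+* ℂ_[p] where
  toFun ξ := ξ.1.coeff 0
  map_one' := by
    change HahnSeries.coeff (1 : Series p n d) 0 = 1
    rw [HahnSeries.coeff_one, if_pos rfl]
  map_mul' a b := coeff_zero_mul a.2 b.2
  map_zero' := rfl
  map_add' _ _ := rfl

/-- An element of `posRing` is invertible there if its constant term is a unit. -/
theorem inv_mem_posRing {ξ : Series p n d} (hξ : ξ ∈ posRing p n d) (h0 : ‖ξ.coeff 0‖ = 1) :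
    ξ⁻¹ ∈ posRing p n d := by
  have hne : ξ ≠ 0 := by
    rintro rfl
    simp at h0
  have hc0 : ξ.coeff 0 ≠ 0 := norm_ne_zero_iff.1 (by rw [h0]; exact one_ne_zero)
  set η := ξ⁻¹ with hη
  have hmul : ξ * η = 1 := mul_inv_cancel₀ hne
  suffices h : ∀ l, η.coeff l ≠ 0 → ‖η.coeff l‖ ≤ 1 ∧ l ∈ posSet n d by
    refine ⟨fun l => ?_, fun l hl => (h l hl).2⟩
    by_cases hl : η.coeff l = 0
    · rw [hl, norm_zero]
      exact zero_le_one
    · exact (h l hl).1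
  by_contra! hcon
  -- Take the least exponent $m$ where the claim fails for $\eta=\xi^{-1}$. The coefficient of
  -- $\xi\eta=1$ at $m$ expresses $\xi_0\eta_m$ by coefficients of $\eta$ at smaller exponents,
  -- where the claim holds, and $\xi_0$ is a unit.
  set B : Set (Expo n d) := {l | η.coeff l ≠ 0 ∧ (‖η.coeff l‖ ≤ 1 → l ∉ posSet n d)} with hB
  have hBne : B.Nonempty := hcon
  have hwf : B.IsWF := η.isWF_support.mono fun l hl => hl.1
  set m := hwf.min hBne with hm
  have hmB : m ∈ B := hwf.min_mem hBne
  have hlt : ∀ b, b < m → η.coeff b ≠ 0 → ‖η.coeff b‖ ≤ 1 ∧ b ∈ posSet n d := by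
    intro b hb hb0
    by_contra h
    exact hwf.not_lt_min hBne (show b ∈ B from ⟨hb0, fun h1 h2 => h ⟨h1, h2⟩⟩) hb
  have hsum := congrArg (fun x => HahnSeries.coeff x m) hmul
  simp only [HahnSeries.coeff_mul] at hsum
  have hmem : ((0 : Expo n d), m) ∈ Finset.antidiagonal ξ.isPWO_support η.isPWO_support m := by
    rw [Finset.mem_antidiagonal]
    exact ⟨hc0, hmB.1, zero_add _⟩
  rw [← Finset.add_sum_erase _ _ hmem] at hsum
  set R := ∑ x ∈ (Finset.antidiagonal ξ.isPWO_support η.isPWO_support m).erase (0, m),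
    ξ.coeff x.1 * η.coeff x.2 with hR
  have hterm : ∀ x ∈ (Finset.antidiagonal ξ.isPWO_support η.isPWO_support m).erase (0, m),
      ‖η.coeff x.2‖ ≤ 1 ∧ m ∈ posSet n d := by
    intro x hx
    rw [Finset.mem_erase, Finset.mem_antidiagonal] at hx
    obtain ⟨hx0, h1, h2, h3⟩ := hx
    have hx1 := hξ.2 _ h1
    have hpos : 0 < x.1 := by
      refine lt_of_le_of_ne hx1.1 fun h => hx0 ?_
      rw [← h, zero_add] at h3
      exact Prod.ext h.symm h3
    have := hlt x.2 (by rw [← h3]; exact lt_add_of_pos_left _ hpos) h2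
    exact ⟨this.1, by rw [← h3]; exact add_mem_posSet hx1 this.2⟩
  have hRle : ‖R‖ ≤ 1 := by
    refine IsUltrametricDist.norm_sum_le_of_forall_le_of_nonneg zero_le_one fun x hx => ?_
    rw [norm_mul]
    exact mul_le_one₀ (hξ.1 _) (norm_nonneg _) (hterm x hx).1
  have hone : ‖(1 : Series p n d).coeff m‖ ≤ 1 := Bdd.one m
  have hηm : ‖η.coeff m‖ ≤ 1 := by
    have : ξ.coeff 0 * η.coeff m = (1 : Series p n d).coeff m - R := by rw [← hsum]; ring
    have h := congrArg norm this
    rw [norm_mul, h0, one_mul] at h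
    rw [h, sub_eq_add_neg]
    exact (IsUltrametricDist.norm_add_le_max _ _).trans (max_le hone (by rwa [norm_neg]))
  apply hmB.2 hηm
  -- If another term occurs, $m$ is a sum of two elements of `posSet`; otherwise $\xi_0\eta_m$ is a
  -- coefficient of the series $1$, which forces $m=0$.
  by_cases hempty : ∃ x, x ∈ (Finset.antidiagonal ξ.isPWO_support η.isPWO_support m).erase (0, m)
  · obtain ⟨x, hx⟩ := hempty
    exact (hterm x hx).2
  · have hR0 : R = 0 := Finset.sum_eq_zero fun x hx => absurd ⟨x, hx⟩ hempty
    rw [hR0, add_zero, HahnSeries.coeff_one] at hsum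
    by_cases hm0 : m = 0
    · rw [hm0]
      exact zero_mem_posSet
    · rw [if_neg hm0] at hsum
      exact absurd ((mul_eq_zero.1 hsum).resolve_left hc0) hmB.1

/-! ### Matrices over `posRing` -/

variable {ι : Type*} [Fintype ι] [DecidableEq ι]

theorem det_mem_of_forall_mem {R : Type*} [CommRing R] (S : Subring R) {A : Matrix ι ι R}
    (hA : ∀ i j, A i j ∈ S) : A.det ∈ S := by
  rw [Matrix.det_apply]
  refine S.sum_mem fun σ _ => ?_
  rw [Units.smul_def]
  exact S.zsmul_mem (S.prod_mem fun i _ => hA _ _) _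

theorem adjugate_mem_of_forall_mem {R : Type*} [CommRing R] (S : Subring R) {A : Matrix ι ι R}
    (hA : ∀ i j, A i j ∈ S) (i j : ι) : A.adjugate i j ∈ S := by
  rw [Matrix.adjugate_apply]
  refine det_mem_of_forall_mem S fun a b => ?_
  rw [Matrix.updateRow_apply]
  split_ifs
  · rw [Pi.single_apply]
    split_ifs
    exacts [S.one_mem, S.zero_mem]
  · exact hA a b

theorem mul_mem_of_forall_mem {R : Type*} [CommRing R] (S : Subring R) {A B : Matrix ι ι R}
    (hA : ∀ i j, A i j ∈ S) (hB : ∀ i j, B i j ∈ S) (i j : ι) : (A * B) i j ∈ S := by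
  rw [Matrix.mul_apply]
  exact S.sum_mem fun k _ => S.mul_mem (hA _ _) (hB _ _)

theorem inv_mem_of_forall_mem {K : Type*} [Field K] (S : Subring K) {A : Matrix ι ι K}
    (hA : ∀ i j, A i j ∈ S) (hdet : A.det⁻¹ ∈ S) (i j : ι) : A⁻¹ i j ∈ S := by
  rw [Matrix.inv_def, Ring.inverse_eq_inv', Matrix.smul_apply, smul_eq_mul]
  exact S.mul_mem hdet (adjugate_mem_of_forall_mem S hA i j)

theorem coeff_zero_det {A : Matrix ι ι (Series p n d)} (hA : ∀ i j, A i j ∈ posRing p n d) :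
    A.det.coeff 0 = (Matrix.of fun i j => (A i j).coeff 0).det := by
  let A' : Matrix ι ι (posRing p n d) := fun i j => ⟨A i j, hA i j⟩
  have h1 : A = (posRing p n d).subtype.mapMatrix A' := rfl
  have h2 : A.det = (posRing p n d).subtype A'.det := by rw [h1, RingHom.map_det]
  have h3 := RingHom.map_det (constTerm p n d) A'
  rw [h2]
  exact h3

end Bounded

/-! ### The substitution `Λ ↦ Λ^p` -/

section Frobenius

variable {p : ℕ} [hp : Fact p.Prime] {n d : ℕ}

/-- The substitution `Λ ↦ Λ^p` as a ring homomorphism. -/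
noncomputable def frobHom (p : ℕ) [Fact p.Prime] (n d : ℕ) : Series p n d →+* Series p n d where
  toFun := frob
  map_one' := HahnSeries.embDomain_one _ (smul_zero p)
  map_mul' := HahnSeries.embDomain_mul _ (smul_add p)
  map_zero' := HahnSeries.embDomain_zero
  map_add' := HahnSeries.embDomain_add _

theorem frobHom_apply (ξ : Series p n d) : frobHom p n d ξ = frob ξ := rfl

theorem coeff_frob_nsmul (ξ : Series p n d) (l : Expo n d) :
    (frob ξ).coeff (p • l) = ξ.coeff l :=
  HahnSeries.embDomain_coeff (f := OrderEmbedding.ofStrictMono _ (nsmul_strictMono p n d))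

theorem coeff_frob_of_notMem {ξ : Series p n d} {m : Expo n d} (h : ∀ l : Expo n d, p • l ≠ m) :
    (frob ξ).coeff m = 0 :=
  HahnSeries.embDomain_of_notMem_range
    (f := OrderEmbedding.ofStrictMono _ (nsmul_strictMono p n d)) (by rintro ⟨l, hl⟩; exact h l hl)

theorem Bdd.frob {C : ℝ} (hC : 0 ≤ C) {ξ : Series p n d} (hξ : Bdd C ξ) : Bdd C (frob ξ) := by
  intro m
  by_cases h : ∃ l : Expo n d, p • l = m
  · obtain ⟨l, rfl⟩ := h
    rw [coeff_frob_nsmul]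
    exact hξ l
  · push Not at h
    rw [coeff_frob_of_notMem h, norm_zero]
    exact hC

theorem coeff_zero_frob (ξ : Series p n d) : (frob ξ).coeff 0 = ξ.coeff 0 := by
  have := coeff_frob_nsmul ξ 0
  rwa [smul_zero] at this

theorem frob_mem_posRing {ξ : Series p n d} (hξ : ξ ∈ posRing p n d) :
    frob ξ ∈ posRing p n d := by
  refine ⟨hξ.1.frob zero_le_one, fun m hm => ?_⟩
  by_cases h : ∃ l : Expo n d, p • l = m
  · obtain ⟨l, rfl⟩ := h
    rw [coeff_frob_nsmul] at hm
    obtain ⟨h1, h2⟩ := hξ.2 l hm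
    exact ⟨nsmul_nonneg h1 p, by rw [degVec_nsmul, h2, smul_zero]⟩
  · push Not at h
    exact absurd (coeff_frob_of_notMem h) hm

theorem frob_single (a : Expo n d) (c : ℂ_[p]) :
    frob (HahnSeries.single a c : Series p n d) = HahnSeries.single (p • a) c :=
  HahnSeries.embDomain_single

end Frobenius

/-! ### The series `G_u^{(i)}(Λ)` -/

section GSeries

open PowerSeries

variable {p : ℕ} [hp : Fact p.Prime] {n d : ℕ} {γ₀ : ℂ_[p]}

/-- The vectors `l` of given degree with `l_k ≥ 0` for `k ≠ i` are partially well ordered, by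
Dickson's lemma. -/
theorem isPWO_degree (i : IntMon n d) (u : Fin (n + 2) → ℤ) :
    {l : Expo n d | degVec l = u ∧ ∀ k, k ≠ i.1 → 0 ≤ l k}.IsPWO := by
  intro f
  obtain ⟨a, b, hab, hle⟩ := wellQuasiOrdered_le (α := Mon n d → ℕ)
    fun m k => ((f m).1 k).toNat
  refine ⟨a, b, hab, ?_⟩
  change (f a).1 ≤ (f b).1
  have hk : ∀ k, k ≠ i.1 → 0 ≤ ((f b).1 - (f a).1) k := by
    intro k hk
    have h1 := (f a).2.2 k hk
    have h2 := (f b).2.2 k hk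
    have h3 : ((f a).1 k).toNat ≤ ((f b).1 k).toNat := hle k
    rw [Expo.sub_apply]
    omega
  have hdeg : degVec ((f b).1 - (f a).1) = 0 := by
    rw [degVec_sub, (f a).2.1, (f b).2.1, sub_self]
  have hs : ∑ k, ((f b).1 - (f a).1) k = 0 := by rw [← degVec_last, hdeg]; rfl
  rw [← Finset.add_sum_erase _ _ (Finset.mem_univ i.1)] at hs
  have hnn : 0 ≤ ∑ k ∈ Finset.univ.erase i.1, ((f b).1 - (f a).1) k :=
    Finset.sum_nonneg fun k hk' => hk k (Finset.ne_of_mem_erase hk')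
  have := relSet_zero_nonneg (i := i) ⟨hdeg, by linarith, hk⟩
  exact sub_nonneg.1 this

theorem gCoeff_support_subset (γ₀ : ℂ_[p]) (i : IntMon n d) (u : Fin (n + 2) → ℤ) :
    (Function.support fun l : Expo n d => gCoeff γ₀ i u l) ⊆
      {l | degVec l = u ∧ ∀ k, k ≠ i.1 → 0 ≤ l k} := by
  intro l hl
  obtain ⟨ν, hν⟩ : ∃ ν : Mon n d → ℕ, gTerm γ₀ i u l ν ≠ 0 := by
    by_contra! h
    exact hl (by simp [gCoeff, h])
  have hmem : l - natExpo ν ∈ relSet i (u - degVec (natExpo ν)) := by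
    by_contra h
    exact hν (by simp [gTerm, fCoeff, h])
  refine ⟨?_, fun k hk => ?_⟩
  · have := hmem.1
    rwa [degVec_sub, sub_left_inj] at this
  · have h1 := hmem.2.2 k hk
    have h2 := natExpo_nonneg ν k
    rw [Expo.sub_apply] at h1
    linarith

/-- The series `G_u^{(i)}(Λ)`. -/
noncomputable def gSer (γ₀ : ℂ_[p]) (i : IntMon n d) (u : Fin (n + 2) → ℤ) : Series p n d where
  coeff := gCoeff γ₀ i u
  isPWO_support' := (isPWO_degree i u).mono (gCoeff_support_subset γ₀ i u)

theorem gMat_eq_single_mul (i j : IntMon n d) :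
    gMat γ₀ n d i j = HahnSeries.single (eVec j.1) 1 * gSer γ₀ i (-aVec j.1) := by
  ext l
  rw [HahnSeries.coeff_single_mul, one_mul]
  rfl

theorem aVec_last (k : Mon n d) : aVec k (Fin.last _) = 1 := by simp [aVec]

theorem neg_aVec_last (k : Mon n d) : (-aVec k) (Fin.last _) < 0 := by
  rw [Pi.neg_apply, aVec_last]
  norm_num

variable (hγ₀ : HasSum (fun i : ℕ => γ₀ ^ p ^ i / (p : ℂ_[p]) ^ i) 0)
  (hγ₀' : ‖γ₀‖ ^ (p - 1) = (p : ℝ)⁻¹)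

include hγ₀ hγ₀' in
theorem bdd_gSer (i : IntMon n d) {u : Fin (n + 2) → ℤ} (hu : u (Fin.last _) < 0) :
    Bdd 1 (gSer γ₀ i u) := fun l => norm_gCoeff_le hγ₀ hγ₀' hu l

include hγ₀ hγ₀' in
theorem gMat_mem_posRing (i j : IntMon n d) : gMat γ₀ n d i j ∈ posRing p n d :=
  ⟨fun _ => norm_gCoeff_le hγ₀ hγ₀' (neg_aVec_last j.1) _,
    fun _ hl => relSet_zero_subset_posSet i (gCoeff_support γ₀ i j hl)⟩

include hγ₀ hγ₀' in
-- The constant term of $G_{ij}$ is the coefficient of $\Lambda_j^{-1}$ in $G^{(i)}_{-\mathbf a_j}$.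
-- A negative exponent is allowed only at $i$, hence $i=j$, and then all other factors of the
-- product are $1$.
theorem coeff_zero_gMat (i j : IntMon n d) :
    (gMat γ₀ n d i j).coeff 0 = if i = j then polarHat γ₀ (-1) else 0 := by
  change gCoeff γ₀ i (-aVec j.1) (0 - eVec j.1) = _
  have hdeg : degVec (0 - eVec j.1 : Expo n d) = -aVec j.1 := by
    rw [zero_sub, degVec_neg, degVec_eVec]
  have hval : ∀ k, (0 - eVec j.1 : Expo n d) k = if k = j.1 then -1 else 0 := by
    intro k
    rw [zero_sub, Expo.neg_apply]
    change -(if k = j.1 then (1 : ℤ) else 0) = _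
    split_ifs <;> simp
  split_ifs with h
  · subst h
    have hmem : (0 - eVec i.1 : Expo n d) ∈ relSet i (-aVec i.1) := by
      refine (mem_relSet_iff (neg_aVec_last _)).2 ⟨hdeg, fun k hk => ?_⟩
      rw [hval, if_neg hk]
    rw [gCoeff_eq_gProd hγ₀ hγ₀' (neg_aVec_last _) hmem, gProd, hval, if_pos rfl,
      Finset.prod_eq_one, mul_one]
    intro k hk
    rw [hval, if_neg (Finset.ne_of_mem_erase hk)]
    simp [thetaHat, constantCoeff_theta]
  · refine gCoeff_eq_zero (neg_aVec_last _) fun hmem => ?_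
    have := ((mem_relSet_iff (neg_aVec_last _)).1 hmem).2 j.1 fun h' => h (Subtype.ext h'.symm)
    rw [hval, if_pos rfl] at this
    norm_num at this

include hγ₀ hγ₀' in
theorem norm_coeff_zero_det_gMat : ‖(gMat γ₀ n d).det.coeff 0‖ = 1 := by
  rw [coeff_zero_det (gMat_mem_posRing hγ₀ hγ₀')]
  have : (Matrix.of fun i j => (gMat γ₀ n d i j).coeff 0) =
      Matrix.diagonal fun _ => polarHat γ₀ (-1) := by
    ext i j
    rw [Matrix.of_apply, coeff_zero_gMat hγ₀ hγ₀', Matrix.diagonal_apply]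
  rw [this, Matrix.det_diagonal, norm_prod, Finset.prod_eq_one]
  exact fun _ _ => norm_polarHat_neg_one hγ₀ hγ₀'

include hγ₀ hγ₀' in
theorem det_gMat_ne_zero : (gMat γ₀ n d).det ≠ 0 := by
  intro h
  have := norm_coeff_zero_det_gMat (n := n) (d := d) hγ₀ hγ₀'
  rw [h, HahnSeries.coeff_zero, norm_zero] at this
  exact zero_ne_one this

include hγ₀ hγ₀' in
theorem isUnit_det_gMat : IsUnit (gMat γ₀ n d).det := (det_gMat_ne_zero hγ₀ hγ₀').isUnit

include hγ₀ hγ₀' in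
theorem gMat_inv_mem_posRing (i j : IntMon n d) : (gMat γ₀ n d)⁻¹ i j ∈ posRing p n d :=
  inv_mem_of_forall_mem _ (gMat_mem_posRing hγ₀ hγ₀')
    (inv_mem_posRing (det_mem_of_forall_mem _ (gMat_mem_posRing hγ₀ hγ₀'))
      (norm_coeff_zero_det_gMat hγ₀ hγ₀')) i j

include hγ₀ hγ₀' in
theorem gMat_map_frob_mul : (gMat γ₀ n d).map frob * (gMat γ₀ n d)⁻¹.map frob = 1 := by
  change (gMat γ₀ n d).map (frobHom p n d) * (gMat γ₀ n d)⁻¹.map (frobHom p n d) = 1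
  rw [← Matrix.map_mul, Matrix.mul_nonsing_inv _ (isUnit_det_gMat hγ₀ hγ₀'), Matrix.map_one _
    (map_zero _) (map_one _)]

include hγ₀ hγ₀' in
theorem gMat_map_frob_inv : ((gMat γ₀ n d).map frob)⁻¹ = (gMat γ₀ n d)⁻¹.map frob :=
  Matrix.inv_eq_right_inv (gMat_map_frob_mul hγ₀ hγ₀')

include hγ₀ hγ₀' in
theorem isUnit_gMat_map_frob : IsUnit ((gMat γ₀ n d).map frob) :=
  (Matrix.isUnit_iff_isUnit_det _).2 (Matrix.isUnit_det_of_right_inverse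
    (gMat_map_frob_mul hγ₀ hγ₀'))

include hγ₀ hγ₀' in
theorem calG_eq : calG γ₀ n d = (gMat γ₀ n d)⁻¹.map frob * gMat γ₀ n d := by
  rw [calG, gMat_map_frob_inv hγ₀ hγ₀']

include hγ₀ hγ₀' in
theorem calG_mem_posRing (i j : IntMon n d) : calG γ₀ n d i j ∈ posRing p n d := by
  rw [calG_eq hγ₀ hγ₀']
  exact mul_mem_of_forall_mem _ (fun a b => frob_mem_posRing (gMat_inv_mem_posRing hγ₀ hγ₀' a b))
    (gMat_mem_posRing hγ₀ hγ₀') i j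

include hγ₀ hγ₀' in
theorem det_calG_mem_posRing : (calG γ₀ n d).det ∈ posRing p n d :=
  det_mem_of_forall_mem _ (calG_mem_posRing hγ₀ hγ₀')

include hγ₀ hγ₀' in
-- The substitution $\Lambda\mapsto\Lambda^p$ does not change constant terms, so those of $\det
-- G(\Lambda^p)^{-1}$ and $\det G(\Lambda)$ cancel.
theorem coeff_zero_det_calG : (calG γ₀ n d).det.coeff 0 = 1 := by
  have hi := gMat_inv_mem_posRing (n := n) (d := d) hγ₀ hγ₀'
  have hg := gMat_mem_posRing (n := n) (d := d) hγ₀ hγ₀'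
  have hf : ∀ i j, (gMat γ₀ n d)⁻¹.map frob i j ∈ posRing p n d := fun i j =>
    frob_mem_posRing (hi i j)
  rw [calG_eq hγ₀ hγ₀', Matrix.det_mul, coeff_zero_mul (det_mem_of_forall_mem _ hf)
    (det_mem_of_forall_mem _ hg), coeff_zero_det hf]
  simp only [Matrix.map_apply, coeff_zero_frob]
  rw [← coeff_zero_det hi, ← coeff_zero_mul (det_mem_of_forall_mem _ hi)
    (det_mem_of_forall_mem _ hg), ← Matrix.det_mul,
    Matrix.nonsing_inv_mul _ (isUnit_det_gMat hγ₀ hγ₀'), Matrix.det_one, HahnSeries.coeff_one,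
    if_pos rfl]

include hγ₀ hγ₀' in
theorem det_calG_ne_zero : (calG γ₀ n d).det ≠ 0 := by
  intro h
  have := coeff_zero_det_calG (n := n) (d := d) hγ₀ hγ₀'
  rw [h, HahnSeries.coeff_zero] at this
  exact zero_ne_one this

include hγ₀ hγ₀' in
theorem det_calG_inv_mem_posRing : (calG γ₀ n d).det⁻¹ ∈ posRing p n d :=
  inv_mem_posRing (det_calG_mem_posRing hγ₀ hγ₀')
    (by rw [coeff_zero_det_calG hγ₀ hγ₀', norm_one])

/-! ### The functional equation of `G_u^{(i)}(Λ)` -/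

/-- The vector `(u - deg ρ) / p`. -/
noncomputable def shiftDeg (p : ℕ) (u : Fin (n + 2) → ℤ) (ρ : Mon n d → ℕ) : Fin (n + 2) → ℤ :=
  fun r => (u r - degVec (natExpo ρ) r) / p

/-- The coefficient of the monomial `Λ^ρ` in Dwork's Frobenius operator. -/
noncomputable def frobCoeff (γ₀ : ℂ_[p]) (u : Fin (n + 2) → ℤ) (ρ : Mon n d → ℕ) : ℂ_[p] :=
  if ∀ r, (p : ℤ) ∣ u r - degVec (natExpo ρ) r then
    (p : ℂ_[p])⁻¹ * (γ₀ ^ (p - 1)) ^ (-shiftDeg p u ρ (Fin.last _)) *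
      ∏ k, coeff (ρ k) (artinHasse ℂ_[p] p) else 0

/-- A term of Dwork's Frobenius operator applied to the series `G_u^{(i)}(Λ)`. -/
noncomputable def frobTerm (γ₀ : ℂ_[p]) (i : IntMon n d) (u : Fin (n + 2) → ℤ)
    (ρ : Mon n d → ℕ) : Series p n d :=
  HahnSeries.single (natExpo ρ) (frobCoeff γ₀ u ρ) * frob (gSer γ₀ i (shiftDeg p u ρ))

theorem shiftDeg_last_le {u : Fin (n + 2) → ℤ} (hu : u (Fin.last _) < 0) (ρ : Mon n d → ℕ) {K : ℤ}
    (hK : p * K ≤ ∑ k, (ρ k : ℤ)) : shiftDeg p u ρ (Fin.last _) ≤ -K - 1 := by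
  rw [shiftDeg, degVec_natExpo_last_nonneg]
  have hp0 : (0 : ℤ) < p := by exact_mod_cast hp.out.pos
  have : (u (Fin.last _) - ∑ k, (ρ k : ℤ)) / p < -K := by
    apply Int.ediv_lt_of_lt_mul hp0
    linarith
  omega

theorem shiftDeg_last_lt {u : Fin (n + 2) → ℤ} (hu : u (Fin.last _) < 0) (ρ : Mon n d → ℕ) :
    shiftDeg p u ρ (Fin.last _) < 0 := by
  have := shiftDeg_last_le (p := p) hu ρ (K := 0)
    (by rw [mul_zero]; exact Finset.sum_nonneg fun k _ => Int.natCast_nonneg _)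
  omega

include hγ₀' in
-- The number $\gamma_0^{p-1}$, of norm $p^{-1}$, occurs at least $K+1$ times; one factor is lost to
-- $p^{-1}$, and the Artin-Hasse coefficients are integral.
theorem norm_frobCoeff_le {u : Fin (n + 2) → ℤ} {ρ : Mon n d → ℕ} {K : ℕ}
    (hK : shiftDeg p u ρ (Fin.last _) ≤ -K - 1) : ‖frobCoeff γ₀ u ρ‖ ≤ (p : ℝ)⁻¹ ^ K := by
  have hp0 : (p : ℝ) ≠ 0 := (zero_lt_one.trans one_lt_cast_p).ne'
  rw [frobCoeff]
  split_ifs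
  · obtain ⟨e, he⟩ : ∃ e : ℕ, -shiftDeg p u ρ (Fin.last _) = ((K + 1 + e : ℕ) : ℤ) :=
      ⟨(-shiftDeg p u ρ (Fin.last _) - (K + 1)).toNat, by omega⟩
    rw [he, zpow_natCast, norm_mul, norm_mul, norm_pow, norm_gamma_pow hγ₀', norm_inv,
      norm_natCast_p, inv_inv]
    have h1 : ‖∏ k, coeff (ρ k) (artinHasse ℂ_[p] p)‖ ≤ 1 := by
      rw [norm_prod]
      exact Finset.prod_le_one (fun _ _ => norm_nonneg _) fun _ _ => norm_coeff_artinHasse_le _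
    have h2 : (p : ℝ) * (p : ℝ)⁻¹ ^ (K + 1 + e) ≤ (p : ℝ)⁻¹ ^ K := by
      have : (p : ℝ) * (p : ℝ)⁻¹ ^ (K + 1 + e) = (p : ℝ)⁻¹ ^ (K + e) := by
        rw [show K + 1 + e = K + e + 1 by ring, pow_succ]
        field_simp
      rw [this]
      exact pow_le_pow_of_le_one inv_p_pos.le inv_p_lt_one.le (Nat.le_add_right _ _)
    calc _ ≤ (p : ℝ)⁻¹ ^ K * 1 := mul_le_mul h2 h1 (norm_nonneg _) (pow_nonneg inv_p_pos.le _)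
      _ = _ := mul_one _
  · rw [norm_zero]
    exact pow_nonneg inv_p_pos.le _

include hγ₀ hγ₀' in
theorem bdd_frobTerm (i : IntMon n d) {u : Fin (n + 2) → ℤ} (hu : u (Fin.last _) < 0)
    {ρ : Mon n d → ℕ} {K : ℕ} (hK : shiftDeg p u ρ (Fin.last _) ≤ -K - 1) :
    Bdd ((p : ℝ)⁻¹ ^ K) (frobTerm γ₀ i u ρ) := by
  have := Bdd.mul (pow_nonneg inv_p_pos.le K) zero_le_one
    (Bdd.single (pow_nonneg inv_p_pos.le K) (natExpo ρ) (norm_frobCoeff_le hγ₀' hK))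
    ((bdd_gSer hγ₀ hγ₀' i (shiftDeg_last_lt (p := p) hu ρ)).frob zero_le_one)
  rwa [mul_one] at this

/-- The general term in the functional equation of the coefficients. -/
theorem coeff_frobTerm {i : IntMon n d} {u : Fin (n + 2) → ℤ} (hu : u (Fin.last _) < 0)
    {l : Expo n d} (hl : l ∈ relSet i u) (ρ : Mon n d → ℕ)
    (hγ₀ : HasSum (fun i : ℕ => γ₀ ^ p ^ i / (p : ℂ_[p]) ^ i) 0)
    (hγ₀' : ‖γ₀‖ ^ (p - 1) = (p : ℝ)⁻¹) :
    (frobTerm γ₀ i u ρ).coeff l = (p : ℂ_[p])⁻¹ * ((if (p : ℤ) ∣ l i.1 - ρ i.1 then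
        (γ₀ ^ (p - 1)) ^ (-((l i.1 - ρ i.1) / p)) * polarHat γ₀ ((l i.1 - ρ i.1) / p) *
          coeff (ρ i.1) (artinHasse ℂ_[p] p) else 0) *
      ∏ k ∈ Finset.univ.erase i.1, if (ρ k : ℤ) ≤ l k ∧ (p : ℤ) ∣ l k - ρ k then
        (γ₀ ^ (p - 1)) ^ (-((l k - ρ k) / p)) * coeff ((l k - ρ k) / p).toNat (thetaHat γ₀) *
          coeff (ρ k) (artinHasse ℂ_[p] p) else 0) := by
  have hpZ : (p : ℤ) ≠ 0 := by exact_mod_cast hp.out.ne_zero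
  have hpZ0 : (0 : ℤ) < p := by exact_mod_cast hp.out.pos
  have hlr := (mem_relSet_iff hu).1 hl
  have hπ0 : γ₀ ^ (p - 1) ≠ 0 := pow_ne_zero _ (gamma_ne_zero hγ₀')
  rw [frobTerm, HahnSeries.coeff_single_mul]
  by_cases hdvd : ∀ k, (p : ℤ) ∣ l k - ρ k
  -- The only exponent with $\Lambda^\rho(\Lambda^p)^m=\Lambda^l$.
  · set m : Expo n d := ⟨fun k => (l k - ρ k) / p⟩ with hm
    have hmk : ∀ k, m k = (l k - ρ k) / p := fun k => rfl
    have hpm : p • m = l - natExpo ρ := by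
      ext k
      rw [Expo.nsmul_apply, Expo.sub_apply, natExpo_apply, hmk, nsmul_eq_mul]
      exact Int.mul_ediv_cancel' (hdvd k)
    have hdegm : ∀ r, (p : ℤ) * degVec m r = u r - degVec (natExpo ρ) r := by
      intro r
      have h := congrFun (congrArg degVec hpm) r
      rw [degVec_nsmul, degVec_sub, hlr.1, Pi.smul_apply, nsmul_eq_mul] at h
      exact h
    have hshift : degVec m = shiftDeg p u ρ := by
      funext r
      rw [shiftDeg, ← hdegm, Int.mul_ediv_cancel_left _ hpZ]
    rw [← hpm, coeff_frob_nsmul, frobCoeff, if_pos fun r => ⟨_, (hdegm r).symm⟩]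
    change _ * gCoeff γ₀ i (shiftDeg p u ρ) m = _
    have hsl := shiftDeg_last_lt (p := p) hu ρ
    by_cases hk : ∀ k, k ≠ i.1 → (ρ k : ℤ) ≤ l k
    · have hmem : m ∈ relSet i (shiftDeg p u ρ) := by
        refine (mem_relSet_iff hsl).2 ⟨hshift, fun k hki => ?_⟩
        rw [hmk]
        exact Int.ediv_nonneg (by have := hk k hki; linarith) hpZ0.le
      rw [gCoeff_eq_gProd hγ₀ hγ₀' hsl hmem, gProd, if_pos (hdvd i.1)]
      have e : ∀ k ∈ Finset.univ.erase i.1, (if (ρ k : ℤ) ≤ l k ∧ (p : ℤ) ∣ l k - ρ k then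
        (γ₀ ^ (p - 1)) ^ (-((l k - ρ k) / p)) * coeff ((l k - ρ k) / p).toNat (thetaHat γ₀) *
          coeff (ρ k) (artinHasse ℂ_[p] p) else 0) =
          (γ₀ ^ (p - 1)) ^ (-(m k)) * coeff (m k).toNat (thetaHat γ₀) *
          coeff (ρ k) (artinHasse ℂ_[p] p) := by
        intro k hk'
        rw [if_pos ⟨hk k (Finset.ne_of_mem_erase hk'), hdvd k⟩, hmk]
      rw [Finset.prod_congr rfl e, Finset.prod_mul_distrib, Finset.prod_mul_distrib, ← hmk,
        ← Finset.mul_prod_erase Finset.univ (fun k => coeff (ρ k) (artinHasse ℂ_[p] p))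
          (Finset.mem_univ i.1)]
      -- The last coordinate of $\deg m$ is $\sum_km_k$, so the power of $\gamma_0^{p-1}$ in
      -- `frobCoeff` is the product of the powers belonging to the single variables.
      have hsum : -shiftDeg p u ρ (Fin.last _) = -m i.1 + ∑ k ∈ Finset.univ.erase i.1, -m k := by
        rw [← hshift, degVec_last, ← Finset.add_sum_erase _ _ (Finset.mem_univ i.1),
          Finset.sum_neg_distrib]
        ring
      have hz : ∀ s : Finset (Mon n d), (γ₀ ^ (p - 1)) ^ (∑ k ∈ s, -m k) =
          ∏ k ∈ s, (γ₀ ^ (p - 1)) ^ (-m k) := by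
        intro s
        induction s using Finset.induction_on with
        | empty => simp
        | insert a s ha ih =>
          rw [Finset.sum_insert ha, Finset.prod_insert ha, zpow_add₀ hπ0, ih]
      rw [hsum, zpow_add₀ hπ0, hz]
      ring
    -- If $\rho_k>l_k$ for some $k\ne i$, then $m_k<0$ and both sides vanish.
    · have h0 : gCoeff γ₀ i (shiftDeg p u ρ) m = 0 := by
        refine gCoeff_eq_zero hsl fun hmem => hk fun k hki => ?_
        have := ((mem_relSet_iff hsl).1 hmem).2 k hki
        have h2 : (p : ℤ) * m k = l k - ρ k := Int.mul_ediv_cancel' (hdvd k)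
        have h3 : 0 ≤ (p : ℤ) * m k := mul_nonneg hpZ0.le this
        linarith
      push Not at hk
      obtain ⟨k, hki, hk⟩ := hk
      rw [h0, mul_zero, Finset.prod_eq_zero (Finset.mem_erase.2 ⟨hki, Finset.mem_univ k⟩),
        mul_zero, mul_zero]
      exact if_neg fun h => absurd h.1 (by omega)
  · have h0 : (frob (gSer γ₀ i (shiftDeg p u ρ))).coeff (l - natExpo ρ) = 0 := by
      refine coeff_frob_of_notMem fun m hm => hdvd fun k => ⟨m k, ?_⟩
      have := congrArg (fun e : Expo n d => e k) hm
      simp only [Expo.nsmul_apply, Expo.sub_apply, natExpo_apply, nsmul_eq_mul] at this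
      exact this.symm
    push Not at hdvd
    obtain ⟨k, hk⟩ := hdvd
    rw [h0, mul_zero]
    by_cases hki : k = i.1
    · subst hki
      rw [if_neg hk, zero_mul, mul_zero]
    · rw [Finset.prod_eq_zero (Finset.mem_erase.2 ⟨hki, Finset.mem_univ k⟩), mul_zero, mul_zero]
      exact if_neg fun h => hk h.2

theorem coeff_frobTerm_of_notMem {i : IntMon n d} {u : Fin (n + 2) → ℤ}
    (hu : u (Fin.last _) < 0) {l : Expo n d} (hl : l ∉ relSet i u) (ρ : Mon n d → ℕ) :
    (frobTerm γ₀ i u ρ).coeff l = 0 := by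
  have hpZ0 : (0 : ℤ) < p := by exact_mod_cast hp.out.pos
  rw [frobTerm, HahnSeries.coeff_single_mul]
  by_cases hd : ∀ r, (p : ℤ) ∣ u r - degVec (natExpo ρ) r
  · have h0 : (frob (gSer γ₀ i (shiftDeg p u ρ))).coeff (l - natExpo ρ) = 0 := by
      by_cases h : ∃ m : Expo n d, p • m = l - natExpo ρ
      · obtain ⟨m, hm⟩ := h
        rw [← hm, coeff_frob_nsmul]
        have hsl := shiftDeg_last_lt (p := p) hu ρ
        refine gCoeff_eq_zero hsl fun hmem => hl ?_
        obtain ⟨h1, h2⟩ := (mem_relSet_iff hsl).1 hmem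
        refine (mem_relSet_iff hu).2 ⟨?_, fun k hk => ?_⟩
        · funext r
          have h := congrFun (congrArg degVec hm) r
          rw [degVec_nsmul, degVec_sub, h1, Pi.smul_apply, nsmul_eq_mul, shiftDeg,
            Int.mul_ediv_cancel' (hd r), Pi.sub_apply] at h
          linarith
        · have := congrArg (fun e : Expo n d => e k) hm
          simp only [Expo.nsmul_apply, Expo.sub_apply, natExpo_apply, nsmul_eq_mul] at this
          have h3 : 0 ≤ (p : ℤ) * m k := mul_nonneg hpZ0.le (h2 k hk)
          have h4 : (0 : ℤ) ≤ ρ k := Int.natCast_nonneg _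
          linarith
      · push Not at h
        exact coeff_frob_of_notMem h
    rw [h0, mul_zero]
  · rw [frobCoeff, if_neg hd, zero_mul]

include hγ₀ hγ₀' in
theorem hasSum_frobTerm (i : IntMon n d) {u : Fin (n + 2) → ℤ} (hu : u (Fin.last _) < 0)
    (l : Expo n d) : HasSum (fun ρ => (frobTerm γ₀ i u ρ).coeff l) ((gSer γ₀ i u).coeff l) := by
  have hp0 : (p : ℂ_[p]) ≠ 0 := by exact_mod_cast hp.out.ne_zero
  change HasSum _ (gCoeff γ₀ i u l)
  by_cases hl : l ∈ relSet i u
  · have h := (hasSum_gProd_frob hγ₀ hγ₀' hu hl).mul_left (p : ℂ_[p])⁻¹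
    rw [inv_mul_cancel_left₀ hp0, ← gCoeff_eq_gProd hγ₀ hγ₀' hu hl] at h
    exact h.congr_fun fun ρ => coeff_frobTerm hu hl ρ hγ₀ hγ₀'
  · rw [gCoeff_eq_zero hu hl]
    simp only [coeff_frobTerm_of_notMem hu hl]
    exact hasSum_zero

/-- The exponents `ρ` with all coordinates at most `p K`. -/
def expoBox (p n d K : ℕ) : Finset (Mon n d → ℕ) :=
  Fintype.piFinset fun _ => Finset.range (p * K + 1)

include hγ₀ hγ₀' in
/-- The series `G_u^{(i)}(Λ)` is fixed by Dwork's Frobenius operator, up to a small error if this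
operator is truncated. -/
theorem bdd_gSer_sub_sum_frobTerm (i : IntMon n d) {u : Fin (n + 2) → ℤ}
    (hu : u (Fin.last _) < 0) (K : ℕ) :
    Bdd ((p : ℝ)⁻¹ ^ K) (gSer γ₀ i u - ∑ ρ ∈ expoBox p n d K, frobTerm γ₀ i u ρ) := by
  intro l
  have h := hasSum_frobTerm hγ₀ hγ₀' i hu l
  have h2 := h.summable.sum_add_tsum_subtype_compl (expoBox p n d K)
  rw [h.tsum_eq] at h2
  rw [HahnSeries.coeff_sub, HahnSeries.coeff_sum, ← h2, add_sub_cancel_left]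
  refine IsUltrametricDist.norm_tsum_le_of_forall_le_of_nonneg (pow_nonneg inv_p_pos.le _)
    fun ρ => ?_
  -- An exponent outside the box has an entry above $pK$, which pushes the last coordinate of
  -- $(u-\deg\rho)/p$ down to $-K-1$.
  refine bdd_frobTerm hγ₀ hγ₀' i hu (shiftDeg_last_le hu ρ.1 ?_) l
  have hρ : ¬ ρ.1 ∈ Fintype.piFinset fun _ => Finset.range (p * K + 1) := ρ.2
  rw [Fintype.mem_piFinset] at hρ
  push Not at hρ
  obtain ⟨k, hk⟩ := hρ
  rw [Finset.mem_range, not_lt] at hk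
  have h3 : (ρ.1 k : ℤ) ≤ ∑ k, (ρ.1 k : ℤ) :=
    Finset.single_le_sum (f := fun k => (ρ.1 k : ℤ)) (fun _ _ => Int.natCast_nonneg _)
      (Finset.mem_univ k)
  have h4 : ((p * K + 1 : ℕ) : ℤ) ≤ ρ.1 k := by exact_mod_cast hk
  push_cast at h4
  linarith

end GSeries

/-! ### Laurent polynomials and their values -/

section Polynomials

variable {p : ℕ} [hp : Fact p.Prime] {n d : ℕ}

theorem LPoly.toSeries_single (a : Expo n d) (c : ℂ_[p]) :
    LPoly.toSeries (AddMonoidAlgebra.single a c : LPoly p n d) = HahnSeries.single a c := by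
  classical
  ext l
  simp [LPoly.toSeries, HahnSeries.coeff_single, Finsupp.single_apply, eq_comm]

theorem LPoly.toSeries_add (f g : LPoly p n d) :
    LPoly.toSeries (f + g) = f.toSeries + g.toSeries := by
  ext l
  simp [LPoly.toSeries]

theorem LPoly.toSeries_zero : LPoly.toSeries (0 : LPoly p n d) = 0 := by
  ext l
  simp [LPoly.toSeries]

theorem LPoly.coeff_toSeries (f : LPoly p n d) (l : Expo n d) :
    f.toSeries.coeff l = f.coeff l := rfl

theorem LPoly.toSeries_mul (f g : LPoly p n d) :
    LPoly.toSeries (f * g) = f.toSeries * g.toSeries := by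
  refine AddMonoidAlgebra.induction_linear f ?_ ?_ fun a c => ?_
  · rw [zero_mul, LPoly.toSeries_zero, zero_mul]
  · intro x y hx hy
    rw [add_mul, LPoly.toSeries_add, hx, hy, LPoly.toSeries_add, add_mul]
  refine AddMonoidAlgebra.induction_linear g ?_ ?_ fun b e => ?_
  · rw [mul_zero, LPoly.toSeries_zero, mul_zero]
  · intro x y hx hy
    rw [mul_add, LPoly.toSeries_add, hx, hy, LPoly.toSeries_add, mul_add]
  · rw [AddMonoidAlgebra.single_mul_single, LPoly.toSeries_single, LPoly.toSeries_single,
      LPoly.toSeries_single, HahnSeries.single_mul_single]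

/-- The inclusion of Laurent polynomials in Laurent series as a ring homomorphism. -/
noncomputable def toSeriesHom (p : ℕ) [Fact p.Prime] (n d : ℕ) : LPoly p n d →+* Series p n d where
  toFun := LPoly.toSeries
  map_one' := by
    rw [AddMonoidAlgebra.one_def, LPoly.toSeries_single]
    rfl
  map_mul' := LPoly.toSeries_mul
  map_zero' := LPoly.toSeries_zero
  map_add' := LPoly.toSeries_add

theorem toSeriesHom_apply (f : LPoly p n d) : toSeriesHom p n d f = f.toSeries := rfl

theorem zero_mem_monoSet : (0 : Expo n d) ∈ monoSet n d := fun _ _ => le_rfl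

theorem add_mem_monoSet {l m : Expo n d} (hl : l ∈ monoSet n d) (hm : m ∈ monoSet n d) :
    l + m ∈ monoSet n d := fun k hk => add_nonneg (hl k hk) (hm k hk)

theorem nsmul_mem_monoSet {l : Expo n d} (hl : l ∈ monoSet n d) (m : ℕ) :
    m • l ∈ monoSet n d := fun k hk => nsmul_nonneg (hl k hk) m

theorem natExpo_mem_monoSet (ν : Mon n d → ℕ) : natExpo ν ∈ monoSet n d :=
  fun k _ => natExpo_nonneg ν k

theorem eVec_mem_monoSet (k : Mon n d) : eVec k ∈ monoSet n d := fun j _ => by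
  simp only [eVec]
  split_ifs <;> norm_num

theorem neg_eVec_mem_monoSet (k : IntMon n d) : -eVec k.1 ∈ monoSet n d := fun j hj => by
  have : j ≠ k.1 := by
    rintro rfl
    exact hj k.2
  simp [eVec, this]

/-- The ring of Laurent polynomials with exponents in `monoSet`. -/
noncomputable def monoRing (p : ℕ) [Fact p.Prime] (n d : ℕ) : Subring (LPoly p n d) where
  carrier := {h | ∀ l, h.coeff l ≠ 0 → l ∈ monoSet n d}
  mul_mem' {a b} ha hb l hl := by
    classical
    have := AddMonoidAlgebra.support_coeff_mul_subset a b (Finsupp.mem_support_iff.2 hl)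
    obtain ⟨x, hx, y, hy, rfl⟩ := Finset.mem_add.1 this
    exact add_mem_monoSet (ha x (Finsupp.mem_support_iff.1 hx))
      (hb y (Finsupp.mem_support_iff.1 hy))
  one_mem' l hl := by
    classical
    rw [AddMonoidAlgebra.one_def, AddMonoidAlgebra.coeff_single, Finsupp.single_apply] at hl
    have : l = 0 := by
      by_contra h
      exact hl (if_neg (Ne.symm h))
    rw [this]
    exact zero_mem_monoSet
  add_mem' {a b} ha hb l hl := by
    rw [AddMonoidAlgebra.coeff_add, Finsupp.add_apply] at hl
    by_cases h : a.coeff l = 0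
    · rw [h, zero_add] at hl
      exact hb l hl
    · exact ha l h
  zero_mem' l hl := absurd rfl hl
  neg_mem' {a} ha l hl := ha l (by simpa using hl)

theorem single_mem_monoRing {a : Expo n d} (ha : a ∈ monoSet n d) (c : ℂ_[p]) :
    (AddMonoidAlgebra.single a c : LPoly p n d) ∈ monoRing p n d := fun l hl => by
  classical
  rw [AddMonoidAlgebra.coeff_single, Finsupp.single_apply] at hl
  have : a = l := by
    by_contra h
    exact hl (if_neg h)
  rwa [← this]

theorem hEntry_mem_monoRing (i j : IntMon n d) : hEntry p i j ∈ monoRing p n d :=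
  (monoRing p n d).sum_mem fun ν _ => single_mem_monoRing (natExpo_mem_monoSet ν) _

theorem bMat_mem_monoRing (i j : IntMon n d) : bMat p n d i j ∈ monoRing p n d := by
  refine (monoRing p n d).mul_mem (single_mem_monoRing ?_ _) (hEntry_mem_monoRing i j)
  rw [sub_eq_add_neg, ← smul_neg]
  exact add_mem_monoSet (eVec_mem_monoSet _) (nsmul_mem_monoSet (neg_eVec_mem_monoSet i) p)

theorem detB_mem_monoRing : detB p n d ∈ monoRing p n d :=
  det_mem_of_forall_mem _ bMat_mem_monoRing

theorem LPoly.eval_single (pt : Mon n d → ℂ_[p]) (a : Expo n d) (c : ℂ_[p]) :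
    LPoly.eval pt (AddMonoidAlgebra.single a c) = c * ∏ k, pt k ^ a k := by
  rw [LPoly.eval, AddMonoidAlgebra.coeff_single, Finsupp.sum_single_index (zero_mul _)]

/-- The value of a Laurent polynomial as an additive homomorphism. -/
noncomputable def evalHom (pt : Mon n d → ℂ_[p]) : LPoly p n d →+ ℂ_[p] where
  toFun := LPoly.eval pt
  map_zero' := by simp [LPoly.eval]
  map_add' f g := by
    rw [LPoly.eval, AddMonoidAlgebra.coeff_add]
    exact Finsupp.sum_add_index' (fun _ => zero_mul _) fun _ _ _ => add_mul _ _ _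

theorem evalHom_apply (pt : Mon n d → ℂ_[p]) (f : LPoly p n d) : evalHom pt f = f.eval pt := rfl

theorem interior_ne_zero {pt : Mon n d → ℂ_[p]} (hpt : pt ∈ region p n d) {k : Mon n d}
    (hk : ∀ i, 0 < k.1 i) : pt k ≠ 0 :=
  norm_ne_zero_iff.1 (by rw [hpt.1 k hk]; exact one_ne_zero)

/-- Off the interior monomials a coordinate of the point may vanish, and then powers are additive
only for nonnegative exponents; `monoSet` guarantees these. -/
theorem prod_zpow_add {pt : Mon n d → ℂ_[p]} (hpt : pt ∈ region p n d) {l m : Expo n d}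
    (hl : l ∈ monoSet n d) (hm : m ∈ monoSet n d) :
    ∏ k, pt k ^ (l + m) k = (∏ k, pt k ^ l k) * ∏ k, pt k ^ m k := by
  rw [← Finset.prod_mul_distrib]
  refine Finset.prod_congr rfl fun k _ => ?_
  rw [Expo.add_apply]
  by_cases hk : ∀ i, 0 < k.1 i
  · exact zpow_add₀ (interior_ne_zero hpt hk) _ _
  · obtain ⟨a, ha⟩ := Int.eq_ofNat_of_zero_le (hl k hk)
    obtain ⟨b, hb⟩ := Int.eq_ofNat_of_zero_le (hm k hk)
    rw [ha, hb, ← Nat.cast_add, zpow_natCast, zpow_natCast, zpow_natCast, pow_add]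

theorem norm_prod_zpow_le {pt : Mon n d → ℂ_[p]} (hpt : pt ∈ region p n d) {l : Expo n d}
    (hl : l ∈ monoSet n d) : ‖∏ k, pt k ^ l k‖ ≤ 1 := by
  rw [norm_prod]
  refine Finset.prod_le_one (fun _ _ => norm_nonneg _) fun k _ => ?_
  rw [norm_zpow]
  by_cases hk : ∀ i, 0 < k.1 i
  · rw [hpt.1 k hk, one_zpow]
  · obtain ⟨a, ha⟩ := Int.eq_ofNat_of_zero_le (hl k hk)
    rw [ha, zpow_natCast]
    exact pow_le_one₀ (norm_nonneg _) (hpt.2.1 k)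

theorem LPoly.eval_mul {pt : Mon n d → ℂ_[p]} (hpt : pt ∈ region p n d) {f g : LPoly p n d}
    (hf : f ∈ monoRing p n d) (hg : g ∈ monoRing p n d) :
    (f * g).eval pt = f.eval pt * g.eval pt := by
  rw [AddMonoidAlgebra.mul_def, ← evalHom_apply, Finsupp.sum, map_sum, LPoly.eval, LPoly.eval,
    Finsupp.sum, Finsupp.sum, Finset.sum_mul_sum]
  refine Finset.sum_congr rfl fun l hl => ?_
  rw [Finsupp.sum, map_sum]
  refine Finset.sum_congr rfl fun m hm => ?_
  rw [evalHom_apply, LPoly.eval_single, prod_zpow_add hpt (hf l (Finsupp.mem_support_iff.1 hl))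
    (hg m (Finsupp.mem_support_iff.1 hm))]
  ring

theorem LPoly.eval_one (pt : Mon n d → ℂ_[p]) : (1 : LPoly p n d).eval pt = 1 := by
  rw [AddMonoidAlgebra.one_def, LPoly.eval_single]
  simp

theorem LPoly.eval_pow {pt : Mon n d → ℂ_[p]} (hpt : pt ∈ region p n d) {f : LPoly p n d}
    (hf : f ∈ monoRing p n d) (k : ℕ) : (f ^ k).eval pt = f.eval pt ^ k := by
  induction k with
  | zero => rw [pow_zero, pow_zero, LPoly.eval_one]
  | succ k ih => rw [pow_succ, pow_succ, LPoly.eval_mul hpt (pow_mem hf k) hf, ih]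

theorem LPoly.norm_eval_le {pt : Mon n d → ℂ_[p]} (hpt : pt ∈ region p n d) {f : LPoly p n d}
    (hf : f ∈ monoRing p n d) {C : ℝ} (hC : 0 ≤ C) (h : Bdd C f.toSeries) : ‖f.eval pt‖ ≤ C := by
  refine IsUltrametricDist.norm_sum_le_of_forall_le_of_nonneg hC fun l hl => ?_
  rw [norm_mul]
  calc _ ≤ C * 1 := mul_le_mul (h l)
        (norm_prod_zpow_le hpt (hf l (Finsupp.mem_support_iff.1 hl))) (norm_nonneg _) hC
    _ = C := mul_one C

end Polynomials

/-! ### Congruences for the substitution `Λ ↦ Λ^p` -/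

section Congruence

variable {p : ℕ} [hp : Fact p.Prime] {n d : ℕ}

theorem norm_natCast_of_not_dvd {a : ℕ} (h : ¬ p ∣ a) : ‖(a : ℂ_[p])‖ = 1 := by
  rw [norm_natCast_complex, ← Int.cast_natCast, Padic.norm_intCast_eq_one_iff,
    Nat.isCoprime_iff_coprime]
  exact ((Nat.Prime.coprime_iff_not_dvd hp.out).2 h).symm

theorem norm_natCast_pow_sub (a : ℕ) : ‖(a : ℂ_[p]) ^ p - a‖ ≤ (p : ℝ)⁻¹ := by
  have h : (p : ℤ) ∣ (a : ℤ) ^ p - a := by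
    rw [← ZMod.intCast_zmod_eq_zero_iff_dvd]
    push_cast
    rw [ZMod.pow_card, sub_self]
  obtain ⟨b, hb⟩ := h
  have h2 : (a : ℂ_[p]) ^ p - a = p * (b : ℤ) := by exact_mod_cast congrArg (Int.cast : ℤ → ℂ_[p]) hb
  rw [h2, norm_mul, norm_natCast_p]
  exact mul_le_of_le_one_right inv_p_pos.le (IsUltrametricDist.norm_intCast_le_one _ b)

theorem norm_inv_pow_sub {c : ℂ_[p]} (hc : ‖c‖ = 1) (h : ‖c ^ p - c‖ ≤ (p : ℝ)⁻¹) :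
    ‖c⁻¹ ^ p - c⁻¹‖ ≤ (p : ℝ)⁻¹ := by
  have hc0 : c ≠ 0 := norm_ne_zero_iff.1 (by rw [hc]; exact one_ne_zero)
  have : c⁻¹ ^ p - c⁻¹ = -((c ^ p - c) * (c ^ p * c)⁻¹) := by
    rw [inv_pow, mul_inv]
    field_simp
    ring
  rw [this, norm_neg, norm_mul, norm_inv, norm_mul, norm_pow, hc]
  simpa using h

theorem bdd_natCast_p_mul {ξ : Series p n d} (hξ : Bdd 1 ξ) :
    Bdd (p : ℝ)⁻¹ ((p : Series p n d) * ξ) := by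
  have h : (p : Series p n d) * ξ = (p : ℂ_[p]) • ξ := by
    rw [← HahnSeries.C_mul_eq_smul, map_natCast]
  rw [h, ← mul_one (p : ℝ)⁻¹, ← norm_natCast_p]
  exact hξ.smul

theorem bdd_add_pow_sub {a b : Series p n d} (ha : Bdd 1 a) (hb : Bdd 1 b) :
    Bdd (p : ℝ)⁻¹ ((a + b) ^ p - (a ^ p + b ^ p)) := by
  obtain ⟨r, hr⟩ := exists_add_pow_prime_eq hp.out (⟨a, ha⟩ : intRing p n d) ⟨b, hb⟩
  have h := congrArg Subtype.val hr
  have h2 : (a + b) ^ p - (a ^ p + b ^ p) = p * (a * b * r.1) := by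
    have h3 : (a + b) ^ p = a ^ p + b ^ p + p * a * b * r.1 := h
    rw [h3]
    ring
  rw [h2]
  exact bdd_natCast_p_mul ((intRing p n d).mul_mem ((intRing p n d).mul_mem ha hb) r.2)

theorem Bdd.mul_one' {C : ℝ} (hC : 0 ≤ C) {ξ η : Series p n d} (hξ : Bdd C ξ) (hη : Bdd 1 η) :
    Bdd C (ξ * η) := by
  simpa using Bdd.mul hC zero_le_one hξ hη

/-- The ring of integral series `ξ` with `ξ(Λ^p) ≡ ξ(Λ)^p` modulo `p`. -/
noncomputable def congrRing (p : ℕ) [Fact p.Prime] (n d : ℕ) : Subring (Series p n d) :=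
  have hadd : ∀ {a b : Series p n d}, a ∈ {ξ | Bdd 1 ξ ∧ Bdd (p : ℝ)⁻¹ (frob ξ - ξ ^ p)} →
      b ∈ {ξ | Bdd 1 ξ ∧ Bdd (p : ℝ)⁻¹ (frob ξ - ξ ^ p)} →
      a + b ∈ {ξ | Bdd 1 ξ ∧ Bdd (p : ℝ)⁻¹ (frob ξ - ξ ^ p)} := fun {a b} ha hb => by
    refine ⟨ha.1.add hb.1, ?_⟩
    have h : frob (a + b) - (a + b) ^ p =
        (frob a - a ^ p) + (frob b - b ^ p) - ((a + b) ^ p - (a ^ p + b ^ p)) := by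
      rw [← frobHom_apply, map_add, frobHom_apply, frobHom_apply]
      ring
    rw [h]
    exact (ha.2.add hb.2).sub (bdd_add_pow_sub ha.1 hb.1)
  { carrier := {ξ | Bdd 1 ξ ∧ Bdd (p : ℝ)⁻¹ (frob ξ - ξ ^ p)}
    mul_mem' := fun {a b} ha hb => by
      refine ⟨(intRing p n d).mul_mem ha.1 hb.1, ?_⟩
      have h : frob (a * b) - (a * b) ^ p =
          (frob a - a ^ p) * frob b + (frob b - b ^ p) * a ^ p := by
        rw [← frobHom_apply, map_mul, frobHom_apply, frobHom_apply]
        ring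
      rw [h]
      exact (Bdd.mul_one' inv_p_pos.le ha.2 (hb.1.frob zero_le_one)).add
        (Bdd.mul_one' inv_p_pos.le hb.2 ((intRing p n d).pow_mem ha.1 p))
    one_mem' := by
      refine ⟨Bdd.one, ?_⟩
      rw [← frobHom_apply, map_one, one_pow, sub_self]
      exact Bdd.zero inv_p_pos.le
    add_mem' := hadd
    zero_mem' := by
      refine ⟨Bdd.zero zero_le_one, ?_⟩
      rw [← frobHom_apply, map_zero, zero_pow (Fact.out : p.Prime).ne_zero, sub_self]
      exact Bdd.zero inv_p_pos.le
    neg_mem' := fun {a} ha => by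
      refine ⟨ha.1.neg, ?_⟩
      -- From $a+(-a)=0$ one gets $a^p+(-a)^p\equiv0$ modulo $p$, which covers $p=2$ as well.
      have h := bdd_add_pow_sub ha.1 ha.1.neg
      rw [add_neg_cancel, zero_pow (Fact.out : p.Prime).ne_zero] at h
      have h2 : frob (-a) - (-a) ^ p = (0 - (a ^ p + (-a) ^ p)) - (frob a - a ^ p) := by
        rw [← frobHom_apply, map_neg, frobHom_apply]
        ring
      rw [h2]
      exact h.sub ha.2 }

theorem single_mem_congrRing (a : Expo n d) {c : ℂ_[p]} (hc : ‖c‖ ≤ 1)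
    (h : ‖c ^ p - c‖ ≤ (p : ℝ)⁻¹) : HahnSeries.single a c ∈ congrRing p n d := by
  refine ⟨Bdd.single zero_le_one a hc, ?_⟩
  rw [frob_single, HahnSeries.single_pow, ← HahnSeries.single_sub]
  exact Bdd.single inv_p_pos.le _ (by rwa [norm_sub_rev])

/-- The matrix `B(Λ)` as a matrix of series. -/
noncomputable def bSer (p : ℕ) [Fact p.Prime] (n d : ℕ) :
    Matrix (IntMon n d) (IntMon n d) (Series p n d) := (bMat p n d).map LPoly.toSeries

/-- The determinant `D(Λ)` as a series. -/
noncomputable def dSer (p : ℕ) [Fact p.Prime] (n d : ℕ) : Series p n d := (detB p n d).toSeries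

theorem det_bSer : (bSer p n d).det = dSer p n d :=
  (RingHom.map_det (toSeriesHom p n d) (bMat p n d)).symm

theorem not_dvd_prod_factorial {ν : Mon n d → ℕ}
    (hν : ν ∈ Finset.piAntidiag (Finset.univ : Finset (Mon n d)) (p - 1)) :
    ¬ p ∣ ∏ k, (ν k).factorial := by
  intro h
  obtain ⟨k, -, hk⟩ := (hp.out.prime.dvd_finsetProd_iff _).1 h
  have h1 : ν k ≤ p - 1 := by
    rw [← (Finset.mem_piAntidiag.1 hν).1]
    exact Finset.single_le_sum (f := ν) (fun _ _ => Nat.zero_le _) (Finset.mem_univ k)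
  have h2 := (hp.out.dvd_factorial).1 hk
  have := hp.out.pos
  omega

theorem bSer_apply (i j : IntMon n d) : bSer p n d i j =
    ∑ ν ∈ (Finset.piAntidiag (Finset.univ : Finset (Mon n d)) (p - 1)).filter
      (fun ν => degVec (natExpo ν) = (p : ℤ) • aVec i.1 - aVec j.1),
    HahnSeries.single (eVec j.1 - p • eVec i.1 + natExpo ν)
      (∏ k, ((ν k).factorial : ℂ_[p]))⁻¹ := by
  change toSeriesHom p n d (bMat p n d i j) = _
  rw [bMat, hEntry, map_mul, map_sum, Finset.mul_sum]
  refine Finset.sum_congr rfl fun ν _ => ?_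
  rw [toSeriesHom_apply, toSeriesHom_apply, LPoly.toSeries_single, LPoly.toSeries_single,
    HahnSeries.single_mul_single, one_mul]

/-- The coefficients are inverses of integers prime to $p$, because every $\nu_k$ is less than $p$.
Fermat's little theorem gives $c^p\equiv c$ for them. -/
theorem bSer_mem_congrRing (i j : IntMon n d) : bSer p n d i j ∈ congrRing p n d := by
  rw [bSer_apply]
  refine (congrRing p n d).sum_mem fun ν hν => ?_
  have h1 := norm_natCast_of_not_dvd (not_dvd_prod_factorial (Finset.mem_filter.1 hν).1)
  rw [← Nat.cast_prod]
  refine single_mem_congrRing _ ?_ (norm_inv_pow_sub h1 (norm_natCast_pow_sub _))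
  rw [norm_inv, h1, inv_one]

theorem dSer_mem_congrRing : dSer p n d ∈ congrRing p n d := by
  rw [← det_bSer]
  exact det_mem_of_forall_mem _ bSer_mem_congrRing

theorem bSer_mem_posRing (i j : IntMon n d) : bSer p n d i j ∈ posRing p n d := by
  classical
  refine ⟨(bSer_mem_congrRing i j).1, fun l hl => relSet_zero_subset_posSet i ?_⟩
  rw [bSer_apply, HahnSeries.coeff_sum] at hl
  obtain ⟨ν, hν, hl⟩ := Finset.exists_ne_zero_of_sum_ne_zero hl
  rw [HahnSeries.coeff_single] at hl
  have hl' : l = eVec j.1 - p • eVec i.1 + natExpo ν := by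
    by_contra h
    simp [h] at hl
  rw [hl']
  have hdeg : degVec (eVec j.1 - p • eVec i.1 + natExpo ν) = 0 := by
    rw [degVec_add, degVec_sub, degVec_nsmul, degVec_eVec, degVec_eVec,
      (Finset.mem_filter.1 hν).2, natCast_zsmul]
    abel
  have hnn : ∀ k, k ≠ i.1 → 0 ≤ (eVec j.1 - p • eVec i.1 + natExpo ν) k := fun k hk => by
    have h1 : 0 ≤ eVec j.1 k := by
      simp only [eVec]
      split_ifs <;> norm_num
    have h2 := natExpo_nonneg ν k
    have h3 : eVec i.1 k = 0 := if_neg hk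
    simp only [Expo.add_apply, Expo.sub_apply, Expo.nsmul_apply, h3, smul_zero]
    linarith
  refine ⟨hdeg, ?_, hnn⟩
  have hs := degVec_last (eVec j.1 - p • eVec i.1 + natExpo ν)
  rw [hdeg, ← Finset.add_sum_erase _ _ (Finset.mem_univ i.1), Pi.zero_apply] at hs
  have := Finset.sum_nonneg (s := Finset.univ.erase i.1)
    fun k hk' => hnn k (Finset.ne_of_mem_erase hk')
  linarith

theorem dSer_mem_posRing : dSer p n d ∈ posRing p n d := by
  rw [← det_bSer]
  exact det_mem_of_forall_mem _ bSer_mem_posRing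

end Congruence

/-! ### Dwork's Frobenius operator and the matrix `𝒢(Λ)` -/

section FrobeniusMatrix

open PowerSeries

variable {p : ℕ} [hp : Fact p.Prime] {n d : ℕ} {γ₀ : ℂ_[p]}

/-- The lattice points `v` whose first coordinates have sum `d v_{n+1}`. -/
def IsHomog (d : ℕ) {n : ℕ} (v : Fin (n + 2) → ℤ) : Prop :=
  ∑ r : Fin (n + 1), v r.castSucc = d * v (Fin.last _)

theorem sum_mon (k : Mon n d) : ∑ r, (k.1 r : ℤ) = d := by
  have := (Finset.mem_piAntidiag.1 k.2).1
  exact_mod_cast this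

theorem isHomog_degVec (l : Expo n d) : IsHomog d (degVec l) := by
  rw [IsHomog, degVec_last]
  simp only [degVec_castSucc]
  rw [Finset.sum_comm, Finset.mul_sum]
  refine Finset.sum_congr rfl fun k _ => ?_
  rw [← Finset.mul_sum, sum_mon, mul_comm]

/-- Homogeneity turns last coordinate $-1$ into coordinate sum $-d$, so $-v=(\mathbf b,1)$ with all
entries of $\mathbf b$ positive and of sum $d$. Thus the terms without a factor $p$ are indexed by
the interior monomials. -/
theorem exists_eq_neg_aVec {v : Fin (n + 2) → ℤ} (hv : ∀ r, v r < 0) (h1 : v (Fin.last _) = -1)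
    (hh : IsHomog d v) : ∃ k : IntMon n d, v = -aVec k.1 := by
  rw [IsHomog, h1] at hh
  have hcast : ∀ r : Fin (n + 1), (((-v r.castSucc).toNat : ℕ) : ℤ) = -v r.castSucc := fun r =>
    Int.toNat_of_nonneg (by have := hv r.castSucc; omega)
  have hmem : (fun r : Fin (n + 1) => (-v r.castSucc).toNat) ∈
      Finset.piAntidiag (Finset.univ : Finset (Fin (n + 1))) d := by
    refine Finset.mem_piAntidiag.2 ⟨?_, fun _ _ => Finset.mem_univ _⟩
    have : ((∑ r : Fin (n + 1), (-v r.castSucc).toNat : ℕ) : ℤ) = d := by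
      rw [Nat.cast_sum, Finset.sum_congr rfl fun r _ => hcast r, Finset.sum_neg_distrib, hh]
      ring
    exact_mod_cast this
  refine ⟨⟨⟨_, hmem⟩, fun r => ?_⟩, ?_⟩
  · have := hv r.castSucc
    change 0 < (-v r.castSucc).toNat
    omega
  · funext r
    refine Fin.lastCases ?_ (fun r => ?_) r
    · rw [h1, Pi.neg_apply, aVec_last]
    · have := hcast r
      simp only [Pi.neg_apply, aVec, Fin.snoc_castSucc]
      rw [this, neg_neg]

theorem neg_aVec_neg (k : IntMon n d) (r : Fin (n + 2)) : (-aVec k.1) r < 0 := by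
  refine Fin.lastCases (neg_aVec_last k.1) (fun r => ?_) r
  have := k.2 r
  simp only [Pi.neg_apply, aVec, Fin.snoc_castSucc]
  omega

theorem degVec_natExpo_nonneg (ρ : Mon n d → ℕ) (r : Fin (n + 2)) : 0 ≤ degVec (natExpo ρ) r :=
  Finset.sum_nonneg fun k _ => mul_nonneg (natExpo_nonneg ρ k) <| by
    refine Fin.lastCases ?_ (fun r => ?_) r
    · rw [aVec_last]
      norm_num
    · simp [aVec]

theorem shiftDeg_neg {v : Fin (n + 2) → ℤ} (hv : ∀ r, v r < 0) (ρ : Mon n d → ℕ)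
    (r : Fin (n + 2)) : shiftDeg p v ρ r < 0 := by
  have := degVec_natExpo_nonneg ρ r
  exact Int.ediv_neg_of_neg_of_pos (by linarith [hv r]) (by exact_mod_cast hp.out.pos)

/-- The components of `G(Λ)⁻¹ (G_u^{(i)}(Λ))_i`. -/
noncomputable def hSer (γ₀ : ℂ_[p]) (i : IntMon n d) (u : Fin (n + 2) → ℤ) : Series p n d :=
  ∑ k, (gMat γ₀ n d)⁻¹ i k * gSer γ₀ k u

/-- The components of `G(Λ^p)⁻¹ (G_u^{(i)}(Λ))_i`. -/
noncomputable def hfSer (γ₀ : ℂ_[p]) (i : IntMon n d) (u : Fin (n + 2) → ℤ) : Series p n d :=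
  ∑ k, frob ((gMat γ₀ n d)⁻¹ i k) * gSer γ₀ k u

theorem gSer_eq_zero {i : IntMon n d} {u : Fin (n + 2) → ℤ} (hu : ¬ IsHomog d u) :
    gSer γ₀ i u = 0 := by
  ext l
  by_contra h
  have hex : ∃ ν : Mon n d → ℕ, gTerm γ₀ i u l ν ≠ 0 := by
    by_contra! h'
    exact h (by simp [gSer, gCoeff, h'])
  obtain ⟨ν, hν⟩ := hex
  have hmem : l - natExpo ν ∈ relSet i (u - degVec (natExpo ν)) := by
    by_contra h
    exact hν (by simp [gTerm, fCoeff, h])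
  apply hu
  have h1 := hmem.1
  rw [degVec_sub, sub_left_inj] at h1
  rw [← h1]
  exact isHomog_degVec l

theorem hSer_eq_zero {i : IntMon n d} {u : Fin (n + 2) → ℤ} (hu : ¬ IsHomog d u) :
    hSer γ₀ i u = 0 :=
  Finset.sum_eq_zero fun k _ => by rw [gSer_eq_zero hu, mul_zero]

theorem gSer_neg_aVec (i j : IntMon n d) :
    gSer γ₀ i (-aVec j.1) = HahnSeries.single (-eVec j.1) 1 * gMat γ₀ n d i j := by
  rw [gMat_eq_single_mul, ← mul_assoc, HahnSeries.single_mul_single, neg_add_cancel, mul_one]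
  exact (one_mul _).symm

theorem calG_apply_eq (i j : IntMon n d) (h : calG γ₀ n d = (gMat γ₀ n d)⁻¹.map frob * gMat γ₀ n d) :
    calG γ₀ n d i j = HahnSeries.single (eVec j.1) 1 * hfSer γ₀ i (-aVec j.1) := by
  rw [h, hfSer, Matrix.mul_apply, Finset.mul_sum]
  refine Finset.sum_congr rfl fun k _ => ?_
  rw [gMat_eq_single_mul, Matrix.map_apply]
  ring

variable (hγ₀ : HasSum (fun i : ℕ => γ₀ ^ p ^ i / (p : ℂ_[p]) ^ i) 0)
  (hγ₀' : ‖γ₀‖ ^ (p - 1) = (p : ℝ)⁻¹)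

include hγ₀ hγ₀' in
-- The vector $(G^{(i)}_{-\mathbf a_j})_i$ is $\Lambda_j^{-1}$ times column $j$ of $G$, and
-- $G^{-1}G=1$.
theorem hSer_neg_aVec (i j : IntMon n d) :
    hSer γ₀ i (-aVec j.1) = if i = j then HahnSeries.single (-eVec j.1) 1 else 0 := by
  have h1 : hSer γ₀ i (-aVec j.1) =
      HahnSeries.single (-eVec j.1) 1 * ((gMat γ₀ n d)⁻¹ * gMat γ₀ n d) i j := by
    rw [hSer, Matrix.mul_apply, Finset.mul_sum]
    refine Finset.sum_congr rfl fun k _ => ?_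
    rw [gSer_neg_aVec]
    ring
  rw [h1, Matrix.nonsing_inv_mul _ (isUnit_det_gMat hγ₀ hγ₀'), Matrix.one_apply]
  split_ifs
  · rw [mul_one]
  · rw [mul_zero]

include hγ₀ hγ₀' in
-- Because $G(\Lambda^p)^{-1}=\mathcal G(\Lambda)G(\Lambda)^{-1}$.
theorem hfSer_eq (i : IntMon n d) (u : Fin (n + 2) → ℤ) :
    hfSer γ₀ i u = ∑ k, calG γ₀ n d i k * hSer γ₀ k u := by
  have h : (calG γ₀ n d).mulVec (fun k => hSer γ₀ k u) = fun k => hfSer γ₀ k u := by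
    change (calG γ₀ n d).mulVec ((gMat γ₀ n d)⁻¹.mulVec fun k => gSer γ₀ k u) = _
    rw [Matrix.mulVec_mulVec, calG_eq hγ₀ hγ₀', Matrix.mul_assoc,
      Matrix.mul_nonsing_inv _ (isUnit_det_gMat hγ₀ hγ₀'), Matrix.mul_one]
    rfl
  exact (congrFun h i).symm

include hγ₀ hγ₀' in
theorem hSer_eq (i : IntMon n d) (u : Fin (n + 2) → ℤ) :
    hSer γ₀ i u = ∑ k, (calG γ₀ n d)⁻¹ i k * hfSer γ₀ k u := by
  have h : (calG γ₀ n d)⁻¹.mulVec (fun k => hfSer γ₀ k u) = fun k => hSer γ₀ k u := by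
    have h1 : (fun k => hfSer γ₀ k u) = (calG γ₀ n d).mulVec (fun k => hSer γ₀ k u) :=
      funext fun k => hfSer_eq hγ₀ hγ₀' k u
    rw [h1, Matrix.mulVec_mulVec, Matrix.nonsing_inv_mul _ (det_calG_ne_zero hγ₀ hγ₀').isUnit,
      Matrix.one_mulVec]
  exact (congrFun h i).symm

include hγ₀ hγ₀' in
theorem bdd_hSer (i : IntMon n d) {u : Fin (n + 2) → ℤ} (hu : u (Fin.last _) < 0) :
    Bdd 1 (hSer γ₀ i u) :=
  Bdd.sum zero_le_one _ _ fun k _ => (intRing p n d).mul_mem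
    (gMat_inv_mem_posRing hγ₀ hγ₀' i k).1 (bdd_gSer hγ₀ hγ₀' k hu)

/-- A term of Dwork's Frobenius operator applied to the series `hSer`. -/
noncomputable def hTerm (γ₀ : ℂ_[p]) (i : IntMon n d) (u : Fin (n + 2) → ℤ)
    (ρ : Mon n d → ℕ) : Series p n d :=
  HahnSeries.single (natExpo ρ) (frobCoeff γ₀ u ρ) * frob (hSer γ₀ i (shiftDeg p u ρ))

theorem hTerm_eq (i : IntMon n d) (u : Fin (n + 2) → ℤ) (ρ : Mon n d → ℕ) :
    hTerm γ₀ i u ρ = ∑ k, frob ((gMat γ₀ n d)⁻¹ i k) * frobTerm γ₀ k u ρ := by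
  rw [hTerm, hSer, ← frobHom_apply, map_sum, Finset.mul_sum]
  refine Finset.sum_congr rfl fun k _ => ?_
  rw [frobTerm, map_mul, frobHom_apply, frobHom_apply]
  ring

include hγ₀ hγ₀' in
-- The truncated functional equation of $G_u$ is multiplied by the integral matrix
-- $G(\Lambda^p)^{-1}$, which enters $G_v(\Lambda^p)$ as a factor inside the substitution and makes
-- it $H_v(\Lambda^p)$.
theorem bdd_hfSer_sub_sum_hTerm (i : IntMon n d) {u : Fin (n + 2) → ℤ}
    (hu : u (Fin.last _) < 0) (K : ℕ) :
    Bdd ((p : ℝ)⁻¹ ^ K) (hfSer γ₀ i u - ∑ ρ ∈ expoBox p n d K, hTerm γ₀ i u ρ) := by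
  have h : hfSer γ₀ i u - ∑ ρ ∈ expoBox p n d K, hTerm γ₀ i u ρ =
      ∑ k, (gSer γ₀ k u - ∑ ρ ∈ expoBox p n d K, frobTerm γ₀ k u ρ) *
        frob ((gMat γ₀ n d)⁻¹ i k) := by
    simp only [hTerm_eq, hfSer]
    rw [Finset.sum_comm, ← Finset.sum_sub_distrib]
    refine Finset.sum_congr rfl fun k _ => ?_
    rw [← Finset.mul_sum]
    ring
  rw [h]
  exact Bdd.sum (pow_nonneg inv_p_pos.le K) _ _ fun k _ =>
    Bdd.mul_one' (pow_nonneg inv_p_pos.le K) (bdd_gSer_sub_sum_frobTerm hγ₀ hγ₀' k hu K)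
      ((gMat_inv_mem_posRing hγ₀ hγ₀' i k).1.frob zero_le_one)

theorem hTerm_eq_zero_of_not_isHomog {i : IntMon n d} {u : Fin (n + 2) → ℤ} {ρ : Mon n d → ℕ}
    (h : ¬ IsHomog d (shiftDeg p u ρ)) : hTerm γ₀ i u ρ = 0 := by
  rw [hTerm, hSer_eq_zero h, ← frobHom_apply, map_zero, mul_zero]

include hγ₀ hγ₀' in
theorem hTerm_of_shiftDeg_eq {i k : IntMon n d} {u : Fin (n + 2) → ℤ} {ρ : Mon n d → ℕ}
    (h : shiftDeg p u ρ = -aVec k.1) : hTerm γ₀ i u ρ =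
      if i = k then HahnSeries.single (natExpo ρ - p • eVec k.1) (frobCoeff γ₀ u ρ) else 0 := by
  rw [hTerm, h, hSer_neg_aVec hγ₀ hγ₀']
  split_ifs
  · rw [frob_single, HahnSeries.single_mul_single, mul_one, smul_neg, sub_eq_add_neg]
  · rw [← frobHom_apply, map_zero, mul_zero]

include hγ₀' in
theorem norm_frobCoeff_le_one {u : Fin (n + 2) → ℤ} (hu : u (Fin.last _) < 0) (ρ : Mon n d → ℕ) :
    ‖frobCoeff γ₀ u ρ‖ ≤ 1 := by
  have := norm_frobCoeff_le hγ₀' (K := 0) (u := u) (ρ := ρ)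
    (by have := shiftDeg_last_lt (p := p) hu ρ; push_cast; omega)
  rwa [pow_zero] at this

/-- The terms of Dwork's Frobenius operator are of three kinds. -/
theorem shiftDeg_cases {u : Fin (n + 2) → ℤ} (hu : ∀ r, u r < 0) (ρ : Mon n d → ℕ) :
    ¬ IsHomog d (shiftDeg p u ρ) ∨ shiftDeg p u ρ (Fin.last _) ≤ -2 ∨
      ∃ k : IntMon n d, shiftDeg p u ρ = -aVec k.1 := by
  by_cases h1 : IsHomog d (shiftDeg p u ρ)
  · rcases lt_or_ge (-2) (shiftDeg p u ρ (Fin.last _)) with h2 | h2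
    · have h3 := shiftDeg_neg (p := p) hu ρ (Fin.last _)
      exact Or.inr (Or.inr (exists_eq_neg_aVec (shiftDeg_neg hu ρ) (by omega) h1))
    · exact Or.inr (Or.inl h2)
  · exact Or.inl h1

/-- The unit `γ₀^(p-1) / p`. -/
noncomputable def wUnit (γ₀ : ℂ_[p]) : ℂ_[p] := (p : ℂ_[p])⁻¹ * γ₀ ^ (p - 1)

include hγ₀' in
theorem norm_wUnit : ‖wUnit γ₀‖ = 1 := by
  have hp0 : (p : ℝ) ≠ 0 := (zero_lt_one.trans one_lt_cast_p).ne'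
  rw [wUnit, norm_mul, norm_gamma_pow hγ₀', norm_inv, norm_natCast_p, inv_inv]
  exact mul_inv_cancel₀ hp0

/-- The exponents `ν` with sum `p - 1` and degree `p a_i - a_j`. -/
def entryExpo (p : ℕ) [Fact p.Prime] (i j : IntMon n d) : Finset (Mon n d → ℕ) :=
  (Finset.piAntidiag (Finset.univ : Finset (Mon n d)) (p - 1)).filter
    (fun ν => degVec (natExpo ν) = (p : ℤ) • aVec i.1 - aVec j.1)

theorem mem_entryExpo {i j : IntMon n d} {ν : Mon n d → ℕ} :
    ν ∈ entryExpo p i j ↔ degVec (natExpo ν) = (p : ℤ) • aVec i.1 - aVec j.1 := by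
  refine ⟨fun h => (Finset.mem_filter.1 h).2, fun h => Finset.mem_filter.2
    ⟨Finset.mem_piAntidiag.2 ⟨?_, fun _ _ => Finset.mem_univ _⟩, h⟩⟩
  have h5 := congrFun h (Fin.last _)
  have hsum : (∑ k, (ν k : ℤ)) = ((∑ k, ν k : ℕ) : ℤ) := by push_cast; rfl
  rw [degVec_natExpo_last_nonneg, hsum, Pi.sub_apply, Pi.smul_apply, aVec_last, aVec_last,
    smul_eq_mul, mul_one] at h5
  have := hp.out.pos
  change ∑ k, ν k = p - 1
  omega

theorem lt_of_mem_entryExpo {i j : IntMon n d} {ν : Mon n d → ℕ} (hν : ν ∈ entryExpo p i j)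
    (k : Mon n d) : ν k < p := by
  have h1 := (Finset.mem_piAntidiag.1 (Finset.mem_filter.1 hν).1).1
  have : ν k ≤ p - 1 := by
    rw [← h1]
    exact Finset.single_le_sum (f := ν) (fun _ _ => Nat.zero_le _) (Finset.mem_univ k)
  have := hp.out.pos
  omega

theorem sub_degVec_of_mem_entryExpo {i j : IntMon n d} {ν : Mon n d → ℕ}
    (hν : ν ∈ entryExpo p i j) (r : Fin (n + 2)) :
    (-aVec j.1) r - degVec (natExpo ν) r = p * (-aVec i.1) r := by
  rw [mem_entryExpo.1 hν]
  simp only [Pi.neg_apply, Pi.sub_apply, Pi.smul_apply, smul_eq_mul]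
  ring

theorem shiftDeg_of_mem_entryExpo {i j : IntMon n d} {ν : Mon n d → ℕ}
    (hν : ν ∈ entryExpo p i j) : shiftDeg p (-aVec j.1) ν = -aVec i.1 := by
  have hp0 : (p : ℤ) ≠ 0 := by exact_mod_cast hp.out.ne_zero
  funext r
  rw [shiftDeg, sub_degVec_of_mem_entryExpo hν r, Int.mul_ediv_cancel_left _ hp0]

/-- All $\nu_k<p$, so the Artin-Hasse coefficients are $1/\nu_k!$, and the last coordinate $-1$
leaves a single $\gamma_0^{p-1}/p$. -/
theorem frobCoeff_of_mem_entryExpo {i j : IntMon n d} {ν : Mon n d → ℕ}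
    (hν : ν ∈ entryExpo p i j) :
    frobCoeff γ₀ (-aVec j.1) ν = wUnit γ₀ * (∏ k, ((ν k).factorial : ℂ_[p]))⁻¹ := by
  have hdvd : ∀ r, (p : ℤ) ∣ (-aVec j.1) r - degVec (natExpo ν) r := fun r =>
    ⟨_, sub_degVec_of_mem_entryExpo hν r⟩
  have hA : ∏ k, coeff (ν k) (artinHasse ℂ_[p] p) = (∏ k, ((ν k).factorial : ℂ_[p]))⁻¹ := by
    rw [← Finset.prod_inv_distrib]
    exact Finset.prod_congr rfl fun k _ =>
      coeff_artinHasse_of_lt hp.out.one_lt (lt_of_mem_entryExpo hν k)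
  have h1 : -shiftDeg p (-aVec j.1) ν (Fin.last _) = 1 := by
    rw [shiftDeg_of_mem_entryExpo hν, Pi.neg_apply, aVec_last, neg_neg]
  rw [frobCoeff, if_pos hdvd, hA, h1, zpow_one, wUnit]

theorem mem_entryExpo_of_shiftDeg {i j : IntMon n d} {ν : Mon n d → ℕ}
    (hdvd : ∀ r, (p : ℤ) ∣ (-aVec j.1) r - degVec (natExpo ν) r)
    (h : shiftDeg p (-aVec j.1) ν = -aVec i.1) : ν ∈ entryExpo p i j := by
  refine mem_entryExpo.2 (funext fun r => ?_)
  have h3 := Int.mul_ediv_cancel' (hdvd r)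
  have h4 : shiftDeg p (-aVec j.1) ν r = -aVec i.1 r := congrFun h r
  rw [shiftDeg] at h4
  rw [h4] at h3
  simp only [Pi.neg_apply, Pi.sub_apply, Pi.smul_apply, smul_eq_mul] at h3 ⊢
  linarith

theorem hTerm_eq_zero_of_not_dvd {i : IntMon n d} {u : Fin (n + 2) → ℤ} {ρ : Mon n d → ℕ}
    (h : ¬ ∀ r, (p : ℤ) ∣ u r - degVec (natExpo ρ) r) : hTerm γ₀ i u ρ = 0 := by
  rw [hTerm, frobCoeff, if_neg h, HahnSeries.single_eq_zero, zero_mul]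

include hγ₀ hγ₀' in
theorem single_mul_hTerm_of_mem {i j : IntMon n d} {ρ : Mon n d → ℕ} (hρ : ρ ∈ entryExpo p i j) :
    HahnSeries.single (eVec j.1) 1 * hTerm γ₀ i (-aVec j.1) ρ =
      HahnSeries.single (eVec j.1 - p • eVec i.1 + natExpo ρ)
        (wUnit γ₀ * (∏ k, ((ρ k).factorial : ℂ_[p]))⁻¹) := by
  have h1 := hTerm_of_shiftDeg_eq hγ₀ hγ₀' (i := i) (shiftDeg_of_mem_entryExpo hρ)
  rw [if_pos rfl, frobCoeff_of_mem_entryExpo hρ] at h1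
  have h2 : eVec j.1 + (natExpo ρ - p • eVec i.1) = eVec j.1 - p • eVec i.1 + natExpo ρ := by abel
  rw [h1, HahnSeries.single_mul_single, one_mul, h2]

include hγ₀ hγ₀' in
theorem bdd_hTerm_of_le {i : IntMon n d} {u : Fin (n + 2) → ℤ} (hu : u (Fin.last _) < 0)
    {ρ : Mon n d → ℕ} (h : shiftDeg p u ρ (Fin.last _) ≤ -2) :
    Bdd (p : ℝ)⁻¹ (hTerm γ₀ i u ρ) := by
  have h1 : ‖frobCoeff γ₀ u ρ‖ ≤ (p : ℝ)⁻¹ := by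
    have := norm_frobCoeff_le hγ₀' (K := 1) (u := u) (ρ := ρ) (by push_cast; omega)
    rwa [pow_one] at this
  exact Bdd.mul_one' inv_p_pos.le (Bdd.single inv_p_pos.le _ h1)
    ((bdd_hSer hγ₀ hγ₀' i (shiftDeg_last_lt hu ρ)).frob zero_le_one)

include hγ₀ hγ₀' in
theorem bdd_single_mul_hTerm_of_notMem {i j : IntMon n d} {ρ : Mon n d → ℕ}
    (hρ : ρ ∉ entryExpo p i j) :
    Bdd (p : ℝ)⁻¹ (HahnSeries.single (eVec j.1) 1 * hTerm γ₀ i (-aVec j.1) ρ) := by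
  suffices h : Bdd (p : ℝ)⁻¹ (hTerm γ₀ i (-aVec j.1) ρ) by
    rw [mul_comm]
    exact Bdd.mul_one' inv_p_pos.le h (Bdd.single zero_le_one _ norm_one.le)
  by_cases hdiv : ∀ r, (p : ℤ) ∣ (-aVec j.1) r - degVec (natExpo ρ) r
  swap
  · rw [hTerm_eq_zero_of_not_dvd hdiv]
    exact Bdd.zero inv_p_pos.le
  rcases shiftDeg_cases (p := p) (neg_aVec_neg j) ρ with h | h | ⟨k, h⟩
  · rw [hTerm_eq_zero_of_not_isHomog h]
    exact Bdd.zero inv_p_pos.le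
  · exact bdd_hTerm_of_le hγ₀ hγ₀' (neg_aVec_last j.1) h
  · rw [hTerm_of_shiftDeg_eq hγ₀ hγ₀' h, if_neg]
    · exact Bdd.zero inv_p_pos.le
    rintro rfl
    exact hρ (mem_entryExpo_of_shiftDeg hdiv h)

/-- The matrix `w B(Λ)` for the unit `w = γ₀^(p-1) / p`. -/
noncomputable def wbSer (γ₀ : ℂ_[p]) (n d : ℕ) : Matrix (IntMon n d) (IntMon n d) (Series p n d) :=
  (HahnSeries.single 0 (wUnit γ₀) : Series p n d) • bSer p n d

/-- The determinant of `w B(Λ)` for the unit `w = γ₀^(p-1) / p`. -/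
noncomputable def wdSer (γ₀ : ℂ_[p]) (n d : ℕ) : Series p n d :=
  HahnSeries.single 0 (wUnit γ₀ ^ Fintype.card (IntMon n d)) * dSer p n d

theorem det_wbSer : (wbSer γ₀ n d).det = wdSer γ₀ n d := by
  rw [wbSer, Matrix.det_smul, det_bSer, wdSer, HahnSeries.single_pow, smul_zero]

include hγ₀' in
theorem bdd_wbSer (i j : IntMon n d) : Bdd 1 (wbSer γ₀ n d i j) :=
  (intRing p n d).mul_mem (Bdd.single zero_le_one _ (norm_wUnit hγ₀').le) (bSer_mem_posRing i j).1

theorem wbSer_apply (i j : IntMon n d) : wbSer γ₀ n d i j = ∑ ρ ∈ entryExpo p i j,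
    HahnSeries.single (eVec j.1 - p • eVec i.1 + natExpo ρ)
      (wUnit γ₀ * (∏ k, ((ρ k).factorial : ℂ_[p]))⁻¹) := by
  rw [wbSer, Matrix.smul_apply, smul_eq_mul, bSer_apply, Finset.mul_sum]
  refine Finset.sum_congr rfl fun ν _ => ?_
  rw [HahnSeries.single_mul_single, zero_add]

theorem entryExpo_subset (i j : IntMon n d) : entryExpo p i j ⊆ expoBox p n d 1 := fun ν hν =>
  Fintype.mem_piFinset.2 fun k => Finset.mem_range.2 <| by
    have := lt_of_mem_entryExpo hν k
    omega

include hγ₀ hγ₀' in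
-- Truncation with $K=1$ costs an error divisible by $p$. Of the terms kept, those in `entryExpo`
-- add up exactly to the entry of $wB$, and each of the others is divisible by $p$.
theorem bdd_calG_sub (i j : IntMon n d) :
    Bdd (p : ℝ)⁻¹ (calG γ₀ n d i j - wbSer γ₀ n d i j) := by
  classical
  have h0 := bdd_hfSer_sub_sum_hTerm hγ₀ hγ₀' i (neg_aVec_last j.1) 1
  rw [pow_one, ← Finset.sum_sdiff (entryExpo_subset i j)] at h0
  have h1 : ∀ (s x a b : Series p n d), s * x - s * b = (x - (a + b)) * s + s * a :=
    fun s x a b => by ring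
  have h2 : wbSer γ₀ n d i j = HahnSeries.single (eVec j.1) 1 *
      ∑ ρ ∈ entryExpo p i j, hTerm γ₀ i (-aVec j.1) ρ := by
    rw [wbSer_apply, Finset.mul_sum]
    exact Finset.sum_congr rfl fun ρ hρ => (single_mul_hTerm_of_mem hγ₀ hγ₀' hρ).symm
  rw [calG_apply_eq i j (calG_eq hγ₀ hγ₀'), h2,
    h1 _ _ (∑ ρ ∈ expoBox p n d 1 \ entryExpo p i j, hTerm γ₀ i (-aVec j.1) ρ)]
  refine (Bdd.mul_one' inv_p_pos.le h0 (Bdd.single zero_le_one _ norm_one.le)).add ?_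
  rw [Finset.mul_sum]
  exact Bdd.sum inv_p_pos.le _ _ fun ρ hρ =>
    bdd_single_mul_hTerm_of_notMem hγ₀ hγ₀' (Finset.mem_sdiff.1 hρ).2

/-- The ideal of series divisible by `p` in the ring of integral series. -/
noncomputable def pIdeal (p : ℕ) [Fact p.Prime] (n d : ℕ) : Ideal (intRing p n d) where
  carrier := {ξ | Bdd (p : ℝ)⁻¹ ξ.1}
  add_mem' ha hb := Bdd.add ha hb
  zero_mem' := Bdd.zero inv_p_pos.le
  smul_mem' c x hx := by
    change Bdd _ (c.1 * x.1)
    rw [mul_comm]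
    exact Bdd.mul_one' inv_p_pos.le hx c.2

theorem det_sub_det_mem {R : Type*} [CommRing R] (I : Ideal R) {ι : Type*} [Fintype ι]
    [DecidableEq ι] {A B : Matrix ι ι R} (h : ∀ i j, A i j - B i j ∈ I) : A.det - B.det ∈ I := by
  refine Ideal.Quotient.eq.1 ((RingHom.map_det (Ideal.Quotient.mk I) A).trans
    (Eq.trans ?_ (RingHom.map_det (Ideal.Quotient.mk I) B).symm))
  congr 1
  ext i j
  exact Ideal.Quotient.eq.2 (h i j)

theorem bdd_det_sub {ι : Type*} [Fintype ι] [DecidableEq ι] {A B : Matrix ι ι (Series p n d)}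
    (hA : ∀ i j, Bdd 1 (A i j)) (hB : ∀ i j, Bdd 1 (B i j))
    (h : ∀ i j, Bdd (p : ℝ)⁻¹ (A i j - B i j)) : Bdd (p : ℝ)⁻¹ (A.det - B.det) := by
  let A' : Matrix ι ι (intRing p n d) := fun i j => ⟨A i j, hA i j⟩
  let B' : Matrix ι ι (intRing p n d) := fun i j => ⟨B i j, hB i j⟩
  have hA' : A.det = (intRing p n d).subtype A'.det := by
    rw [RingHom.map_det]
    rfl
  have hB' : B.det = (intRing p n d).subtype B'.det := by
    rw [RingHom.map_det]
    rfl
  have := det_sub_det_mem (pIdeal p n d) (A := A') (B := B') h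
  rw [hA', hB', ← map_sub]
  exact this

include hγ₀ hγ₀' in
theorem bdd_det_calG_sub : Bdd (p : ℝ)⁻¹ ((calG γ₀ n d).det - wdSer γ₀ n d) := by
  rw [← det_wbSer]
  exact bdd_det_sub (fun i j => (calG_mem_posRing hγ₀ hγ₀' i j).1) (bdd_wbSer hγ₀')
    (bdd_calG_sub hγ₀ hγ₀')

theorem norm_eq_one_of_norm_one_sub_le {x : ℂ_[p]} (hx : ‖1 - x‖ ≤ (p : ℝ)⁻¹) : ‖x‖ = 1 := by
  have h3 : ‖1 - x‖ < ‖(1 : ℂ_[p])‖ := by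
    rw [norm_one]
    exact hx.trans_lt inv_p_lt_one
  have h4 := IsUltrametricDist.norm_add_eq_max_of_norm_ne_norm (x := -(1 - x)) (y := (1 : ℂ_[p]))
    (by rw [norm_neg]; exact h3.ne)
  rw [norm_neg, max_eq_right h3.le, norm_one] at h4
  rw [← h4]
  congr 1
  ring

include hγ₀ hγ₀' in
-- Constant terms in $\det\mathcal G\equiv w^MD$: the left one is $1$ and $w$ is a unit. This makes
-- $D$ invertible without computing its constant term directly.
theorem norm_coeff_zero_dSer : ‖(dSer p n d).coeff 0‖ = 1 := by
  have h := bdd_det_calG_sub (n := n) (d := d) hγ₀ hγ₀' 0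
  rw [HahnSeries.coeff_sub, coeff_zero_det_calG hγ₀ hγ₀', wdSer, HahnSeries.coeff_single_mul,
    sub_zero] at h
  have h2 := norm_eq_one_of_norm_one_sub_le h
  rwa [norm_mul, norm_pow, norm_wUnit hγ₀', one_pow, one_mul] at h2

include hγ₀ hγ₀' in
theorem dSer_inv_mem_posRing : (dSer p n d)⁻¹ ∈ posRing p n d :=
  inv_mem_posRing dSer_mem_posRing (norm_coeff_zero_dSer hγ₀ hγ₀')

include hγ₀ hγ₀' in
theorem dSer_ne_zero : dSer p n d ≠ 0 := fun h => by
  have := norm_coeff_zero_dSer (n := n) (d := d) hγ₀ hγ₀'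
  rw [h] at this
  simp at this

end FrobeniusMatrix

/-! ### Approximation by fractions with denominator a power of `D(Λ)` -/

section Approximation

variable {p : ℕ} [hp : Fact p.Prime] {n d : ℕ} {γ₀ : ℂ_[p]}

theorem dSer_eq : dSer p n d = toSeriesHom p n d (detB p n d) := rfl

theorem frob_toSeries (h : LPoly p n d) (hh : h ∈ monoRing p n d) :
    ∃ h' ∈ monoRing p n d, h'.toSeries = frob h.toSeries := by
  refine ⟨∑ l ∈ h.coeff.support, AddMonoidAlgebra.single (p • l) (h.coeff l),
    (monoRing p n d).sum_mem fun l hl => single_mem_monoRing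
      (nsmul_mem_monoSet (hh l (Finsupp.mem_support_iff.1 hl)) p) _, ?_⟩
  conv_rhs => rw [← AddMonoidAlgebra.sum_coeff_single h, Finsupp.sum]
  rw [← toSeriesHom_apply, ← toSeriesHom_apply, map_sum, map_sum, ← frobHom_apply, map_sum]
  refine Finset.sum_congr rfl fun l _ => ?_
  rw [toSeriesHom_apply, toSeriesHom_apply, LPoly.toSeries_single, LPoly.toSeries_single,
    frobHom_apply, frob_single]

/-- The fractions `h / D^k` for Laurent polynomials `h` with exponents in `monoSet`, in case that
`D` is not zero. -/
noncomputable def fracRing (hD : dSer p n d ≠ 0) : Subring (Series p n d) where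
  carrier := {ξ | ∃ h ∈ monoRing p n d, ∃ k : ℕ, ξ = h.toSeries / dSer p n d ^ k}
  mul_mem' := by
    rintro _ _ ⟨h, hh, k, rfl⟩ ⟨h', hh', k', rfl⟩
    refine ⟨h * h', (monoRing p n d).mul_mem hh hh', k + k', ?_⟩
    rw [LPoly.toSeries_mul, pow_add, div_mul_div_comm]
  one_mem' := ⟨1, (monoRing p n d).one_mem, 0, by
    rw [pow_zero, div_one, ← toSeriesHom_apply, map_one]⟩
  add_mem' := by
    rintro _ _ ⟨h, hh, k, rfl⟩ ⟨h', hh', k', rfl⟩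
    refine ⟨h * detB p n d ^ k' + detB p n d ^ k * h', (monoRing p n d).add_mem
      ((monoRing p n d).mul_mem hh (pow_mem detB_mem_monoRing k'))
      ((monoRing p n d).mul_mem (pow_mem detB_mem_monoRing k) hh'), k + k', ?_⟩
    rw [← toSeriesHom_apply, ← toSeriesHom_apply, ← toSeriesHom_apply, map_add, map_mul, map_mul,
      map_pow, map_pow, ← dSer_eq, pow_add, div_add_div _ _ (pow_ne_zero k hD) (pow_ne_zero k' hD)]
  zero_mem' := ⟨0, (monoRing p n d).zero_mem, 0, by
    rw [LPoly.toSeries_zero, zero_div]⟩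
  neg_mem' := by
    rintro _ ⟨h, hh, k, rfl⟩
    refine ⟨-h, (monoRing p n d).neg_mem hh, k, ?_⟩
    rw [← toSeriesHom_apply, ← toSeriesHom_apply, map_neg]
    ring

theorem toSeries_mem_fracRing (hD : dSer p n d ≠ 0) {h : LPoly p n d} (hh : h ∈ monoRing p n d) :
    h.toSeries ∈ fracRing hD := ⟨h, hh, 0, by rw [pow_zero, div_one]⟩

theorem single_mem_fracRing (hD : dSer p n d ≠ 0) {a : Expo n d} (ha : a ∈ monoSet n d)
    (c : ℂ_[p]) : HahnSeries.single a c ∈ fracRing hD := by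
  rw [← LPoly.toSeries_single]
  exact toSeries_mem_fracRing hD (single_mem_monoRing ha c)

theorem dSer_inv_mem_fracRing (hD : dSer p n d ≠ 0) : (dSer p n d)⁻¹ ∈ fracRing hD :=
  ⟨1, (monoRing p n d).one_mem, 1, by
    rw [← toSeriesHom_apply, map_one, pow_one, one_div]⟩

/-- The integral series that are congruent modulo `p^m` to a fraction in `fracRing`. -/
noncomputable def approxRing (hD : dSer p n d ≠ 0) (m : ℕ) : Subring (Series p n d) where
  carrier := {ξ | Bdd 1 ξ ∧ ∃ f ∈ fracRing hD, Bdd ((p : ℝ)⁻¹ ^ m) (ξ - f)}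
  mul_mem' := by
    rintro a b ⟨ha, f, hf, haf⟩ ⟨hb, g, hg, hbg⟩
    refine ⟨(intRing p n d).mul_mem ha hb, f * g, (fracRing hD).mul_mem hf hg, ?_⟩
    have hm0 : 0 ≤ (p : ℝ)⁻¹ ^ m := pow_nonneg inv_p_pos.le m
    have hg1 : Bdd 1 g := by
      have := hb.sub (hbg.mono (pow_le_one₀ inv_p_pos.le inv_p_lt_one.le))
      rwa [sub_sub_cancel] at this
    have : a * b - f * g = (a - f) * g + (b - g) * a := by ring
    rw [this]
    exact (Bdd.mul_one' hm0 haf hg1).add (Bdd.mul_one' hm0 hbg ha)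
  one_mem' := ⟨Bdd.one, 1, (fracRing hD).one_mem, by
    rw [sub_self]
    exact Bdd.zero (pow_nonneg inv_p_pos.le m)⟩
  add_mem' := by
    rintro a b ⟨ha, f, hf, haf⟩ ⟨hb, g, hg, hbg⟩
    refine ⟨ha.add hb, f + g, (fracRing hD).add_mem hf hg, ?_⟩
    rw [add_sub_add_comm]
    exact haf.add hbg
  zero_mem' := ⟨Bdd.zero zero_le_one, 0, (fracRing hD).zero_mem, by
    rw [sub_self]
    exact Bdd.zero (pow_nonneg inv_p_pos.le m)⟩
  neg_mem' := by
    rintro a ⟨ha, f, hf, haf⟩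
    refine ⟨ha.neg, -f, (fracRing hD).neg_mem hf, ?_⟩
    rw [← neg_sub']
    exact haf.neg

theorem mem_approxRing_of_bdd (hD : dSer p n d ≠ 0) {m : ℕ} {ξ : Series p n d}
    (h : Bdd ((p : ℝ)⁻¹ ^ m) ξ) : ξ ∈ approxRing hD m :=
  ⟨h.mono (pow_le_one₀ inv_p_pos.le inv_p_lt_one.le), 0, (fracRing hD).zero_mem, by rwa [sub_zero]⟩

theorem mem_approxRing_of_mem_fracRing (hD : dSer p n d ≠ 0) {m : ℕ} {ξ : Series p n d}
    (h : Bdd 1 ξ) (hξ : ξ ∈ fracRing hD) : ξ ∈ approxRing hD m :=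
  ⟨h, ξ, hξ, by
    rw [sub_self]
    exact Bdd.zero (pow_nonneg inv_p_pos.le m)⟩

/-- A unit that is congruent modulo `p` to the inverse of a fraction has an inverse that can be
approximated. -/
theorem inv_mem_approxRing (hD : dSer p n d ≠ 0) {m : ℕ} {x g : Series p n d} (hx0 : x ≠ 0)
    (hx : x ∈ approxRing hD m) (hx' : Bdd 1 x⁻¹) (hg : g ∈ fracRing hD) (hg' : Bdd 1 g)
    (h : Bdd (p : ℝ)⁻¹ (1 - g * x)) : x⁻¹ ∈ approxRing hD m := by
  have hgm := mem_approxRing_of_mem_fracRing hD (m := m) hg' hg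
  have hy : 1 - g * x ∈ approxRing hD m :=
    (approxRing hD m).sub_mem (approxRing hD m).one_mem ((approxRing hD m).mul_mem hgm hx)
  have hpow : ∀ k : ℕ, Bdd ((p : ℝ)⁻¹ ^ k) ((1 - g * x) ^ k) := by
    intro k
    induction k with
    | zero =>
      rw [pow_zero, pow_zero]
      exact Bdd.one
    | succ k ih =>
      rw [pow_succ, pow_succ]
      exact Bdd.mul (pow_nonneg inv_p_pos.le k) inv_p_pos.le ih h
  -- With $y=1-gx$, divisible by $p$, one has $x^{-1}=g\sum_{i<m}y^i+y^mx^{-1}$, and the last term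
  -- is divisible by $p^m$.
  have hsum := mul_neg_geom_sum (1 - g * x) m
  rw [sub_sub_cancel] at hsum
  have key : x⁻¹ = g * ∑ i ∈ Finset.range m, (1 - g * x) ^ i + (1 - g * x) ^ m * x⁻¹ := by
    have h1 : g * ∑ i ∈ Finset.range m, (1 - g * x) ^ i = (1 - (1 - g * x) ^ m) * x⁻¹ := by
      rw [← hsum]
      field_simp
    rw [h1]
    ring
  rw [key]
  refine (approxRing hD m).add_mem ((approxRing hD m).mul_mem hgm
    ((approxRing hD m).sum_mem fun i _ => pow_mem hy i)) (mem_approxRing_of_bdd hD ?_)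
  exact Bdd.mul_one' (pow_nonneg inv_p_pos.le m) (hpow m) hx'

theorem frob_inv (ξ : Series p n d) : frob ξ⁻¹ = (frob ξ)⁻¹ := map_inv₀ (frobHom p n d) ξ

theorem frob_ne_zero {ξ : Series p n d} (h : ξ ≠ 0) : frob ξ ≠ 0 :=
  (map_ne_zero (frobHom p n d)).2 h

/-- As $D(\Lambda^p)\equiv D(\Lambda)^p$ modulo $p$, the fraction $D^{-p}$ inverts $D(\Lambda^p)$
modulo $p$; the geometric series does the rest. -/
theorem frob_dSer_inv_mem (hD : dSer p n d ≠ 0) (hD' : Bdd 1 (dSer p n d)⁻¹) (m : ℕ) :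
    (frob (dSer p n d))⁻¹ ∈ approxRing hD m := by
  obtain ⟨h', hh', hf⟩ := frob_toSeries _ (detB_mem_monoRing (p := p) (n := n) (d := d))
  have hg : Bdd 1 ((dSer p n d)⁻¹ ^ p) := (intRing p n d).pow_mem hD' p
  refine inv_mem_approxRing hD (g := (dSer p n d)⁻¹ ^ p) (frob_ne_zero hD)
    (mem_approxRing_of_mem_fracRing hD (dSer_mem_posRing.1.frob zero_le_one) ?_) ?_
    (pow_mem (dSer_inv_mem_fracRing hD) p) hg ?_
  · change frob (detB p n d).toSeries ∈ _
    rw [← hf]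
    exact toSeries_mem_fracRing hD hh'
  · rw [← frob_inv]
    exact hD'.frob zero_le_one
  · have : 1 - (dSer p n d)⁻¹ ^ p * frob (dSer p n d) =
        -((frob (dSer p n d) - dSer p n d ^ p) * (dSer p n d)⁻¹ ^ p) := by
      have h1 : dSer p n d ^ p * (dSer p n d)⁻¹ ^ p = 1 := by
        rw [← mul_pow, mul_inv_cancel₀ hD, one_pow]
      rw [sub_mul, h1]
      ring
    rw [this]
    exact (Bdd.mul_one' inv_p_pos.le dSer_mem_congrRing.2 hg).neg

/-- Laurent polynomials are preserved by $\Lambda\mapsto\Lambda^p$, so only the denominator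
$D(\Lambda^p)^k$ has to be approximated. -/
theorem frob_mem_approxRing (hD : dSer p n d ≠ 0) (hD' : Bdd 1 (dSer p n d)⁻¹) {m : ℕ}
    {ξ : Series p n d} (hξ : ξ ∈ approxRing hD m) : frob ξ ∈ approxRing hD m := by
  obtain ⟨h1, _, ⟨h, hh, k, rfl⟩, hf⟩ := hξ
  have hf1 : Bdd 1 (h.toSeries / dSer p n d ^ k) := by
    have := h1.sub (hf.mono (pow_le_one₀ inv_p_pos.le inv_p_lt_one.le))
    rwa [sub_sub_cancel] at this
  -- The numerator is the integral fraction times $D^k$, hence integral, as membership in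
  -- `approxRing` requires.
  have hh1 : Bdd 1 h.toSeries := by
    have := (intRing p n d).mul_mem hf1
      ((intRing p n d).pow_mem (dSer_mem_posRing (p := p) (n := n) (d := d)).1 k)
    rwa [div_mul_cancel₀ _ (pow_ne_zero k hD)] at this
  obtain ⟨h', hh', hfr⟩ := frob_toSeries h hh
  have e : frob ξ = frob h.toSeries * (frob (dSer p n d))⁻¹ ^ k +
      frob (ξ - h.toSeries / dSer p n d ^ k) := by
    simp only [← frobHom_apply, map_sub, map_div₀, map_pow, inv_pow]
    ring
  rw [e]
  refine (approxRing hD m).add_mem ((approxRing hD m).mul_mem ?_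
    (pow_mem (frob_dSer_inv_mem hD hD' m) k)) (mem_approxRing_of_bdd hD
      (hf.frob (pow_nonneg inv_p_pos.le m)))
  rw [← hfr]
  refine mem_approxRing_of_mem_fracRing hD ?_ (toSeries_mem_fracRing hD hh')
  rw [hfr]
  exact hh1.frob zero_le_one

theorem single_mul_mem_approxRing_succ (hD : dSer p n d ≠ 0) {m : ℕ} {ξ : Series p n d}
    (hξ : ξ ∈ approxRing hD m) {a : Expo n d} (ha : a ∈ monoSet n d) {c : ℂ_[p]}
    (hc : ‖c‖ ≤ (p : ℝ)⁻¹) : HahnSeries.single a c * ξ ∈ approxRing hD (m + 1) := by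
  obtain ⟨h1, f, hf, hf1⟩ := hξ
  have hb := Bdd.single (p := p) inv_p_pos.le a hc
  refine ⟨(intRing p n d).mul_mem (hb.mono inv_p_lt_one.le) h1, HahnSeries.single a c * f,
    (fracRing hD).mul_mem (single_mem_fracRing hD ha c) hf, ?_⟩
  rw [← mul_sub, mul_comm, pow_succ]
  exact Bdd.mul (pow_nonneg inv_p_pos.le m) inv_p_pos.le hf1 hb

variable (hγ₀ : HasSum (fun i : ℕ => γ₀ ^ p ^ i / (p : ℂ_[p]) ^ i) 0)
  (hγ₀' : ‖γ₀‖ ^ (p - 1) = (p : ℝ)⁻¹)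

include hγ₀ hγ₀' in
-- A term is zero, or has a coefficient divisible by $p$, which improves the precision of
-- $H_v(\Lambda^p)$ from $p^m$ to $p^{m+1}$, or is zero or a monomial and thus itself a fraction.
theorem hTerm_mem_approxRing (hD : dSer p n d ≠ 0) {m : ℕ}
    (ih : ∀ v : Fin (n + 2) → ℤ, (∀ r, v r < 0) → ∀ i, hSer γ₀ i v ∈ approxRing hD m)
    (i : IntMon n d) {v : Fin (n + 2) → ℤ} (hv : ∀ r, v r < 0) (ρ : Mon n d → ℕ) :
    hTerm γ₀ i v ρ ∈ approxRing hD (m + 1) := by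
  have hc1 := norm_frobCoeff_le_one hγ₀' (hv (Fin.last _)) ρ
  rcases shiftDeg_cases (p := p) hv ρ with h | h | ⟨k, h⟩
  · rw [hTerm_eq_zero_of_not_isHomog h]
    exact (approxRing hD _).zero_mem
  · have h1 : ‖frobCoeff γ₀ v ρ‖ ≤ (p : ℝ)⁻¹ := by
      have := norm_frobCoeff_le hγ₀' (K := 1) (u := v) (ρ := ρ) (by push_cast; omega)
      rwa [pow_one] at this
    exact single_mul_mem_approxRing_succ hD (frob_mem_approxRing hD
      (dSer_inv_mem_posRing hγ₀ hγ₀').1 (ih _ (shiftDeg_neg hv ρ) i)) (natExpo_mem_monoSet ρ) h1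
  · rw [hTerm_of_shiftDeg_eq hγ₀ hγ₀' h]
    split_ifs
    · refine mem_approxRing_of_mem_fracRing hD (Bdd.single zero_le_one _ hc1)
        (single_mem_fracRing hD ?_ _)
      rw [sub_eq_add_neg, ← smul_neg]
      exact add_mem_monoSet (natExpo_mem_monoSet ρ) (nsmul_mem_monoSet (neg_eVec_mem_monoSet k) p)
    · exact (approxRing hD _).zero_mem

include hγ₀ hγ₀' in
theorem hfSer_mem_approxRing (hD : dSer p n d ≠ 0) {m : ℕ}
    (ih : ∀ v : Fin (n + 2) → ℤ, (∀ r, v r < 0) → ∀ i, hSer γ₀ i v ∈ approxRing hD m)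
    (i : IntMon n d) {v : Fin (n + 2) → ℤ} (hv : ∀ r, v r < 0) :
    hfSer γ₀ i v ∈ approxRing hD (m + 1) := by
  have h := mem_approxRing_of_bdd hD
    (bdd_hfSer_sub_sum_hTerm hγ₀ hγ₀' i (hv (Fin.last _)) (m + 1))
  rw [← sub_add_cancel (hfSer γ₀ i v) (∑ ρ ∈ expoBox p n d (m + 1), hTerm γ₀ i v ρ)]
  exact (approxRing hD _).add_mem h ((approxRing hD _).sum_mem fun ρ _ =>
    hTerm_mem_approxRing hγ₀ hγ₀' hD ih i hv ρ)

include hγ₀ hγ₀' in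
theorem calG_mem_approxRing_succ (hD : dSer p n d ≠ 0) {m : ℕ}
    (ih : ∀ v : Fin (n + 2) → ℤ, (∀ r, v r < 0) → ∀ i, hSer γ₀ i v ∈ approxRing hD m)
    (i j : IntMon n d) : calG γ₀ n d i j ∈ approxRing hD (m + 1) := by
  rw [calG_apply_eq i j (calG_eq hγ₀ hγ₀')]
  exact (approxRing hD _).mul_mem (mem_approxRing_of_mem_fracRing hD
    (Bdd.single zero_le_one _ norm_one.le) (single_mem_fracRing hD (eVec_mem_monoSet _) _))
    (hfSer_mem_approxRing hγ₀ hγ₀' hD ih i (neg_aVec_neg j))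

include hγ₀ hγ₀' in
-- The fraction $(w^MD)^{-1}$ inverts $\det\mathcal G$ modulo $p$.
theorem det_calG_inv_mem_approxRing (hD : dSer p n d ≠ 0) {m : ℕ}
    (h : ∀ i j, calG γ₀ n d i j ∈ approxRing hD m) :
    (calG γ₀ n d).det⁻¹ ∈ approxRing hD m := by
  have hw := norm_wUnit hγ₀'
  have hw0 : wUnit γ₀ ≠ 0 := norm_ne_zero_iff.1 (by rw [hw]; exact one_ne_zero)
  have hgb : Bdd 1 (HahnSeries.single 0 ((wUnit γ₀ ^ Fintype.card (IntMon n d))⁻¹) *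
      (dSer p n d)⁻¹) :=
    (intRing p n d).mul_mem (Bdd.single zero_le_one _ (by simp [hw]))
      (dSer_inv_mem_posRing hγ₀ hγ₀').1
  have hgw : HahnSeries.single 0 ((wUnit γ₀ ^ Fintype.card (IntMon n d))⁻¹) *
      (dSer p n d)⁻¹ * wdSer γ₀ n d = 1 := by
    have h1 : (HahnSeries.single 0 ((wUnit γ₀ ^ Fintype.card (IntMon n d))⁻¹) : Series p n d) *
        HahnSeries.single 0 (wUnit γ₀ ^ Fintype.card (IntMon n d)) = 1 := by
      rw [HahnSeries.single_mul_single, zero_add, inv_mul_cancel₀ (pow_ne_zero _ hw0)]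
      rfl
    rw [wdSer, mul_mul_mul_comm, h1, inv_mul_cancel₀ hD, one_mul]
  refine inv_mem_approxRing hD (det_calG_ne_zero hγ₀ hγ₀') (det_mem_of_forall_mem _ h)
    (det_calG_inv_mem_posRing hγ₀ hγ₀').1
    ((fracRing hD).mul_mem (single_mem_fracRing hD zero_mem_monoSet _) (dSer_inv_mem_fracRing hD))
    hgb ?_
  rw [← hgw, ← mul_sub, mul_comm]
  refine Bdd.mul_one' inv_p_pos.le ?_ hgb
  rw [← neg_sub]
  exact (bdd_det_calG_sub hγ₀ hγ₀').neg

include hγ₀ hγ₀' in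
-- The bootstrap. From precision $p^m$ for all $H_v$, Frobenius gives $\mathcal G H_v$ to precision
-- $p^{m+1}$. The case $v=-\mathbf a_j$ yields $\mathcal G$ itself, hence $\mathcal G^{-1}$, and
-- finally $H_v=\mathcal G^{-1}(\mathcal G H_v)$.
theorem hSer_mem_approxRing (hD : dSer p n d ≠ 0) (m : ℕ) :
    ∀ v : Fin (n + 2) → ℤ, (∀ r, v r < 0) → ∀ i, hSer γ₀ i v ∈ approxRing hD m := by
  induction m with
  | zero =>
    intro v hv i
    refine mem_approxRing_of_bdd hD ?_
    rw [pow_zero]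
    exact bdd_hSer hγ₀ hγ₀' i (hv _)
  | succ m ih =>
    intro v hv i
    have hG := calG_mem_approxRing_succ hγ₀ hγ₀' hD ih
    rw [hSer_eq hγ₀ hγ₀']
    exact (approxRing hD _).sum_mem fun k _ => (approxRing hD _).mul_mem
      (inv_mem_of_forall_mem _ hG (det_calG_inv_mem_approxRing hγ₀ hγ₀' hD hG) i k)
      (hfSer_mem_approxRing hγ₀ hγ₀' hD ih k hv)

include hγ₀ hγ₀' in
/-- The entries of `𝒢(Λ)` are limits of fractions with denominator a power of `D(Λ)`. -/
theorem calG_mem_approxRing (hD : dSer p n d ≠ 0) (m : ℕ) (i j : IntMon n d) :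
    calG γ₀ n d i j ∈ approxRing hD m := by
  cases m with
  | zero =>
    refine mem_approxRing_of_bdd hD ?_
    rw [pow_zero]
    exact (calG_mem_posRing hγ₀ hγ₀' i j).1
  | succ m => exact calG_mem_approxRing_succ hγ₀ hγ₀' hD (hSer_mem_approxRing hγ₀ hγ₀' hD m) i j

end Approximation

/-! ### Elements of the Banach space `𝔹` -/

section Banach

variable {p : ℕ} [hp : Fact p.Prime] {n d : ℕ}

/-- A bounded series as an element of `𝔹`. -/
noncomputable def Bdd.toBSpace {C : ℝ} {ξ : Series p n d} (h : Bdd C ξ) : BSpace p n d :=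
  ⟨fun l => ξ.coeff l, memℓp_infty ⟨C, by rintro _ ⟨l, rfl⟩; exact h l⟩⟩

theorem norm_apply_le_norm (b : BSpace p n d) (l : Expo n d) : ‖b l‖ ≤ ‖b‖ :=
  lp.norm_apply_le_norm ENNReal.top_ne_zero b l

theorem norm_sub_le_of_forall_le {C : ℝ} (hC : 0 ≤ C) {b b' : BSpace p n d}
    (h : ∀ l, ‖b l - b' l‖ ≤ C) : ‖b - b'‖ ≤ C :=
  lp.norm_le_of_forall_le hC fun l => by
    rw [lp.coeFn_sub]
    exact h l

theorem norm_apply_sub_le (b b' : BSpace p n d) (l : Expo n d) : ‖b l - b' l‖ ≤ ‖b - b'‖ := by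
  have := norm_apply_le_norm (b - b') l
  rwa [lp.coeFn_sub] at this

theorem Bdd.norm_toBSpace_eq_one {ξ : Series p n d} (h : Bdd 1 ξ) {l : Expo n d}
    (hl : ‖ξ.coeff l‖ = 1) : ‖h.toBSpace‖ = 1 :=
  le_antisymm (lp.norm_le_of_forall_le zero_le_one h)
    (hl.symm.le.trans (norm_apply_le_norm h.toBSpace l))

theorem norm_toBSpace_sub_le {C C₁ C₂ : ℝ} (hC : 0 ≤ C) {ξ η : Series p n d} (hξ : Bdd C₁ ξ)
    (hη : Bdd C₂ η) (h : Bdd C (ξ - η)) : ‖hξ.toBSpace - hη.toBSpace‖ ≤ C :=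
  norm_sub_le_of_forall_le hC h

/-- Every generator of the cone can be negative only at an interior monomial. -/
theorem coneSet_subset_monoSet : coneSet n d ⊆ monoSet n d := by
  intro l hl k hk
  have h : ∀ v ∈ PointedCone.hull ℝ
      {v : Mon n d → ℝ | ∃ i : IntMon n d, ∃ m ∈ relSet i 0, v = fun k => (m k : ℝ)}, 0 ≤ v k := by
    intro v hv
    induction hv using Submodule.span_induction with
    | mem x hx =>
      obtain ⟨i, m, hm, rfl⟩ := hx
      have hki : k ≠ i.1 := by
        rintro rfl
        exact hk i.2
      exact Int.cast_nonneg (hm.2.2 k hki)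
    | zero => exact le_rfl
    | add x y _ _ hx hy => exact add_nonneg hx hy
    | smul a x _ hx => exact mul_nonneg a.2 hx
  exact_mod_cast h _ hl

theorem zero_mem_coneSet : (0 : Expo n d) ∈ coneSet n d := by
  have : (fun k => (((0 : Expo n d) k : ℤ) : ℝ)) = 0 := by
    funext k
    simp
  rw [coneSet, Set.mem_ofPred_eq, this]
  exact Submodule.zero_mem _

theorem exists_bdd_toSeries (h : LPoly p n d) : ∃ C, 0 ≤ C ∧ Bdd C h.toSeries := by
  refine ⟨∑ l ∈ h.coeff.support, ‖h.coeff l‖, Finset.sum_nonneg fun _ _ => norm_nonneg _,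
    fun l => ?_⟩
  rw [LPoly.coeff_toSeries]
  by_cases hl : h.coeff l = 0
  · rw [hl, norm_zero]
    exact Finset.sum_nonneg fun _ _ => norm_nonneg _
  · exact Finset.single_le_sum (f := fun l => ‖h.coeff l‖) (fun _ _ => norm_nonneg _)
      (Finsupp.mem_support_iff.2 hl)

theorem single_coneSet (c : ℂ_[p]) (l : Expo n d)
    (hl : (AddMonoidAlgebra.single 0 c : LPoly p n d).coeff l ≠ 0) : l ∈ coneSet n d := by
  classical
  rw [AddMonoidAlgebra.coeff_single, Finsupp.single_apply] at hl
  have : 0 = l := by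
    by_contra h
    exact hl (if_neg h)
  rw [← this]
  exact zero_mem_coneSet

/-- The fraction `c / D^k` as an element of `𝔹`. -/
noncomputable def constFrac (hD' : Bdd 1 (dSer p n d)⁻¹) (k : ℕ) (c : ℂ_[p]) : BSpace p n d :=
  Bdd.toBSpace (C := ‖c‖) (ξ := HahnSeries.single 0 c * (dSer p n d)⁻¹ ^ k)
    (Bdd.mul_one' (norm_nonneg c) (Bdd.single (norm_nonneg c) 0 le_rfl)
      ((intRing p n d).pow_mem hD' k))

theorem sameCoeff_constFrac (hD' : Bdd 1 (dSer p n d)⁻¹) (k : ℕ) (c : ℂ_[p]) :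
    SameCoeff (constFrac hD' k c)
      (LPoly.toSeries (AddMonoidAlgebra.single 0 c) / (detB p n d).toSeries ^ k) := by
  intro l
  rw [LPoly.toSeries_single, div_eq_mul_inv, ← inv_pow]
  rfl

theorem constFrac_mem_fracSet (hD' : Bdd 1 (dSer p n d)⁻¹) (k : ℕ) (c : ℂ_[p]) :
    constFrac hD' k c ∈ fracSet p n d :=
  ⟨_, k, single_coneSet c, sameCoeff_constFrac hD' k c⟩

theorem isValueRE_constFrac (hD' : Bdd 1 (dSer p n d)⁻¹) (k : ℕ) (c : ℂ_[p])
    (pt : Mon n d → ℂ_[p]) :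
    IsValueRE pt (constFrac hD' k c) (c / (detB p n d).eval pt ^ k) := by
  refine subset_closure ⟨_, k, single_coneSet c, sameCoeff_constFrac hD' k c, ?_⟩
  rw [LPoly.eval_single]
  simp

/-- Splits the numerator into monomials. The definition of $R'_E$ asks for numerators with exponents
in $E$, which constants satisfy, and the monomials are supplied by the coefficients of $\tilde R'$.
-/
theorem coeff_frac (h : LPoly p n d) (hD' : Bdd 1 (dSer p n d)⁻¹) (k : ℕ) (m : Expo n d) :
    (h.toSeries / dSer p n d ^ k).coeff m =
      ∑ l ∈ h.coeff.support, constFrac hD' k (h.coeff l) (m - l) := by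
  have h1 : h.toSeries / dSer p n d ^ k = ∑ l ∈ h.coeff.support,
      HahnSeries.single l 1 * (HahnSeries.single 0 (h.coeff l) * (dSer p n d)⁻¹ ^ k) := by
    conv_lhs => rw [← AddMonoidAlgebra.sum_coeff_single h, Finsupp.sum]
    rw [← toSeriesHom_apply, map_sum, div_eq_mul_inv, Finset.sum_mul, ← inv_pow]
    refine Finset.sum_congr rfl fun l _ => ?_
    rw [← mul_assoc, HahnSeries.single_mul_single, add_zero, one_mul, toSeriesHom_apply,
      LPoly.toSeries_single]
  rw [h1, HahnSeries.coeff_sum]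
  refine Finset.sum_congr rfl fun l _ => ?_
  rw [HahnSeries.coeff_single_mul, one_mul]
  rfl

theorem mem_ringRtilde_of_sameCoeff (hD' : Bdd 1 (dSer p n d)⁻¹) {h : LPoly p n d}
    (hh : h ∈ monoRing p n d) {k : ℕ} {b : BSpace p n d}
    (hb : SameCoeff b (h.toSeries / dSer p n d ^ k)) : b ∈ ringRtilde p n d :=
  ⟨h.coeff.support, fun l => constFrac hD' k (h.coeff l),
    fun l hl => ⟨hh l (Finsupp.mem_support_iff.1 hl),
      subset_closure (constFrac_mem_fracSet hD' k _)⟩,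
    fun m => (hb m).trans (coeff_frac h hD' k m)⟩

theorem mem_graphRtilde_of_sameCoeff (hD' : Bdd 1 (dSer p n d)⁻¹) (pt : Mon n d → ℂ_[p])
    {h : LPoly p n d} (hh : h ∈ monoRing p n d) {k : ℕ} {b : BSpace p n d}
    (hb : SameCoeff b (h.toSeries / dSer p n d ^ k)) :
    (b, h.eval pt / (detB p n d).eval pt ^ k) ∈ graphRtilde pt := by
  refine ⟨h.coeff.support, fun l => constFrac hD' k (h.coeff l),
    fun l => h.coeff l / (detB p n d).eval pt ^ k,
    fun l hl => ⟨hh l (Finsupp.mem_support_iff.1 hl), isValueRE_constFrac hD' k _ pt⟩,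
    fun m => (hb m).trans (coeff_frac h hD' k m), ?_⟩
  change h.eval pt / _ = _
  rw [LPoly.eval, Finsupp.sum, Finset.sum_div]
  refine Finset.sum_congr rfl fun l _ => ?_
  ring

theorem exists_pow_lt {ε : ℝ} (hε : 0 < ε) : ∃ m : ℕ, (p : ℝ)⁻¹ ^ m < ε :=
  exists_pow_lt_of_lt_one hε inv_p_lt_one

theorem exists_bdd_frac (h : LPoly p n d) (hD' : Bdd 1 (dSer p n d)⁻¹) (k : ℕ) :
    ∃ C, 0 ≤ C ∧ Bdd C (h.toSeries / dSer p n d ^ k) := by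
  obtain ⟨C, hC, h1⟩ := exists_bdd_toSeries h
  refine ⟨C, hC, ?_⟩
  rw [div_eq_mul_inv, ← inv_pow]
  exact Bdd.mul_one' hC h1 ((intRing p n d).pow_mem hD' k)

theorem toBSpace_mem_ringR (hD : dSer p n d ≠ 0) (hD' : Bdd 1 (dSer p n d)⁻¹) {C : ℝ}
    {ξ : Series p n d} (h : Bdd C ξ) (hξ : ∀ m, ξ ∈ approxRing hD m) :
    h.toBSpace ∈ ringR p n d := by
  refine Metric.mem_closure_iff.2 fun ε hε => ?_
  obtain ⟨m, hm⟩ := exists_pow_lt (p := p) hε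
  obtain ⟨-, _, ⟨f, hf, k, rfl⟩, hfm⟩ := hξ m
  obtain ⟨C', -, hC'⟩ := exists_bdd_frac f hD' k
  refine ⟨hC'.toBSpace, mem_ringRtilde_of_sameCoeff hD' hf fun _ => rfl, ?_⟩
  rw [dist_eq_norm]
  exact (norm_toBSpace_sub_le (pow_nonneg inv_p_pos.le m) h hC' hfm).trans_lt hm

theorem toBSpace_mem_ringR0 (hD : dSer p n d ≠ 0) (hD' : Bdd 1 (dSer p n d)⁻¹)
    {ξ : Series p n d} (h : ξ ∈ posRing p n d) (hξ : ∀ m, ξ ∈ approxRing hD m) :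
    h.1.toBSpace ∈ ringR0 p n d :=
  ⟨toBSpace_mem_ringR hD hD' h.1 hξ, fun l hl => (h.2 l hl).2⟩

end Banach

/-! ### Values at the points of `𝒟` -/

section Values

variable {p : ℕ} [hp : Fact p.Prime] {n d : ℕ} {pt : Mon n d → ℂ_[p]}

theorem eval_detB_ne_zero (hpt : pt ∈ region p n d) : (detB p n d).eval pt ≠ 0 :=
  norm_ne_zero_iff.1 (by rw [hpt.2.2]; exact one_ne_zero)

/-- The graph of the evaluation at `pt` on the ring of fractions `h / D^k`. -/
noncomputable def fracGraph (hD : dSer p n d ≠ 0) (hpt : pt ∈ region p n d) :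
    Subring (Series p n d × ℂ_[p]) where
  carrier := {x | ∃ h ∈ monoRing p n d, ∃ k : ℕ, x.1 = h.toSeries / dSer p n d ^ k ∧
    x.2 = h.eval pt / (detB p n d).eval pt ^ k}
  mul_mem' := by
    rintro ⟨_, _⟩ ⟨_, _⟩ ⟨h, hh, k, rfl, rfl⟩ ⟨h', hh', k', rfl, rfl⟩
    refine ⟨h * h', (monoRing p n d).mul_mem hh hh', k + k', ?_, ?_⟩
    · rw [LPoly.toSeries_mul, pow_add, ← div_mul_div_comm]
      rfl
    · rw [LPoly.eval_mul hpt hh hh', pow_add, ← div_mul_div_comm]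
      rfl
  one_mem' := by
    refine ⟨1, (monoRing p n d).one_mem, 0, ?_, ?_⟩
    · rw [pow_zero, div_one, ← toSeriesHom_apply, map_one]
      rfl
    · rw [pow_zero, div_one, LPoly.eval_one]
      rfl
  add_mem' := by
    rintro ⟨_, _⟩ ⟨_, _⟩ ⟨h, hh, k, rfl, rfl⟩ ⟨h', hh', k', rfl, rfl⟩
    have hk := pow_mem (detB_mem_monoRing (p := p) (n := n) (d := d)) k
    have hk' := pow_mem (detB_mem_monoRing (p := p) (n := n) (d := d)) k'
    have hE := eval_detB_ne_zero hpt
    refine ⟨h * detB p n d ^ k' + detB p n d ^ k * h', (monoRing p n d).add_mem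
      ((monoRing p n d).mul_mem hh hk') ((monoRing p n d).mul_mem hk hh'), k + k', ?_, ?_⟩
    · rw [← toSeriesHom_apply (_ + _), map_add, map_mul, map_mul, map_pow, map_pow, ← dSer_eq, pow_add,
        ← div_add_div _ _ (pow_ne_zero k hD) (pow_ne_zero k' hD)]
      rfl
    · rw [← evalHom_apply pt (_ + _), map_add, evalHom_apply, evalHom_apply, LPoly.eval_mul hpt hh hk',
        LPoly.eval_mul hpt hk hh', LPoly.eval_pow hpt detB_mem_monoRing,
        LPoly.eval_pow hpt detB_mem_monoRing, pow_add,
        ← div_add_div _ _ (pow_ne_zero k hE) (pow_ne_zero k' hE)]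
      rfl
  zero_mem' := by
    refine ⟨0, (monoRing p n d).zero_mem, 0, ?_, ?_⟩
    · rw [LPoly.toSeries_zero, zero_div]
      rfl
    · rw [← evalHom_apply, map_zero, zero_div]
      rfl
  neg_mem' := by
    rintro ⟨_, _⟩ ⟨h, hh, k, rfl, rfl⟩
    refine ⟨-h, (monoRing p n d).neg_mem hh, k, ?_, ?_⟩
    · rw [← toSeriesHom_apply (-h), map_neg]
      change -(toSeriesHom p n d h / _) = _
      ring
    · rw [← evalHom_apply pt (-h), map_neg, neg_div]
      rfl

/-- As $|D(\lambda)|=1$, the value has the norm of $h(\lambda)$, which is at most the sup norm of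
$h=(h/D^k)D^k$, and $D$ is integral. This contraction is the reason for the definition of $\mathcal
D$. -/
theorem norm_snd_le_of_mem_fracGraph (hD : dSer p n d ≠ 0) (hpt : pt ∈ region p n d) {C : ℝ}
    (hC : 0 ≤ C) {x : Series p n d × ℂ_[p]} (hx : x ∈ fracGraph hD hpt) (h : Bdd C x.1) :
    ‖x.2‖ ≤ C := by
  obtain ⟨f, hf, k, h1, h2⟩ := hx
  rw [h2, norm_div, norm_pow, hpt.2.2, one_pow, div_one]
  refine LPoly.norm_eval_le hpt hf hC ?_
  have h3 : f.toSeries = x.1 * dSer p n d ^ k := by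
    rw [h1, div_mul_cancel₀ _ (pow_ne_zero k hD)]
  rw [h3]
  exact Bdd.mul_one' hC h
    ((intRing p n d).pow_mem (dSer_mem_posRing (p := p) (n := n) (d := d)).1 k)

theorem single_mem_fracGraph (hD : dSer p n d ≠ 0) (hpt : pt ∈ region p n d) {l : Expo n d}
    (hl : l ∈ monoSet n d) :
    ((HahnSeries.single l 1, ∏ k, pt k ^ l k) : Series p n d × ℂ_[p]) ∈ fracGraph hD hpt :=
  ⟨AddMonoidAlgebra.single l 1, single_mem_monoRing hl 1, 0, by
    rw [LPoly.toSeries_single, pow_zero, div_one], by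
    rw [LPoly.eval_single, one_mul, pow_zero, div_one]⟩

/-- The limits in `𝔹` of the graph of the evaluation at `pt` on fractions. -/
def limGraph (hD : dSer p n d ≠ 0) (hpt : pt ∈ region p n d) : Set (BSpace p n d × ℂ_[p]) :=
  {x | ∀ ε > 0, ∃ y ∈ fracGraph hD hpt, (∀ l, ‖x.1 l - y.1.coeff l‖ ≤ ε) ∧ ‖x.2 - y.2‖ ≤ ε}

theorem norm_sub_le_of_le {a b c : ℂ_[p]} {ε : ℝ} (h1 : ‖a - b‖ ≤ ε) (h2 : ‖b - c‖ ≤ ε) :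
    ‖a - c‖ ≤ ε := by
  rw [← sub_add_sub_cancel a b c]
  exact (IsUltrametricDist.norm_add_le_max _ _).trans (max_le h1 h2)

theorem closure_subset_limGraph (hD : dSer p n d ≠ 0) (hpt : pt ∈ region p n d)
    {S : Set (BSpace p n d × ℂ_[p])} (hS : S ⊆ limGraph hD hpt) : closure S ⊆ limGraph hD hpt := by
  intro x hx ε hε
  obtain ⟨y, hy, hxy⟩ := Metric.mem_closure_iff.1 hx ε hε
  obtain ⟨z, hz, hz1, hz2⟩ := hS hy ε hε
  rw [Prod.dist_eq, max_lt_iff, dist_eq_norm, dist_eq_norm] at hxy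
  exact ⟨z, hz, fun l => norm_sub_le_of_le ((norm_apply_sub_le _ _ l).trans hxy.1.le) (hz1 l),
    norm_sub_le_of_le hxy.2.le hz2⟩

theorem graphFrac_subset_limGraph (hD : dSer p n d ≠ 0) (hpt : pt ∈ region p n d) :
    graphFrac pt ⊆ limGraph hD hpt := by
  rintro ⟨b, z⟩ ⟨h, k, hh, h1, h2⟩ ε hε
  refine ⟨(h.toSeries / dSer p n d ^ k, h.eval pt / (detB p n d).eval pt ^ k),
    ⟨h, fun l hl => coneSet_subset_monoSet (hh l hl), k, rfl, rfl⟩, fun l => ?_, ?_⟩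
  · have : b l = (h.toSeries / dSer p n d ^ k).coeff l := h1 l
    rw [this, sub_self, norm_zero]
    exact hε.le
  · rw [h2, sub_self, norm_zero]
    exact hε.le

/-- The approximations of the coefficients $\xi_l$ survive multiplication by $\Lambda^l$, whose
value at the point has norm at most $1$. -/
theorem graphRtilde_subset_limGraph (hD : dSer p n d ≠ 0) (hpt : pt ∈ region p n d) :
    graphRtilde pt ⊆ limGraph hD hpt := by
  rintro ⟨b, z⟩ ⟨s, ξ, ζ, hs, hb, hz⟩ ε hε
  have hl : ∀ l, ∃ y ∈ fracGraph hD hpt, l ∈ s →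
      (∀ m, ‖ξ l m - y.1.coeff m‖ ≤ ε) ∧ ‖ζ l - y.2‖ ≤ ε := by
    intro l
    by_cases hls : l ∈ s
    · obtain ⟨y, hy, hy'⟩ :=
        closure_subset_limGraph hD hpt (graphFrac_subset_limGraph hD hpt) (hs l hls).2 ε hε
      exact ⟨y, hy, fun _ => hy'⟩
    · exact ⟨0, (fracGraph hD hpt).zero_mem, fun h => absurd h hls⟩
  choose y hy hy' using hl
  refine ⟨∑ l ∈ s, (HahnSeries.single l 1, ∏ k, pt k ^ l k) * y l,
    (fracGraph hD hpt).sum_mem fun l hls =>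
      (fracGraph hD hpt).mul_mem (single_mem_fracGraph hD hpt (hs l hls).1) (hy l),
    fun m => ?_, ?_⟩
  · change ‖b m - _‖ ≤ ε
    have hbm : b m = _ := hb m
    rw [hbm, Prod.fst_sum, HahnSeries.coeff_sum, ← Finset.sum_sub_distrib]
    refine IsUltrametricDist.norm_sum_le_of_forall_le_of_nonneg hε.le fun l hls => ?_
    rw [Prod.fst_mul, HahnSeries.coeff_single_mul, one_mul]
    exact (hy' l hls).1 _
  · change ‖z - _‖ ≤ ε
    have hz' : z = _ := hz
    rw [hz', Prod.snd_sum, ← Finset.sum_sub_distrib]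
    refine IsUltrametricDist.norm_sum_le_of_forall_le_of_nonneg hε.le fun l hls => ?_
    rw [Prod.snd_mul, ← mul_sub, norm_mul]
    calc _ ≤ 1 * ε := mul_le_mul (norm_prod_zpow_le hpt (hs l hls).1) (hy' l hls).2
          (norm_nonneg _) zero_le_one
      _ = ε := one_mul ε

/-- Two fractions close to the same series have a small difference, and evaluation does not increase
norms. -/
theorem limGraph_unique (hD : dSer p n d ≠ 0) (hpt : pt ∈ region p n d) {b : BSpace p n d}
    {z z' : ℂ_[p]} (h : (b, z) ∈ limGraph hD hpt) (h' : (b, z') ∈ limGraph hD hpt) : z = z' := by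
  refine eq_of_forall_dist_le fun ε hε => ?_
  obtain ⟨y, hy, h1, h2⟩ := h ε hε
  obtain ⟨y', hy', h1', h2'⟩ := h' ε hε
  rw [dist_eq_norm]
  have h3 : ‖(y - y').2‖ ≤ ε := by
    refine norm_snd_le_of_mem_fracGraph hD hpt hε.le ((fracGraph hD hpt).sub_mem hy hy') fun l => ?_
    rw [Prod.fst_sub, HahnSeries.coeff_sub]
    exact norm_sub_le_of_le (b := b l) (by rw [norm_sub_rev]; exact h1 l) (h1' l)
  rw [Prod.snd_sub] at h3
  exact norm_sub_le_of_le h2 (norm_sub_le_of_le h3 (by rw [norm_sub_rev]; exact h2'))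

theorem isValue_unique (hD : dSer p n d ≠ 0) (hpt : pt ∈ region p n d) {b : BSpace p n d}
    {z z' : ℂ_[p]} (h : IsValue pt b z) (h' : IsValue pt b z') : z = z' :=
  limGraph_unique hD hpt (closure_subset_limGraph hD hpt (graphRtilde_subset_limGraph hD hpt) h)
    (closure_subset_limGraph hD hpt (graphRtilde_subset_limGraph hD hpt) h')

/-- The integral series that are limits of fractions, with their values at `pt`. -/
noncomputable def valueRing (hD : dSer p n d ≠ 0) (hpt : pt ∈ region p n d) :
    Subring (Series p n d × ℂ_[p]) where
  carrier := {x | Bdd 1 x.1 ∧ ∀ m : ℕ, ∃ y ∈ fracGraph hD hpt,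
    Bdd ((p : ℝ)⁻¹ ^ m) (x.1 - y.1) ∧ ‖x.2 - y.2‖ ≤ (p : ℝ)⁻¹ ^ m}
  mul_mem' := by
    rintro a b ⟨ha, ha'⟩ ⟨hb, hb'⟩
    refine ⟨(intRing p n d).mul_mem ha hb, fun m => ?_⟩
    obtain ⟨y, hy, h1, h2⟩ := ha' m
    obtain ⟨z, hz, h3, h4⟩ := hb' m
    have hm0 : 0 ≤ (p : ℝ)⁻¹ ^ m := pow_nonneg inv_p_pos.le m
    have hm1 : (p : ℝ)⁻¹ ^ m ≤ 1 := pow_le_one₀ inv_p_pos.le inv_p_lt_one.le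
    have hz1 : Bdd 1 z.1 := by
      have := hb.sub (h3.mono hm1)
      rwa [sub_sub_cancel] at this
    have hz2 := norm_snd_le_of_mem_fracGraph hD hpt zero_le_one hz hz1
    have hy1 : Bdd 1 y.1 := by
      have := ha.sub (h1.mono hm1)
      rwa [sub_sub_cancel] at this
    have hy2 := norm_snd_le_of_mem_fracGraph hD hpt zero_le_one hy hy1
    have ha2 : ‖a.2‖ ≤ 1 := by
      have := norm_sub_le_of_le (c := 0) (h2.trans hm1) (by rwa [sub_zero])
      rwa [sub_zero] at this
    refine ⟨y * z, (fracGraph hD hpt).mul_mem hy hz, ?_, ?_⟩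
    · have : (a * b).1 - (y * z).1 = (a.1 - y.1) * z.1 + (b.1 - z.1) * a.1 := by
        rw [Prod.fst_mul, Prod.fst_mul]
        ring
      rw [this]
      exact (Bdd.mul_one' hm0 h1 hz1).add (Bdd.mul_one' hm0 h3 ha)
    · have : (a * b).2 - (y * z).2 = (a.2 - y.2) * z.2 + (b.2 - z.2) * a.2 := by
        rw [Prod.snd_mul, Prod.snd_mul]
        ring
      rw [this]
      refine (IsUltrametricDist.norm_add_le_max _ _).trans (max_le ?_ ?_)
      · rw [norm_mul]
        exact (mul_le_of_le_one_right (norm_nonneg _) hz2).trans h2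
      · rw [norm_mul]
        exact (mul_le_of_le_one_right (norm_nonneg _) ha2).trans h4
  one_mem' := ⟨Bdd.one, fun m => ⟨1, (fracGraph hD hpt).one_mem, by
    rw [sub_self]
    exact Bdd.zero (pow_nonneg inv_p_pos.le m), by
    rw [sub_self, norm_zero]
    exact pow_nonneg inv_p_pos.le m⟩⟩
  add_mem' := by
    rintro a b ⟨ha, ha'⟩ ⟨hb, hb'⟩
    refine ⟨ha.add hb, fun m => ?_⟩
    obtain ⟨y, hy, h1, h2⟩ := ha' m
    obtain ⟨z, hz, h3, h4⟩ := hb' m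
    refine ⟨y + z, (fracGraph hD hpt).add_mem hy hz, ?_, ?_⟩
    · rw [Prod.fst_add, Prod.fst_add, add_sub_add_comm]
      exact h1.add h3
    · rw [Prod.snd_add, Prod.snd_add, add_sub_add_comm]
      exact (IsUltrametricDist.norm_add_le_max _ _).trans (max_le h2 h4)
  zero_mem' := ⟨Bdd.zero zero_le_one, fun m => ⟨0, (fracGraph hD hpt).zero_mem, by
    rw [sub_self]
    exact Bdd.zero (pow_nonneg inv_p_pos.le m), by
    rw [sub_self, norm_zero]
    exact pow_nonneg inv_p_pos.le m⟩⟩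
  neg_mem' := by
    rintro a ⟨ha, ha'⟩
    refine ⟨ha.neg, fun m => ?_⟩
    obtain ⟨y, hy, h1, h2⟩ := ha' m
    refine ⟨-y, (fracGraph hD hpt).neg_mem hy, ?_, ?_⟩
    · rw [Prod.fst_neg, Prod.fst_neg, ← neg_sub']
      exact h1.neg
    · rw [Prod.snd_neg, Prod.snd_neg, ← neg_sub', norm_neg]
      exact h2

theorem norm_snd_le_one_of_mem_valueRing (hD : dSer p n d ≠ 0) (hpt : pt ∈ region p n d)
    {x : Series p n d × ℂ_[p]} (hx : x ∈ valueRing hD hpt) : ‖x.2‖ ≤ 1 := by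
  obtain ⟨y, hy, h1, h2⟩ := hx.2 0
  rw [pow_zero] at h1 h2
  have hy1 : Bdd 1 y.1 := by
    have := hx.1.sub h1
    rwa [sub_sub_cancel] at this
  have := norm_sub_le_of_le (c := 0) h2
    (by rw [sub_zero]; exact norm_snd_le_of_mem_fracGraph hD hpt zero_le_one hy hy1)
  rwa [sub_zero] at this

theorem snd_eq_of_mem_valueRing (hD : dSer p n d ≠ 0) (hpt : pt ∈ region p n d)
    {ξ : Series p n d} {z z' : ℂ_[p]} (h : (ξ, z) ∈ valueRing hD hpt)
    (h' : (ξ, z') ∈ valueRing hD hpt) : z = z' := by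
  have key : ∀ {z}, (ξ, z) ∈ valueRing hD hpt → (h.1.toBSpace, z) ∈ limGraph hD hpt := by
    intro z hz ε hε
    obtain ⟨m, hm⟩ := exists_pow_lt (p := p) hε
    obtain ⟨y, hy, h1, h2⟩ := hz.2 m
    exact ⟨y, hy, fun l => (h1 l).trans hm.le, h2.trans hm.le⟩
  exact limGraph_unique hD hpt (key h) (key h')

theorem isValue_of_mem_valueRing (hD : dSer p n d ≠ 0) (hD' : Bdd 1 (dSer p n d)⁻¹)
    (hpt : pt ∈ region p n d) {ξ : Series p n d} {z : ℂ_[p]} (hx : (ξ, z) ∈ valueRing hD hpt)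
    {C : ℝ} (h : Bdd C ξ) : IsValue pt h.toBSpace z := by
  refine Metric.mem_closure_iff.2 fun ε hε => ?_
  obtain ⟨m, hm⟩ := exists_pow_lt (p := p) hε
  obtain ⟨⟨_, _⟩, ⟨f, hf, k, rfl, rfl⟩, h1, h2⟩ := hx.2 m
  obtain ⟨C', -, hC'⟩ := exists_bdd_frac f hD' k
  refine ⟨_, mem_graphRtilde_of_sameCoeff hD' pt hf (b := hC'.toBSpace) fun _ => rfl, ?_⟩
  rw [Prod.dist_eq, max_lt_iff, dist_eq_norm, dist_eq_norm]
  exact ⟨(norm_toBSpace_sub_le (pow_nonneg inv_p_pos.le m) h hC' h1).trans_lt hm, h2.trans_lt hm⟩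

/-- Limits of fractions have values at the points of `𝒟`. -/
theorem exists_mem_valueRing (hD : dSer p n d ≠ 0) (hpt : pt ∈ region p n d) {ξ : Series p n d}
    (hξ : ∀ m, ξ ∈ approxRing hD m) : ∃ z, (ξ, z) ∈ valueRing hD hpt := by
  have hy : ∀ m : ℕ, ∃ y ∈ fracGraph hD hpt, Bdd ((p : ℝ)⁻¹ ^ m) (ξ - y.1) := by
    intro m
    obtain ⟨-, _, ⟨h, hh, k, rfl⟩, hf⟩ := hξ m
    exact ⟨(h.toSeries / dSer p n d ^ k, h.eval pt / (detB p n d).eval pt ^ k),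
      ⟨h, hh, k, rfl, rfl⟩, hf⟩
  choose y hy hξy using hy
  -- Approximations modulo $p^m$ and $p^{m'}$ with $m\le m'$ agree modulo $p^m$, hence so do their
  -- values, which therefore form a Cauchy sequence.
  have hle : ∀ {m m' : ℕ}, m ≤ m' → ‖(y m').2 - (y m).2‖ ≤ (p : ℝ)⁻¹ ^ m := by
    intro m m' hmm
    rw [← Prod.snd_sub]
    refine norm_snd_le_of_mem_fracGraph hD hpt (pow_nonneg inv_p_pos.le m)
      ((fracGraph hD hpt).sub_mem (hy m') (hy m)) ?_
    have h1 := (hξy m').mono (pow_le_pow_of_le_one inv_p_pos.le inv_p_lt_one.le hmm)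
    have h2 := (hξy m).sub h1
    rwa [sub_sub_sub_cancel_left] at h2
  have hcauchy : CauchySeq fun m => (y m).2 :=
    cauchySeq_of_le_geometric (p : ℝ)⁻¹ 1 inv_p_lt_one fun m => by
      rw [dist_comm, dist_eq_norm, one_mul]
      exact hle m.le_succ
  obtain ⟨z, hz⟩ := cauchySeq_tendsto_of_complete hcauchy
  refine ⟨z, (hξ 0).1, fun m => ⟨y m, hy m, hξy m, ?_⟩⟩
  exact le_of_tendsto (hz.sub_const (y m).2).norm
    (Filter.eventually_atTop.2 ⟨m, fun m' hm' => hle hm'⟩)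

end Values

/-! ### Eigenvalues of integral matrices with unit determinant -/

section Eigenvalues

variable {p : ℕ} [hp : Fact p.Prime] {ι : Type*} [Fintype ι] [DecidableEq ι]

/-- The ring of integers of `ℂ_p`. -/
def unitBall (p : ℕ) [Fact p.Prime] : Subring ℂ_[p] where
  carrier := {x | ‖x‖ ≤ 1}
  mul_mem' {a b} ha hb := by
    rw [Set.mem_ofPred_eq, norm_mul]
    exact mul_le_one₀ ha (norm_nonneg _) hb
  one_mem' := norm_one.le
  add_mem' ha hb := (IsUltrametricDist.norm_add_le_max _ _).trans (max_le ha hb)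
  zero_mem' := by
    rw [Set.mem_ofPred_eq, norm_zero]
    exact zero_le_one
  neg_mem' {a} ha := by
    rw [Set.mem_ofPred_eq, norm_neg]
    exact ha

/-- Compare norms in a coordinate where the eigenvector is largest. -/
theorem norm_eigenvalue_le_one {Z : Matrix ι ι ℂ_[p]} (hZ : ∀ i j, ‖Z i j‖ ≤ 1) {v : ι → ℂ_[p]}
    (hv : v ≠ 0) {μ : ℂ_[p]} (h : Z.mulVec v = μ • v) : ‖μ‖ ≤ 1 := by
  obtain ⟨i₀, hi₀⟩ := Function.ne_iff.1 hv
  obtain ⟨i, -, hi⟩ := Finset.exists_max_image Finset.univ (fun i => ‖v i‖) ⟨i₀, Finset.mem_univ _⟩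
  have hpos : 0 < ‖v i‖ := (norm_pos_iff.2 hi₀).trans_le (hi i₀ (Finset.mem_univ _))
  have h1 : ‖μ * v i‖ ≤ ‖v i‖ := by
    have h2 : ∑ j, Z i j * v j = μ * v i := congrFun h i
    rw [← h2]
    refine IsUltrametricDist.norm_sum_le_of_forall_le_of_nonneg (norm_nonneg _) fun j _ => ?_
    rw [norm_mul]
    exact (mul_le_of_le_one_left (norm_nonneg _) (hZ i j)).trans (hi j (Finset.mem_univ _))
  rw [norm_mul] at h1
  exact le_of_mul_le_mul_right (by rwa [one_mul]) hpos

/-- The inverse matrix is integral too and has the eigenvalue $\mu^{-1}$ on the same vector. -/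
theorem norm_eigenvalue_eq_one {Z : Matrix ι ι ℂ_[p]} (hZ : ∀ i j, ‖Z i j‖ ≤ 1)
    (hdet : ‖Z.det‖ = 1) {v : ι → ℂ_[p]} (hv : v ≠ 0) {μ : ℂ_[p]} (h : Z.mulVec v = μ • v) :
    ‖μ‖ = 1 := by
  have hdet0 : Z.det ≠ 0 := norm_ne_zero_iff.1 (by rw [hdet]; exact one_ne_zero)
  have hinv : ∀ i j, ‖Z⁻¹ i j‖ ≤ 1 := inv_mem_of_forall_mem (unitBall p) hZ (by
    change ‖Z.det⁻¹‖ ≤ 1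
    rw [norm_inv, hdet, inv_one])
  have hv' : v = μ • Z⁻¹.mulVec v := by
    rw [← Matrix.mulVec_smul, ← h, Matrix.mulVec_mulVec, Matrix.nonsing_inv_mul _ hdet0.isUnit,
      Matrix.one_mulVec]
  have hμ0 : μ ≠ 0 := by
    rintro rfl
    rw [zero_smul] at hv'
    exact hv hv'
  refine le_antisymm (norm_eigenvalue_le_one hZ hv h) ?_
  have h2 : ‖μ⁻¹‖ ≤ 1 := norm_eigenvalue_le_one hinv hv (by
    conv_rhs => rw [hv', smul_smul, inv_mul_cancel₀ hμ0, one_smul])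
  rw [norm_inv] at h2
  exact (inv_le_one₀ (norm_pos_iff.2 hμ0)).1 h2

theorem norm_charpoly_root_eq_one {Z : Matrix ι ι ℂ_[p]} (hZ : ∀ i j, ‖Z i j‖ ≤ 1)
    (hdet : ‖Z.det‖ = 1) {μ : ℂ_[p]} (h : Z.charpoly.IsRoot μ) : ‖μ‖ = 1 := by
  rw [Polynomial.IsRoot, Matrix.eval_charpoly] at h
  obtain ⟨v, hv, hv'⟩ := Matrix.exists_mulVec_eq_zero_iff.2 h
  refine norm_eigenvalue_eq_one hZ hdet hv ?_
  rw [Matrix.sub_mulVec, sub_eq_zero] at hv'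
  rw [← hv', Matrix.scalar_apply, ← Matrix.smul_one_eq_diagonal, Matrix.smul_mulVec,
    Matrix.one_mulVec]

theorem norm_reciprocal_root_eq_one {Z : Matrix ι ι ℂ_[p]} (hZ : ∀ i j, ‖Z i j‖ ≤ 1)
    (hdet : ‖Z.det‖ = 1) {t : ℂ_[p]} (h : (1 - t • Z).det = 0) : ‖t‖ = 1 := by
  obtain ⟨v, hv, hv'⟩ := Matrix.exists_mulVec_eq_zero_iff.2 h
  rw [Matrix.sub_mulVec, sub_eq_zero, Matrix.one_mulVec, Matrix.smul_mulVec] at hv'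
  have ht0 : t ≠ 0 := by
    rintro rfl
    rw [zero_smul] at hv'
    exact hv hv'
  have h1 := norm_eigenvalue_eq_one hZ hdet hv (μ := t⁻¹) (by
    conv_rhs => rw [hv', smul_smul, inv_mul_cancel₀ ht0, one_smul])
  rwa [norm_inv, inv_eq_one] at h1

end Eigenvalues

/-! ### The value of the determinant and the conclusion -/

section Conclusion

variable {p : ℕ} [hp : Fact p.Prime] {n d : ℕ} {γ₀ : ℂ_[p]}
  (hγ₀ : HasSum (fun i : ℕ => γ₀ ^ p ^ i / (p : ℂ_[p]) ^ i) 0)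
  (hγ₀' : ‖γ₀‖ ^ (p - 1) = (p : ℝ)⁻¹)

include hγ₀ hγ₀' in
theorem norm_coeff_zero_det_calG_inv : ‖((calG γ₀ n d).det⁻¹).coeff 0‖ = 1 := by
  have h := coeff_zero_mul (det_calG_mem_posRing (n := n) (d := d) hγ₀ hγ₀')
    (det_calG_inv_mem_posRing hγ₀ hγ₀')
  rw [mul_inv_cancel₀ (det_calG_ne_zero hγ₀ hγ₀'), coeff_zero_det_calG hγ₀ hγ₀', one_mul,
    HahnSeries.coeff_one, if_pos rfl] at h
  rw [← h, norm_one]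

/-- A determinant over the product ring, of which `valueRing` is a subring, is the pair of the
determinants of the two projections. -/
theorem det_mem_valueRing (hD : dSer p n d ≠ 0) {pt : Mon n d → ℂ_[p]} (hpt : pt ∈ region p n d)
    {ι : Type*} [Fintype ι] [DecidableEq ι] {A : Matrix ι ι (Series p n d)} {Z : Matrix ι ι ℂ_[p]}
    (h : ∀ i j, (A i j, Z i j) ∈ valueRing hD hpt) : (A.det, Z.det) ∈ valueRing hD hpt := by
  have h1 := det_mem_of_forall_mem (valueRing hD hpt)
    (A := (Matrix.of fun i j => (A i j, Z i j) : Matrix ι ι (Series p n d × ℂ_[p]))) h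
  have h2 : (Matrix.of fun i j => (A i j, Z i j) : Matrix ι ι (Series p n d × ℂ_[p])).det =
      (A.det, Z.det) :=
    Prod.ext (RingHom.map_det (RingHom.fst (Series p n d) ℂ_[p]) _)
      (RingHom.map_det (RingHom.snd (Series p n d) ℂ_[p]) _)
  rwa [h2] at h1

include hγ₀ hγ₀' in
/-- The value of the determinant of `𝒢(Λ)` at a point of `𝒟` is a unit. -/
theorem norm_det_value_eq_one (hD : dSer p n d ≠ 0) {pt : Mon n d → ℂ_[p]}
    (hpt : pt ∈ region p n d) {Z : Matrix (IntMon n d) (IntMon n d) ℂ_[p]}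
    (h : ∀ i j, (calG γ₀ n d i j, Z i j) ∈ valueRing hD hpt) : ‖Z.det‖ = 1 := by
  have h1 := det_mem_valueRing hD hpt h
  obtain ⟨z, hz⟩ := exists_mem_valueRing hD hpt fun m =>
    det_calG_inv_mem_approxRing hγ₀ hγ₀' hD (calG_mem_approxRing hγ₀ hγ₀' hD m)
  have h2 : (1, Z.det * z) ∈ valueRing hD hpt := by
    have := (valueRing hD hpt).mul_mem h1 hz
    rwa [Prod.mk_mul_mk, mul_inv_cancel₀ (det_calG_ne_zero hγ₀ hγ₀')] at this
  -- The constant series $1$ has only one value, so the values of $\det\mathcal G$ and its inverse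
  -- are inverse to each other; both are integral.
  have h3 : Z.det * z = 1 := snd_eq_of_mem_valueRing hD hpt h2 (valueRing hD hpt).one_mem
  have h4 := norm_snd_le_one_of_mem_valueRing hD hpt h1
  have h5 := norm_snd_le_one_of_mem_valueRing hD hpt hz
  refine le_antisymm h4 ?_
  rw [← norm_one (α := ℂ_[p]), ← h3, norm_mul]
  exact mul_le_of_le_one_right (norm_nonneg _) h5

end Conclusion

end HasseWitt

open HasseWitt in
theorem proposition8p14 (p : ℕ) [Fact p.Prime] (n d : ℕ) (hd : n + 1 ≤ d)
    (γ₀ : ℂ_[p]) (hγ₀ : HasSum (fun i : ℕ => γ₀ ^ p ^ i / (p : ℂ_[p]) ^ i) 0)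
    (hγ₀' : ‖γ₀‖ ^ (p - 1) = (p : ℝ)⁻¹) :
    -- the coefficients of `G(Λ)` are given by convergent sums, and `G(Λ^p)` is invertible
    (∀ (i j : IntMon n d) (l : Expo n d), Summable (gTerm γ₀ i (-aVec j.1) (l - eVec j.1))) ∧
    IsUnit ((gMat γ₀ n d).map frob) ∧
    -- the entries of `𝒢(Λ)` lie in `R'_0`, and `det 𝒢(Λ)` and its inverse have norm one there
    ∃ Γ : IntMon n d → IntMon n d → BSpace p n d,
      (∀ i j, Γ i j ∈ ringR0 p n d ∧ SameCoeff (Γ i j) (calG γ₀ n d i j)) ∧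
      (∃ δ ∈ ringR0 p n d, SameCoeff δ (calG γ₀ n d).det ∧ ‖δ‖ = 1) ∧
      IsUnit (calG γ₀ n d).det ∧
      (∃ δ ∈ ringR0 p n d, SameCoeff δ (calG γ₀ n d).det⁻¹ ∧ ‖δ‖ = 1) ∧
      -- at each point of `𝒟` the entries have well-defined values, which form a matrix `Z = 𝒢(λ)`
      -- whose eigenvalues and reciprocal eigenvalues are units
      ∀ pt ∈ region p n d, ∃ Z : Matrix (IntMon n d) (IntMon n d) ℂ_[p],
        (∀ i j z, IsValue pt (Γ i j) z ↔ z = Z i j) ∧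
        (∀ μ : ℂ_[p], Z.charpoly.IsRoot μ → ‖μ‖ = 1) ∧
        (∀ t : ℂ_[p], (1 - t • Z).det = 0 → ‖t‖ = 1) := by
  have hD : dSer p n d ≠ 0 := dSer_ne_zero hγ₀ hγ₀'
  have hD' : Bdd 1 (dSer p n d)⁻¹ := (dSer_inv_mem_posRing hγ₀ hγ₀').1
  have hG : ∀ i j, calG γ₀ n d i j ∈ posRing p n d := calG_mem_posRing hγ₀ hγ₀'
  have hGm : ∀ m i j, calG γ₀ n d i j ∈ approxRing hD m := calG_mem_approxRing hγ₀ hγ₀' hD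
  have hdet : (calG γ₀ n d).det ∈ posRing p n d := det_calG_mem_posRing hγ₀ hγ₀'
  have hdet' : (calG γ₀ n d).det⁻¹ ∈ posRing p n d := det_calG_inv_mem_posRing hγ₀ hγ₀'
  refine ⟨fun i j l => summable_gTerm hγ₀ hγ₀' (neg_aVec_last j.1) _,
    isUnit_gMat_map_frob hγ₀ hγ₀', fun i j => (hG i j).1.toBSpace,
    fun i j => ⟨toBSpace_mem_ringR0 hD hD' (hG i j) fun m => hGm m i j, fun _ => rfl⟩,
    ⟨hdet.1.toBSpace, toBSpace_mem_ringR0 hD hD' hdet fun m => det_mem_of_forall_mem _ (hGm m),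
      fun _ => rfl, hdet.1.norm_toBSpace_eq_one (l := 0) ?_⟩,
    (det_calG_ne_zero hγ₀ hγ₀').isUnit,
    ⟨hdet'.1.toBSpace, toBSpace_mem_ringR0 hD hD' hdet' fun m =>
      det_calG_inv_mem_approxRing hγ₀ hγ₀' hD (hGm m), fun _ => rfl,
      hdet'.1.norm_toBSpace_eq_one (l := 0) (norm_coeff_zero_det_calG_inv hγ₀ hγ₀')⟩,
    fun pt hpt => ?_⟩
  · rw [coeff_zero_det_calG hγ₀ hγ₀', norm_one]
  · choose Z hZ using fun i j => exists_mem_valueRing hD hpt fun m => hGm m i j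
    have hZ1 : ∀ i j, ‖Z i j‖ ≤ 1 := fun i j => norm_snd_le_one_of_mem_valueRing hD hpt (hZ i j)
    have hZdet : ‖(Matrix.of Z).det‖ = 1 := norm_det_value_eq_one hγ₀ hγ₀' hD hpt hZ
    have hval : ∀ i j, IsValue pt (hG i j).1.toBSpace (Z i j) := fun i j =>
      isValue_of_mem_valueRing hD hD' hpt (hZ i j) (hG i j).1
    refine ⟨Matrix.of Z, fun i j z => ⟨fun h => isValue_unique hD hpt h (hval i j), ?_⟩,
      fun μ hμ => norm_charpoly_root_eq_one hZ1 hZdet hμ,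
      fun t ht => norm_reciprocal_root_eq_one hZ1 hZdet ht⟩
    rintro rfl
    exact hval i j
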